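/- Let $K$ be a field of characteristic different from $2$. All superalgebras are $\mathbb{Z}/2$-graded associative unital $K$-algebras $A=A_0\oplus A_1$ with $ab=(-1)^{|a||b|}ba$ for homogeneous $a,b$; morphisms are the degree-preserving $K$-algebra homomorphisms. Let $\mathsf{SAlg}_K$ be their category. (Sets, index sets and superalgebras are small with respect to a fixed universe.) **Superschemes.** A $K$-functor is a functor $\mathsf{SAlg}_K\to\mathsf{Sets}$; put $SSp\,A=\mathrm{Hom}(A,-)$. For a superideal $I$ of $A$ let $D(I)(B)=\{x\in \mathrm{Hom}(A,B) : x(I)B=B\}$. A subfunctor $Y\subseteq X$ of a $K$-functor is open if for every morphism $f: SSp\,A\to X$ the preimage $f^{-1}(Y)$ equals $D(I)$ for some superideal $I$ of $A$. Open subfunctors $(Y_i)_{i\in J}$ cover $X$ if $X(F)=\bigcup_i Y_i(F)$ for every (purely even) field extension $F$ of $K$. A $K$-functor is local if it satisfies the sheaf condition for all families $(SSp\,R_{f_i}\to SSp\,R)_{1\le i\le n}$, $n\ge 0$, with $f_i\in R_0$ and $\sum_i R_0f_i=R_0$. A superscheme is a local $K$-functor that has an open covering by subfunctors isomorphic to functors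 $SSp\,A_i$. Let $\mathcal{SF}$ be the full subcategory of superschemes in the category $\mathcal F$ of $K$-functors. **Geometric superschemes.** A prime (maximal) superideal of $A$ is an ideal $p_0\oplus A_1$ with $p_0$ a prime (maximal) ideal of $A_0$; $A$ is local if it has exactly one maximal superideal, and a morphism of local superalgebras is local if it maps the maximal superideal into the maximal superideal. A geometric superspace is a topological space with a sheaf of superalgebras whose stalks are local; a morphism consists of a continuous map and a morphism of sheaves of superalgebras that is local on stalks. These form a category $\mathcal V$. The affine superspace $SSpec\,A$ is the set of prime superideals of $A$ with the Zariski topology and with the sheaf whose sections on $U$ are the functions $h$ on $U$ with $h(p)\in A_p=(A_0\setminus p_0)^{-1}A$ that are locally of the form $a/s$ with $a\in A$, $s\in A_0$. A geometric superscheme is a geometric superspace that is covered by open subspaces isomorphic to affine superspaces. Let $\mathcal{SV}\subseteq\mathcal V$ be the full subcategory of geometric superschemes. **The functors.** For $Y\in\mathcal V$ let $Y^\diamond$ be the $K$-functor $R\mapsto \mathrm{Mor}_{\mathcal V}(SSpec\,R,Y)$. For a $K$-functor $X$ the geometric realization $|X|$ is the colimit in $\mathcal V$ of the diagram $(R,x)\mapsto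 SSpec\,R$, indexed by the opposite of the category of pairs $(R,x)$ with $R\in\mathsf{SAlg}_K$, $x\in X(R)$; a morphism $f:X\to X'$ induces the morphism $|f|:|X|\to|X'|$ with $|f|\circ i_x=i_{f(x)}$, where $i_x:SSpec\,R\to|X|$ are the canonical morphisms. **Theorem (Comparison Theorem).** For every superscheme $X$ the geometric realization $|X|$ exists and is a geometric superscheme; for every geometric superscheme $Y$ the $K$-functor $Y^\diamond$ is a superscheme. The resulting functors $\mathcal{SF}\to\mathcal{SV}$, $X\mapsto|X|$, and $\mathcal{SV}\to\mathcal{SF}$, $Y\mapsto Y^\diamond$, are equivalences of categories which are quasi-inverse to each other. -/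

import Mathlib

open CategoryTheory Opposite TopologicalSpace AlgebraicGeometry

universe u

noncomputable section

/-- A supercommutative superalgebra over `K`: a `ℤ/2`-graded associative unital `K`-algebra with
`a b = (-1)^{|a||b|} b a` for homogeneous `a`, `b`. -/
structure SAlg (K : Type u) [Field K] : Type (u + 1) where
  carrier : Type u
  [ring : Ring carrier]
  [algebra : Algebra K carrier]
  grading : ZMod 2 → Submodule K carrier
  [graded : GradedAlgebra grading]
  supercomm : ∀ (i j : ZMod 2) (a b : carrier), a ∈ grading i → b ∈ grading j →
    a * b = (-1) ^ (i.val * j.val) * (b * a)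

namespace SAlg

attribute [instance] SAlg.ring SAlg.algebra SAlg.graded

variable {K : Type u} [Field K]

instance : CoeSort (SAlg K) (Type u) := ⟨SAlg.carrier⟩

/-- Morphisms of superalgebras are the degree preserving homomorphisms of `K`-algebras. -/
instance : Category (SAlg K) where
  Hom A B := A.grading →ₐᵍ[K] B.grading
  id A := GradedAlgHom.id K A.grading
  comp f g := GradedAlgHom.comp g f

instance : ConcreteCategory (SAlg K) (fun A B => A.grading →ₐᵍ[K] B.grading) where
  hom f := f
  ofHom f := f

theorem even_comm (A : SAlg K) {a : A} (ha : a ∈ A.grading 0) (b : A) : a * b = b * a := by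
  classical
  rw [← DirectSum.sum_support_decompose A.grading b, Finset.mul_sum, Finset.sum_mul]
  refine Finset.sum_congr rfl fun j _ => ?_
  have := A.supercomm 0 j a _ ha (DirectSum.decompose A.grading b j).2
  simpa using this

/-- The even part `A₀`. -/
abbrev Even (A : SAlg K) : Type u := A.grading 0

instance (A : SAlg K) : CommRing A.Even :=
  { (inferInstance : Ring (A.grading 0)) with
    mul_comm := fun a b => Subtype.ext (A.even_comm a.2 b.1) }

instance (A : SAlg K) : Algebra A.Even A where
  algebraMap := 
    { toFun := Subtype.val, map_one' := rfl, map_mul' := fun _ _ => rfl, map_zero' := rfl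
      map_add' := fun _ _ => rfl }
  smul a b := a.1 * b
  commutes' a b := A.even_comm a.2 b
  smul_def' _ _ := rfl

instance (A : SAlg K) : IsScalarTower K A.Even A := ⟨fun k a b => by
  show (k • a.1) * b = k • (a.1 * b)
  simp⟩


/-- A `ℤ/2`-indexed family of submodules which respects multiplication and whose two members are
complementary is a grading. -/
abbrev gradedOfIsCompl {A : Type u} [Ring A] [Algebra K A] (𝒜 : ZMod 2 → Submodule K A)
    [SetLike.GradedMonoid 𝒜] (h : IsCompl (𝒜 0) (𝒜 1)) : GradedAlgebra 𝒜 :=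
  { (inferInstance : SetLike.GradedMonoid 𝒜),
    DirectSum.IsInternal.chooseDecomposition 𝒜
      ((DirectSum.isInternal_submodule_iff_isCompl 𝒜 (i := 0) (j := 1) (by decide)
        (by ext x; revert x; simp; decide)).2 h) with }

theorem isCompl (A : SAlg K) : IsCompl (A.grading 0) (A.grading 1) :=
  (DirectSum.isInternal_submodule_iff_isCompl A.grading (i := 0) (j := 1) (by decide)
    (by ext x; revert x; simp; decide)).1 (DirectSum.Decomposition.isInternal _)

theorem exists_add (A : SAlg K) (a : A) :
    ∃ b ∈ A.grading 0, ∃ c ∈ A.grading 1, b + c = a :=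
  Submodule.mem_sup.1 (A.isCompl.sup_eq_top ▸ Submodule.mem_top (x := a))

theorem eq_zero_of_mem (A : SAlg K) {a : A} (h₀ : a ∈ A.grading 0) (h₁ : a ∈ A.grading 1) :
    a = 0 :=
  Submodule.disjoint_def.1 A.isCompl.disjoint a h₀ h₁

theorem eq_of_add_eq (A : SAlg K) {b b' c c' : A} (hb : b ∈ A.grading 0) (hb' : b' ∈ A.grading 0)
    (hc : c ∈ A.grading 1) (hc' : c' ∈ A.grading 1) (h : b + c = b' + c') : b = b' ∧ c = c' := by
  have e : b - b' = c' - c := by rw [sub_eq_sub_iff_add_eq_add, h, add_comm]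
  have h0 : b - b' = 0 := A.eq_zero_of_mem (sub_mem hb hb') (e ▸ sub_mem hc' hc)
  exact ⟨sub_eq_zero.1 h0, (sub_eq_zero.1 (e.symm.trans h0)).symm⟩

theorem smul_mem (A : SAlg K) (i : ZMod 2) (s : A.Even) {a : A} (ha : a ∈ A.grading i) :
    s • a ∈ A.grading i := by
  have := SetLike.mul_mem_graded s.2 ha
  rwa [zero_add] at this

section Localization

variable (A : SAlg K) (S : Submonoid A.Even)

instance : Algebra K (LocalizedModule S A) :=
  Algebra.ofModule
    (fun k x y => by
      induction x using LocalizedModule.induction_on with | _ a s =>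
      induction y using LocalizedModule.induction_on with | _ b t =>
      rw [LocalizedModule.smul'_mk, LocalizedModule.mk_mul_mk, LocalizedModule.mk_mul_mk,
        LocalizedModule.smul'_mk, smul_mul_assoc])
    (fun k x y => by
      induction x using LocalizedModule.induction_on with | _ a s =>
      induction y using LocalizedModule.induction_on with | _ b t =>
      rw [LocalizedModule.smul'_mk, LocalizedModule.mk_mul_mk, LocalizedModule.mk_mul_mk,
        LocalizedModule.smul'_mk, mul_smul_comm])

/-- The homogeneous elements of degree `i` of `S⁻¹A`: the fractions `a / s` with `a` of degree
`i`. -/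
def locGrading (i : ZMod 2) : Submodule K (LocalizedModule S A) where
  carrier := {x | ∃ a ∈ A.grading i, ∃ s : S, x = LocalizedModule.mk a s}
  add_mem' := by
    rintro _ _ ⟨a, ha, s, rfl⟩ ⟨b, hb, t, rfl⟩
    exact ⟨_, add_mem (A.smul_mem i t.1 ha) (A.smul_mem i s.1 hb), s * t,
      LocalizedModule.mk_add_mk⟩
  zero_mem' := ⟨0, zero_mem _, 1, (LocalizedModule.zero_mk 1).symm⟩
  smul_mem' := by
    rintro k _ ⟨a, ha, s, rfl⟩
    exact ⟨k • a, Submodule.smul_mem _ k ha, s, LocalizedModule.smul'_mk k a s⟩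

instance : SetLike.GradedMonoid (A.locGrading S) where
  one_mem := ⟨1, SetLike.GradedOne.one_mem, 1, OreLocalization.one_def⟩
  mul_mem := by
    rintro i j _ _ ⟨a, ha, s, rfl⟩ ⟨b, hb, t, rfl⟩
    exact ⟨a * b, SetLike.mul_mem_graded ha hb, s * t, LocalizedModule.mk_mul_mk⟩

theorem locGrading_isCompl : IsCompl (A.locGrading S 0) (A.locGrading S 1) := by
  constructor
  · rw [Submodule.disjoint_def]
    rintro _ ⟨a, ha, s, rfl⟩ ⟨b, hb, t, h⟩
    obtain ⟨u, hu⟩ := LocalizedModule.mk_eq.1 h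
    rw [← LocalizedModule.zero_mk 1]
    refine LocalizedModule.mk_eq.2 ⟨u * t, ?_⟩
    have h1 : u.1 • t.1 • a = u.1 • s.1 • b := hu
    have h0 : u.1 • t.1 • a = 0 := A.eq_zero_of_mem (A.smul_mem _ _ (A.smul_mem _ _ ha))
      (h1 ▸ A.smul_mem _ _ (A.smul_mem _ _ hb))
    simpa [Submonoid.smul_def, mul_smul] using h0
  · rw [codisjoint_iff, eq_top_iff]
    rintro x -
    induction x using LocalizedModule.induction_on with | _ a s =>
    obtain ⟨b, hb, c, hc, rfl⟩ := A.exists_add a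
    rw [show LocalizedModule.mk (b + c) s = LocalizedModule.mk b s + LocalizedModule.mk c s from
      OreLocalization.add_oreDiv.symm]
    exact Submodule.add_mem_sup ⟨b, hb, s, rfl⟩ ⟨c, hc, s, rfl⟩

theorem locGrading_supercomm (i j : ZMod 2) (x y : LocalizedModule S A)
    (hx : x ∈ A.locGrading S i) (hy : y ∈ A.locGrading S j) :
    x * y = (-1) ^ (i.val * j.val) * (y * x) := by
  obtain ⟨a, ha, s, rfl⟩ := hx
  obtain ⟨b, hb, t, rfl⟩ := hy
  rw [LocalizedModule.mk_mul_mk, LocalizedModule.mk_mul_mk, A.supercomm i j a b ha hb, mul_comm s t]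
  rcases Nat.even_or_odd (i.val * j.val) with h | h
  · rw [h.neg_one_pow, h.neg_one_pow, one_mul, one_mul]
  · rw [h.neg_one_pow, h.neg_one_pow, neg_one_mul, neg_one_mul, LocalizedModule.mk_neg]

/-- The localization `S⁻¹A` of `A` at a multiplicative set `S` of even elements. -/
def localization : SAlg K where
  carrier := LocalizedModule S A
  grading := A.locGrading S
  graded := gradedOfIsCompl _ (A.locGrading_isCompl S)
  supercomm := A.locGrading_supercomm S

theorem fraction_unique (g h : LocalizedModule S A) (hg : g ∈ A.locGrading S 0)
    (hh : h ∈ A.locGrading S 1) {b c : A} (hb : b ∈ A.grading 0) (hc : c ∈ A.grading 1) (s : S)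
    (e : g + h = LocalizedModule.mk (b + c) s) :
    g = LocalizedModule.mk b s ∧ h = LocalizedModule.mk c s :=
  (A.localization S).eq_of_add_eq (b := g) (c := h) hg ⟨b, hb, s, rfl⟩ hh ⟨c, hc, s, rfl⟩
    (e.trans OreLocalization.add_oreDiv.symm)

theorem mul_eq_one (z w : LocalizedModule S A) (b t : A.Even) (hb : b ∈ S) (ht : t ∈ S)
    (hz : z = LocalizedModule.mk b.1 ⟨t, ht⟩) (hw : w = LocalizedModule.mk t.1 ⟨b, hb⟩) :
    z * w = 1 := by
  rw [hz, hw, LocalizedModule.mk_mul_mk, OreLocalization.one_def]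
  refine LocalizedModule.mk_eq.2 ⟨1, ?_⟩
  exact congrArg (1 • ·) ((one_smul A.Even _).trans ((A.even_comm b.2 _).trans
    (mul_one _).symm))

theorem mk_mul_one (a b : A) : (LocalizedModule.mk (a * b) 1 : LocalizedModule S A) =
    LocalizedModule.mk a 1 * LocalizedModule.mk b 1 := by
  rw [LocalizedModule.mk_mul_mk, one_mul]

/-- The canonical map `A → S⁻¹A`. -/
def toLocalization : A ⟶ A.localization S where
  toFun a := LocalizedModule.mk a 1
  map_one' := OreLocalization.one_def.symm
  map_mul' := A.mk_mul_one S
  map_zero' := LocalizedModule.zero_mk 1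
  map_add' a b := OreLocalization.add_oreDiv.symm
  commutes' k := by
    show LocalizedModule.mk (algebraMap K A k) 1 = algebraMap K (LocalizedModule S A) k
    rw [Algebra.algebraMap_eq_smul_one, Algebra.algebraMap_eq_smul_one, OreLocalization.one_def,
      LocalizedModule.smul'_mk]
  map_mem ha := ⟨_, ha, 1, rfl⟩

end Localization

theorem hom_map_mem {A B : SAlg K} (f : A ⟶ B) {i : ZMod 2} {a : A} (ha : a ∈ A.grading i) :
    f a ∈ B.grading i :=
  GradedAlgHom.map_mem f ha

/-- The homomorphism `A₀ → B₀` induced by a morphism of superalgebras. -/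
def evenMap {A B : SAlg K} (f : A ⟶ B) : A.Even →+* B.Even where
  toFun a := ⟨f a.1, hom_map_mem f a.2⟩
  map_one' := Subtype.ext (map_one (ConcreteCategory.hom f))
  map_mul' a b := Subtype.ext (map_mul (ConcreteCategory.hom f) a.1 b.1)
  map_zero' := Subtype.ext (map_zero (ConcreteCategory.hom f))
  map_add' a b := Subtype.ext (map_add (ConcreteCategory.hom f) a.1 b.1)

variable (K) in
/-- The functor `A ↦ A₀`. -/
def evenPart : SAlg K ⥤ CommRingCat.{u} where
  obj A := CommRingCat.of A.Even
  map f := CommRingCat.ofHom (evenMap f)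

end SAlg

/-! ### `K`-functors and superschemes -/

section KFunctors

variable (K : Type u) [Field K]

/-- A `K`-functor is a functor from superalgebras to sets. -/
abbrev KFunctor := SAlg K ⥤ Type u

variable {K}

/-- The affine superscheme `SSp A`. -/
abbrev SSp (A : SAlg K) : KFunctor K := coyoneda.obj (op A)

/-- A superideal is a homogeneous ideal; by supercommutativity it does not matter whether one
takes left, right or two-sided ideals. -/
abbrev SAlg.Superideal (A : SAlg K) := HomogeneousIdeal A.grading

/-- The subfunctor `D(I)` of `SSp A`: the morphisms `x : A ⟶ B` such that `x(I)` generates the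
unit ideal of `B`. -/
def basicOpenSubfunctor (A : SAlg K) (I : A.Superideal) : Subfunctor (SSp A) where
  obj B := {x : A ⟶ B | Ideal.span ((fun a : A => x a) '' (I : Set A)) = ⊤}
  map {B C} f x hx := by
    have hx' : Ideal.span ((fun a : A => (show A ⟶ B from x) a) '' (I : Set A)) = ⊤ := hx
    have h := congrArg (Ideal.map (ConcreteCategory.hom f)) hx'
    rw [Ideal.map_span, Ideal.map_top, ← Set.image_comp] at h
    exact h

/-- A subfunctor is open if its preimage under each morphism from an affine superscheme `SSp A`
is of the form `D(I)` for a superideal `I` of `A`. -/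
def IsOpenSubfunctor {X : KFunctor K} (Y : Subfunctor X) : Prop :=
  ∀ (A : SAlg K) (f : SSp A ⟶ X), ∃ I : A.Superideal, Y.preimage f = basicOpenSubfunctor A I

/-- The superalgebra `F` is a field extension of `K` (in particular purely even). -/
def SAlg.IsFieldExtension (F : SAlg K) : Prop := F.grading 1 = ⊥ ∧ IsField F

/-- A family of open subfunctors of `X` is an open covering if it covers `X` on field
extensions of `K`. -/
def IsOpenCovering {X : KFunctor K} {ι : Type u} (Y : ι → Subfunctor X) : Prop :=
  (∀ i, IsOpenSubfunctor (Y i)) ∧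
    ∀ F : SAlg K, F.IsFieldExtension → ∀ x : X.obj F, ∃ i, x ∈ (Y i).obj F

/-- A `K`-functor is local if it is a sheaf for the coverings `{SSp R_{f_i} ⟶ SSp R}`, where
`f_1, …, f_n` are even elements of `R` generating the unit ideal of `R₀`. -/
def IsLocalFunctor (X : KFunctor K) : Prop :=
  ∀ (R : SAlg K) (n : ℕ) (f : Fin n → R.Even), Ideal.span (Set.range f) = ⊤ →
    Presieve.IsSheafFor (unopUnop (SAlg K) ⋙ X)
      (Presieve.ofArrows (fun i => op (R.localization (Submonoid.powers (f i))))
        fun i => (R.toLocalization (Submonoid.powers (f i))).op)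

/-- A superscheme is a local `K`-functor which has an open covering by affine superschemes. -/
def IsSuperscheme : ObjectProperty (KFunctor K) := fun X =>
  IsLocalFunctor X ∧ ∃ (ι : Type u) (Y : ι → Subfunctor X), IsOpenCovering Y ∧
    ∀ i, ∃ A : SAlg K, Nonempty ((Y i).toFunctor ≅ SSp A)

end KFunctors

/-! ### Geometric superspaces -/

section Superspaces

variable (K : Type u) [Field K]

/-- A morphism of spaces with a presheaf of commutative rings is local on stalks. -/
def IsLocalOnStalks {X Y : PresheafedSpace.{u, u + 1, u} CommRingCat.{u}} (f : X ⟶ Y) : Prop :=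
  ∀ x : X, IsLocalHom (f.stalkMap x).hom

theorem IsLocalOnStalks.id (X : PresheafedSpace.{u, u + 1, u} CommRingCat.{u}) :
    IsLocalOnStalks (𝟙 X) := fun x => by
  rw [PresheafedSpace.stalkMap.id]
  exact isLocalHom_id _

theorem IsLocalOnStalks.comp {X Y Z : PresheafedSpace.{u, u + 1, u} CommRingCat.{u}} {f : X ⟶ Y}
    {g : Y ⟶ Z} (hf : IsLocalOnStalks f) (hg : IsLocalOnStalks g) : IsLocalOnStalks (f ≫ g) :=
  fun x => by
    rw [PresheafedSpace.stalkMap.comp]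
    apply +allowSynthFailures RingHom.isLocalHom_comp
    exacts [hf x, hg (f.base x)]

/-- The functor replacing the presheaf of superalgebras `𝒪` of a space by the presheaf of
commutative rings `U ↦ 𝒪(U)₀`. -/
abbrev evenSpace : PresheafedSpace.{u, u + 1, u} (SAlg K) ⥤
    PresheafedSpace.{u, u + 1, u} CommRingCat.{u} :=
  (SAlg.evenPart K).mapPresheaf

/-- A geometric superspace: a topological space with a sheaf of superalgebras all of whose stalks
are local.  The maximal superideals of a superalgebra `A` are the `𝔪₀ ⊕ A₁` with `𝔪₀` a maximal
ideal of `A₀`, so that `A` is local if and only if the ring `A₀` is; and the even part of the stalk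
of a sheaf of superalgebras is the stalk of its even part. -/
structure GeomSuperspace extends PresheafedSpace.{u, u + 1, u} (SAlg K) where
  isSheaf : TopCat.Presheaf.IsSheaf (presheaf ⋙ forget (SAlg K))
  isLocalRing : ∀ x : (evenSpace K).obj toPresheafedSpace,
    IsLocalRing (((evenSpace K).obj toPresheafedSpace).presheaf.stalk x)

variable {K}

namespace GeomSuperspace

/-- A morphism of geometric superspaces: a continuous map with a morphism of sheaves of
superalgebras that is local on stalks.  (A morphism `A → B` of local superalgebras maps
`𝔪₀ ⊕ A₁` into `𝔫₀ ⊕ B₁` if and only if `A₀ → B₀` is local.) -/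
@[ext]
structure Hom (X Y : GeomSuperspace K) : Type u where
  hom : X.toPresheafedSpace ⟶ Y.toPresheafedSpace
  isLocal : IsLocalOnStalks ((evenSpace K).map hom)

instance : Category (GeomSuperspace K) where
  Hom := Hom
  id X := ⟨𝟙 _, by rw [CategoryTheory.Functor.map_id]; exact IsLocalOnStalks.id _⟩
  comp f g := ⟨f.hom ≫ g.hom, by
    rw [CategoryTheory.Functor.map_comp]; exact f.isLocal.comp g.isLocal⟩

/-- The open subspace of a geometric superspace. -/
def restrict (X : GeomSuperspace K) (U : Opens X.carrier) : GeomSuperspace K where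
  toPresheafedSpace := X.toPresheafedSpace.restrict U.isOpenEmbedding
  isSheaf := TopCat.Presheaf.isSheaf_of_isOpenEmbedding U.isOpenEmbedding X.isSheaf
  isLocalRing x :=
    have : IsLocalRing (((evenSpace K).obj X.toPresheafedSpace).presheaf.stalk (U.inclusion' x)) :=
      X.isLocalRing (U.inclusion' x)
    (((evenSpace K).obj X.toPresheafedSpace).restrictStalkIso U.isOpenEmbedding
      x).symm.commRingCatIsoToRingEquiv.isLocalRing

end GeomSuperspace
end Superspaces

/-! ### Affine superspaces -/

namespace SAlg

variable {K : Type u} [Field K]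

section LocalizationMap

variable {A B C : SAlg K}

/-- The morphism `S⁻¹A → T⁻¹B`, `a / s ↦ φ(a) / φ(s)`, induced by `φ : A → B` with `φ(S) ⊆ T`. -/
def locMapFun (φ : A ⟶ B) (S : Submonoid A.Even) (T : Submonoid B.Even)
    (h : S ≤ T.comap (evenMap φ)) (x : LocalizedModule S A) : LocalizedModule T B :=
  x.liftOn (fun y => LocalizedModule.mk (φ y.1) ⟨evenMap φ y.2, h y.2.2⟩) (by
    rintro ⟨a, s⟩ ⟨b, t⟩ ⟨u, hu⟩
    refine LocalizedModule.mk_eq.2 ⟨⟨evenMap φ u, h u.2⟩, ?_⟩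
    have key : ∀ (r r' : A.Even) (c : A), φ (r • r' • c) = evenMap φ r • evenMap φ r' • φ c := by
      intro r r' c
      exact (map_mul (ConcreteCategory.hom φ) _ _).trans
        (congrArg _ (map_mul (ConcreteCategory.hom φ) _ _))
    have := congrArg φ hu
    exact (key u.1 t.1 a).symm.trans (this.trans (key u.1 s.1 b)))

theorem locMapFun_mk (φ : A ⟶ B) (S : Submonoid A.Even) (T : Submonoid B.Even)
    (h : S ≤ T.comap (evenMap φ)) (a : A) (s : S) :
    locMapFun φ S T h (LocalizedModule.mk a s) =
      LocalizedModule.mk (φ a) ⟨evenMap φ s, h s.2⟩ :=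
  LocalizedModule.liftOn_mk ..

theorem hom_smul (φ : A ⟶ B) (s : A.Even) (a : A) : φ (s • a) = evenMap φ s • φ a :=
  map_mul (ConcreteCategory.hom φ) _ _

theorem algebraMap_eq_mk (S : Submonoid A.Even) (k : K) :
    algebraMap K (LocalizedModule S A) k = LocalizedModule.mk (algebraMap K A k) 1 := by
  rw [Algebra.algebraMap_eq_smul_one, Algebra.algebraMap_eq_smul_one, OreLocalization.one_def,
      LocalizedModule.smul'_mk]

theorem locMapFun_id (S : Submonoid A.Even) (h : S ≤ S.comap (evenMap (𝟙 A)))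
    (x : LocalizedModule S A) : locMapFun (𝟙 A) S S h x = x := by
  induction x using LocalizedModule.induction_on with | _ a s =>
  exact locMapFun_mk _ _ _ _ _ _

theorem locMapFun_comp (φ : A ⟶ B) (ψ : B ⟶ C) (S : Submonoid A.Even) (T : Submonoid B.Even)
    (R : Submonoid C.Even) (h : S ≤ T.comap (evenMap φ)) (h' : T ≤ R.comap (evenMap ψ))
    (h'' : S ≤ R.comap (evenMap (φ ≫ ψ))) (x : LocalizedModule S A) :
    locMapFun (φ ≫ ψ) S R h'' x = locMapFun ψ T R h' (locMapFun φ S T h x) := by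
  induction x using LocalizedModule.induction_on with | _ a s =>
  rw [locMapFun_mk, locMapFun_mk, locMapFun_mk]
  rfl

/-- `locMapFun` as a morphism of superalgebras. -/
def locMap (φ : A ⟶ B) (S : Submonoid A.Even) (T : Submonoid B.Even)
    (h : S ≤ T.comap (evenMap φ)) : A.localization S ⟶ B.localization T where
  toFun := locMapFun φ S T h
  map_one' := by
    refine (congrArg _ OreLocalization.one_def).trans ?_
    rw [locMapFun_mk]
    refine Eq.trans ?_ OreLocalization.one_def.symm
    congr 1
    · exact map_one (ConcreteCategory.hom φ)
    · exact Subtype.ext (map_one (evenMap φ))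
  map_mul' x y := by
    induction x using LocalizedModule.induction_on with | _ a s =>
    induction y using LocalizedModule.induction_on with | _ b t =>
    refine (congrArg _ LocalizedModule.mk_mul_mk).trans ?_
    rw [locMapFun_mk, locMapFun_mk, locMapFun_mk]
    refine Eq.trans ?_ LocalizedModule.mk_mul_mk.symm
    congr 1
    · exact map_mul (ConcreteCategory.hom φ) _ _
    · exact Subtype.ext (map_mul (evenMap φ) _ _)
  map_zero' := by
    refine (congrArg _ (LocalizedModule.zero_mk 1).symm).trans ?_
    rw [locMapFun_mk]
    refine Eq.trans ?_ (LocalizedModule.zero_mk 1)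
    congr 1
    · exact map_zero (ConcreteCategory.hom φ)
    · exact Subtype.ext (map_one (evenMap φ))
  map_add' x y := by
    induction x using LocalizedModule.induction_on with | _ a s =>
    induction y using LocalizedModule.induction_on with | _ b t =>
    refine (congrArg _ LocalizedModule.mk_add_mk).trans ?_
    rw [locMapFun_mk, locMapFun_mk, locMapFun_mk]
    refine Eq.trans ?_ LocalizedModule.mk_add_mk.symm
    congr 1
    · exact (map_add (ConcreteCategory.hom φ) _ _).trans
        (congrArg₂ _ (hom_smul φ t.1 a) (hom_smul φ s.1 b))
    · exact Subtype.ext (map_mul (evenMap φ) _ _)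
  commutes' k := by
    refine (congrArg _ (algebraMap_eq_mk S k)).trans ?_
    rw [locMapFun_mk]
    refine Eq.trans ?_ (algebraMap_eq_mk T k).symm
    congr 1
    · exact AlgHomClass.commutes (ConcreteCategory.hom φ) k
    · exact Subtype.ext (map_one (evenMap φ))
  map_mem := by
    rintro i _ ⟨a, ha, s, rfl⟩
    exact ⟨φ a, hom_map_mem φ ha, _, locMapFun_mk φ S T h a s⟩

end LocalizationMap

section StructureSheaf

variable (A : SAlg K)

/-- The underlying topological space of `SSpec A`.  The prime superideals of `A` are the `p ⊕ A₁`
with `p` a prime ideal of `A₀`, and the open sets `{p | I ⊄ p ⊕ A₁}`, for `I` a superideal of `A`,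
are the Zariski open sets of the prime spectrum of `A₀`. -/
abbrev specTop : TopCat.{u} := PrimeSpectrum.Top A.Even

/-- The multiplicative set `A₀ ∖ p`. -/
abbrev primeSubmonoid (x : PrimeSpectrum A.Even) : Submonoid A.Even := x.asIdeal.primeCompl

/-- The localization `A_p` at a prime superideal. -/
abbrev atPrime (x : PrimeSpectrum A.Even) : SAlg K := A.localization (A.primeSubmonoid x)

/-- The sections of the structure sheaf of `SSpec A` on `U`: the functions `f` on `U` with
`f p ∈ A_p`, which are locally given by a fraction `a / s` with `a ∈ A`, `s ∈ A₀`. -/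
def sectionsSubalgebra (U : Opens A.specTop) :
    Subalgebra K (∀ x : U, A.atPrime x.1) where
  carrier := {f | (StructureSheaf.isLocallyFraction A.Even A).pred f}
  add_mem' {a b} ha hb := by
    exact (StructureSheaf.sectionsSubmodule (R := A.Even) A.carrier U).add_mem' ha hb
  mul_mem' {a b} ha hb x := by
    obtain ⟨Va, ma, ia, ra, sa, wa⟩ := ha x
    obtain ⟨Vb, mb, ib, rb, sb, wb⟩ := hb x
    refine ⟨Va ⊓ Vb, ⟨ma, mb⟩, Opens.infLELeft _ _ ≫ ia, ra * rb, sa * sb, fun x ↦ ?_⟩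
    obtain ⟨hsax, hsa⟩ := wa ⟨x.1, x.2.1⟩
    obtain ⟨hsbx, hsb⟩ := wb ⟨x.1, x.2.2⟩
    exact ⟨(A.primeSubmonoid x.1).mul_mem hsax hsbx,
      congr($hsa * $hsb).trans (LocalizedModule.mk_mul_mk ..)⟩
  algebraMap_mem' k x :=
    ⟨U, x.2, 𝟙 _, algebraMap K A k, 1, fun y ↦ ⟨(A.primeSubmonoid y.1).one_mem,
      algebraMap_eq_mk _ k⟩⟩


variable {A} in
/-- A section is locally given by a fraction. -/
theorem exists_fraction {U : Opens A.specTop} {f : ∀ x : U, A.atPrime x.1}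
    (hf : f ∈ A.sectionsSubalgebra U) (x : U) :
    ∃ (V : Opens A.specTop) (_ : x.1 ∈ V) (hVU : V ≤ U) (r : A) (s : A.Even),
      ∀ y : V, ∃ hs : s ∈ A.primeSubmonoid y.1,
        f ⟨y.1, hVU y.2⟩ = (LocalizedModule.mk r ⟨s, hs⟩ : LocalizedModule _ A) := by
  obtain ⟨V, hxV, i, r, s, h⟩ := hf x
  exact ⟨V, hxV, i.le, r, s, h⟩

variable {A} in
/-- A function which is locally given by a fraction is a section. -/
theorem mem_sections {U : Opens A.specTop} {f : ∀ x : U, A.atPrime x.1}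
    (hf : ∀ x : U, ∃ (V : Opens A.specTop) (_ : x.1 ∈ V) (hVU : V ≤ U) (r : A) (s : A.Even),
      ∀ y : V, ∃ hs : s ∈ A.primeSubmonoid y.1,
        f ⟨y.1, hVU y.2⟩ = (LocalizedModule.mk r ⟨s, hs⟩ : LocalizedModule _ A)) :
    f ∈ A.sectionsSubalgebra U := fun x => by
  obtain ⟨V, hxV, i, r, s, h⟩ := hf x
  exact ⟨V, hxV, homOfLE i, r, s, h⟩

/-- The homogeneous sections: those with all values homogeneous. -/
def sectionsGrading (U : Opens A.specTop) (i : ZMod 2) :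
    Submodule K (A.sectionsSubalgebra U) where
  carrier := {f | ∀ x, f.1 x ∈ (A.atPrime x.1).grading i}
  add_mem' ha hb x := add_mem (ha x) (hb x)
  zero_mem' _ := zero_mem _
  smul_mem' k _ ha x := Submodule.smul_mem _ k (ha x)

instance (U : Opens A.specTop) : SetLike.GradedMonoid (A.sectionsGrading U) where
  one_mem _ := SetLike.GradedOne.one_mem
  mul_mem _ _ _ _ ha hb x := SetLike.mul_mem_graded (ha x) (hb x)

theorem sectionsGrading_isCompl (U : Opens A.specTop) :
    IsCompl (A.sectionsGrading U 0) (A.sectionsGrading U 1) := by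
  constructor
  · rw [Submodule.disjoint_def]
    intro f h0 h1
    exact Subtype.ext (funext fun x => (A.atPrime x.1).eq_zero_of_mem (h0 x) (h1 x))
  · rw [codisjoint_iff, eq_top_iff]
    rintro ⟨f, hf⟩ -
    choose g hg h hh hgh using fun x : U => (A.atPrime x.1).exists_add (f x)
    have key : ∀ x : U, ∃ (V : Opens A.specTop) (_ : x.1 ∈ V) (hVU : V ≤ U) (b c : A)
        (s : A.Even), ∀ y : V, ∃ hs : s ∈ A.primeSubmonoid y.1,
        g ⟨y.1, hVU y.2⟩ = (LocalizedModule.mk b ⟨s, hs⟩ : LocalizedModule _ A) ∧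
        h ⟨y.1, hVU y.2⟩ = (LocalizedModule.mk c ⟨s, hs⟩ : LocalizedModule _ A) := by
      intro x
      obtain ⟨V, hxV, hVU, r, s, hrs⟩ := exists_fraction hf x
      obtain ⟨b, hb, c, hc, rfl⟩ := A.exists_add r
      refine ⟨V, hxV, hVU, b, c, s, fun y => ?_⟩
      obtain ⟨hs, e⟩ := hrs y
      refine ⟨hs, ?_⟩
      exact A.fraction_unique (A.primeSubmonoid y.1) _ _ (hg ⟨y.1, hVU y.2⟩) (hh ⟨y.1, hVU y.2⟩)
        hb hc ⟨s, hs⟩ ((hgh ⟨y.1, hVU y.2⟩).trans e)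
    refine Submodule.mem_sup.2 ⟨⟨g, mem_sections fun x => ?_⟩, hg, ⟨h, mem_sections fun x => ?_⟩,
      hh, Subtype.ext (funext hgh)⟩
    · obtain ⟨V, hxV, hVU, b, c, s, H⟩ := key x
      exact ⟨V, hxV, hVU, b, s, fun y => ⟨(H y).1, (H y).2.1⟩⟩
    · obtain ⟨V, hxV, hVU, b, c, s, H⟩ := key x
      exact ⟨V, hxV, hVU, c, s, fun y => ⟨(H y).1, (H y).2.2⟩⟩

/-- The superalgebra of sections of the structure sheaf of `SSpec A` on `U`. -/
def sections (U : Opens A.specTop) : SAlg K where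
  carrier := A.sectionsSubalgebra U
  grading := A.sectionsGrading U
  graded := gradedOfIsCompl _ (A.sectionsGrading_isCompl U)
  supercomm i j a b ha hb := by
    have h : ∀ x : U, a.1 x * b.1 x = (-1) ^ (i.val * j.val) * (b.1 x * a.1 x) :=
      fun x => (A.atPrime x.1).supercomm i j _ _ (ha x) (hb x)
    rcases Nat.even_or_odd (i.val * j.val) with e | e
    · have h' : ∀ x : U, a.1 x * b.1 x = b.1 x * a.1 x := fun x => by
        rw [h x, e.neg_one_pow, one_mul]
      exact (Subtype.ext (funext h')).trans
        ((congrArg (· * (b * a)) e.neg_one_pow).trans (one_mul _)).symm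
    · have h' : ∀ x : U, a.1 x * b.1 x = -(b.1 x * a.1 x) := fun x => by
        rw [h x, e.neg_one_pow, neg_one_mul]
      exact (Subtype.ext (funext h')).trans
        ((congrArg (· * (b * a)) e.neg_one_pow).trans (neg_one_mul _)).symm

/-- An even section is locally given by a fraction with even numerator. -/
theorem exists_even_fraction (U : Opens A.specTop) (f : A.sections U)
    (hf : f ∈ (A.sections U).grading 0) (x : U) :
    ∃ (V : Opens A.specTop) (_ : x.1 ∈ V) (hVU : V ≤ U) (b : A.Even) (s : A.Even),
      ∀ y : V, ∃ hs : s ∈ A.primeSubmonoid y.1,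
        f.1 ⟨y.1, hVU y.2⟩ = (LocalizedModule.mk b.1 ⟨s, hs⟩ : LocalizedModule _ A) := by
  obtain ⟨V, hxV, hVU, r, s, hrs⟩ := exists_fraction f.2 x
  obtain ⟨b, hb, c, hc, rfl⟩ := A.exists_add r
  refine ⟨V, hxV, hVU, ⟨b, hb⟩, s, fun y => ?_⟩
  obtain ⟨hs, e⟩ := hrs y
  exact ⟨hs, (A.fraction_unique (A.primeSubmonoid y.1) _ 0 (hf ⟨y.1, hVU y.2⟩) (zero_mem _)
    hb hc ⟨s, hs⟩ ((add_zero _).trans e)).1⟩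

/-- Restriction of sections. -/
def sectionsRes {U V : Opens A.specTop} (h : V ≤ U) : A.sections U ⟶ A.sections V where
  toFun f := ⟨fun x => f.1 ⟨x.1, h x.2⟩,
    (StructureSheaf.isLocallyFraction A.Even A).res (homOfLE h) f.1 f.2⟩
  map_one' := rfl
  map_mul' _ _ := rfl
  map_zero' := rfl
  map_add' _ _ := rfl
  commutes' _ := rfl
  map_mem hf x := hf ⟨x.1, h x.2⟩

/-- The structure sheaf of `SSpec A`. -/
def structurePresheaf : TopCat.Presheaf (SAlg K) A.specTop where
  obj U := A.sections U.unop
  map i := A.sectionsRes i.unop.le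

theorem structurePresheaf_isSheaf :
    TopCat.Presheaf.IsSheaf (A.structurePresheaf ⋙ forget (SAlg K)) :=
  (structureSheafInType A.Even A).property


/-- The topological space `SSpec A` with its structure sheaf. -/
def specPresheafedSpace : PresheafedSpace.{u, u + 1, u} (SAlg K) where
  carrier := A.specTop
  presheaf := A.structurePresheaf

/-- Evaluation of sections at a point. -/
def evalSection (U : Opens A.specTop) (x : A.specTop) (hx : x ∈ U) :
    A.sections U ⟶ A.atPrime x where
  toFun f := f.1 ⟨x, hx⟩
  map_one' := rfl
  map_mul' _ _ := rfl
  map_zero' := rfl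
  map_add' _ _ := rfl
  commutes' _ := rfl
  map_mem hf := hf ⟨x, hx⟩

/-- Evaluation of germs of even sections at a point. -/
def stalkEval (x : A.specTop) :
    ((evenSpace K).obj A.specPresheafedSpace).presheaf.stalk x ⟶ (evenPart K).obj (A.atPrime x) :=
  Limits.colimit.desc
    ((OpenNhds.inclusion x).op ⋙ ((evenSpace K).obj A.specPresheafedSpace).presheaf)
    { pt := (evenPart K).obj (A.atPrime x)
      ι := { app := fun V => (evenPart K).map (A.evalSection V.unop.1 x V.unop.2) } }

theorem germ_stalkEval (U : Opens A.specTop) (x : A.specTop) (hx : x ∈ U) :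
    ((evenSpace K).obj A.specPresheafedSpace).presheaf.germ U x hx ≫ A.stalkEval x =
      (evenPart K).map (A.evalSection U x hx) :=
  Limits.colimit.ι_desc (F := (OpenNhds.inclusion (X := A.specTop) x).op ⋙
    ((evenSpace K).obj A.specPresheafedSpace).presheaf) _ (op ⟨U, hx⟩)

theorem germ_stalkEval_apply (U : Opens A.specTop) (x : A.specTop) (hx : x ∈ U)
    (s : (A.sections U).Even) :
    A.stalkEval x (((evenSpace K).obj A.specPresheafedSpace).presheaf.germ U x hx s) =
      (⟨s.1.1 ⟨x, hx⟩, s.2 ⟨x, hx⟩⟩ : (A.atPrime x).Even) :=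
  ConcreteCategory.congr_hom (A.germ_stalkEval U x hx) s

theorem isUnit_mk_iff (x : PrimeSpectrum A.Even) (a : A.Even) (s : A.primeSubmonoid x)
    (z : (A.atPrime x).Even) (hz : z.1 = (LocalizedModule.mk a.1 s : LocalizedModule _ A)) :
    IsUnit z ↔ a ∉ x.asIdeal := by
  constructor
  · intro h ha
    obtain ⟨w, hw⟩ := h.exists_right_inv
    obtain ⟨b, hb, t, hw'⟩ := w.2
    have e : z.1 * w.1 = 1 := congrArg Subtype.val hw
    rw [hz, hw'] at e
    have e' := LocalizedModule.mk_mul_mk.symm.trans (e.trans OreLocalization.one_def)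
    obtain ⟨u, hu⟩ := LocalizedModule.mk_eq.1 e'
    have hu' : u.1 * (a * ⟨b, hb⟩) = u.1 * (s.1 * t.1) := by
      apply Subtype.ext
      have hu' : u.1 • (1 : A.Even) • (a.1 * b) = u.1 • (s.1 * t.1) • (1 : A) := hu
      rw [one_smul] at hu'
      exact hu'.trans (congrArg (u.1.1 * ·) (mul_one _))
    have h1 : u.1 * (s.1 * t.1) ∈ x.asIdeal :=
      hu' ▸ x.asIdeal.mul_mem_left _ (x.asIdeal.mul_mem_right _ ha)
    exact (mul_mem u.2 (mul_mem s.2 t.2) : _ ∈ A.primeSubmonoid x) h1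
  · intro ha
    exact IsUnit.of_mul_eq_one (⟨(LocalizedModule.mk s.1.1 ⟨a, ha⟩ : LocalizedModule _ A),
      ⟨s.1.1, s.1.2, _, rfl⟩⟩ : (A.atPrime x).Even)
      (Subtype.ext (A.mul_eq_one (A.primeSubmonoid x) _ _ a s.1 ha s.2 hz rfl))

theorem isLocalRing_atPrime (x : PrimeSpectrum A.Even) : IsLocalRing (A.atPrime x).Even := by
  have : Nontrivial (A.atPrime x).Even := by
    refine ⟨0, 1, fun h => ?_⟩
    refine (A.isUnit_mk_iff x 0 1 0 (LocalizedModule.zero_mk 1).symm).1 (h ▸ isUnit_one)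
      (zero_mem _)
  refine IsLocalRing.of_nonunits_add fun z w hz hw => ?_
  obtain ⟨a, ha, s, hz'⟩ := z.2
  obtain ⟨b, hb, t, hw'⟩ := w.2
  rw [mem_nonunits_iff, A.isUnit_mk_iff x ⟨a, ha⟩ s z hz', not_not] at hz
  rw [mem_nonunits_iff, A.isUnit_mk_iff x ⟨b, hb⟩ t w hw', not_not] at hw
  rw [mem_nonunits_iff, A.isUnit_mk_iff x (t.1 * ⟨a, ha⟩ + s.1 * ⟨b, hb⟩) (s * t) (z + w)
    ((congrArg₂ _ hz' hw').trans LocalizedModule.mk_add_mk), not_not]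
  exact add_mem (x.asIdeal.mul_mem_left _ hz) (x.asIdeal.mul_mem_left _ hw)

theorem isLocalHom_stalkEval (x : A.specTop) : IsLocalHom (A.stalkEval x).hom := by
  constructor
  intro z hz
  obtain ⟨U, hxU, s, rfl⟩ :=
    ((evenSpace K).obj A.specPresheafedSpace).presheaf.exists_germ_eq z
  obtain ⟨f, hf⟩ : (A.sections U).Even := s
  have hz' : IsUnit (⟨f.1 ⟨x, hxU⟩, hf ⟨x, hxU⟩⟩ : (A.atPrime x).Even) :=
    (A.germ_stalkEval_apply U x hxU ⟨f, hf⟩) ▸ hz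
  obtain ⟨V, hxV, hVU, b, t, H⟩ := A.exists_even_fraction U f hf ⟨x, hxU⟩
  have hbx : b ∉ x.asIdeal := (A.isUnit_mk_iff x b ⟨t, (H ⟨x, hxV⟩).1⟩ _ (H ⟨x, hxV⟩).2).1 hz'
  let W : Opens A.specTop := V ⊓ PrimeSpectrum.basicOpen b
  have hWU : W ≤ U := inf_le_left.trans hVU
  have hxW : x ∈ W := ⟨hxV, hbx⟩
  let g : (A.sections W).Even :=
    ⟨⟨fun y => (LocalizedModule.mk t.1 ⟨b, y.2.2⟩ : LocalizedModule (A.primeSubmonoid y.1) A),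
      mem_sections fun y => ⟨W, y.2, le_rfl, t.1, b, fun y => ⟨y.2.2, rfl⟩⟩⟩,
      fun y => ⟨t.1, t.2, _, rfl⟩⟩
  let f' : (A.sections W).Even := evenMap (A.sectionsRes hWU) ⟨f, hf⟩
  have hfg : f' * g = 1 := by
    refine Subtype.ext (Subtype.ext (funext fun y => ?_))
    exact A.mul_eq_one (A.primeSubmonoid y.1) _ _ b t y.2.2 (H ⟨y.1, y.2.1⟩).1
      (H ⟨y.1, y.2.1⟩).2 rfl
  have key : ((evenSpace K).obj A.specPresheafedSpace).presheaf.germ U x hxU ⟨f, hf⟩ =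
      ((evenSpace K).obj A.specPresheafedSpace).presheaf.germ W x hxW f' :=
    (TopCat.Presheaf.germ_res_apply ((evenSpace K).obj A.specPresheafedSpace).presheaf
      (homOfLE hWU) x hxW ⟨f, hf⟩).symm
  have hu : IsUnit f' := IsUnit.of_mul_eq_one g hfg
  exact key ▸ hu.map (((evenSpace K).obj A.specPresheafedSpace).presheaf.germ W x hxW).hom

/-- The affine superspace `SSpec A`. -/
def sspec : GeomSuperspace K where
  toPresheafedSpace := A.specPresheafedSpace
  isSheaf := A.structurePresheaf_isSheaf
  isLocalRing x :=
    have : IsLocalRing ((evenPart K).obj (A.atPrime x)) :=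
      A.isLocalRing_atPrime x
    have := A.isLocalHom_stalkEval x
    RingHom.domain_isLocalRing (A.stalkEval x).hom

end StructureSheaf

section Functoriality

variable {A B : SAlg K} (φ : A ⟶ B)

/-- The map on spectra induced by `φ : A → B`. -/
def specMap : B.specTop ⟶ A.specTop :=
  TopCat.ofHom ⟨PrimeSpectrum.comap (evenMap φ), by fun_prop⟩

theorem primeSubmonoid_le (x : B.specTop) :
    A.primeSubmonoid (specMap φ x) ≤ (B.primeSubmonoid x).comap (evenMap φ) := fun _ h => h

/-- The map `A_{φ⁻¹(q)} → B_q`. -/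
def stalkLocMap (x : B.specTop) : A.atPrime (specMap φ x) ⟶ B.atPrime x :=
  locMap φ _ _ (primeSubmonoid_le φ x)

theorem stalkLocMap_mk (x : B.specTop) (a : A) (s : A.Even)
    (hs : s ∈ A.primeSubmonoid (specMap φ x)) (z : A.atPrime (specMap φ x))
    (hz : z = (LocalizedModule.mk a ⟨s, hs⟩ : LocalizedModule _ A)) :
    stalkLocMap φ x z = (LocalizedModule.mk (φ a) ⟨evenMap φ s, hs⟩ : LocalizedModule _ B) := by
  subst hz
  exact locMapFun_mk φ _ _ (primeSubmonoid_le φ x) a ⟨s, hs⟩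

/-- The action of `φ : A → B` on sections of the structure sheaves. -/
def sectionsMap (U : Opens A.specTop) :
    A.sections U ⟶ B.sections ((Opens.map (specMap φ)).obj U) where
  toFun f := ⟨fun x => stalkLocMap φ x.1 (f.1 ⟨specMap φ x.1, x.2⟩), mem_sections fun x => by
    obtain ⟨V, hxV, hVU, r, s, h⟩ := exists_fraction f.2 ⟨specMap φ x.1, x.2⟩
    refine ⟨(Opens.map (specMap φ)).obj V, hxV, fun y hy => hVU hy, φ r, evenMap φ s, fun y => ?_⟩
    obtain ⟨hs, e⟩ := h ⟨specMap φ y.1, y.2⟩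
    exact ⟨hs, stalkLocMap_mk φ y.1 r s hs _ e⟩⟩
  map_one' := Subtype.ext (funext fun x => map_one (ConcreteCategory.hom (stalkLocMap φ x.1)))
  map_mul' _ _ := Subtype.ext (funext fun x =>
    map_mul (ConcreteCategory.hom (stalkLocMap φ x.1)) _ _)
  map_zero' := Subtype.ext (funext fun x => map_zero (ConcreteCategory.hom (stalkLocMap φ x.1)))
  map_add' _ _ := Subtype.ext (funext fun x =>
    map_add (ConcreteCategory.hom (stalkLocMap φ x.1)) _ _)
  commutes' k := Subtype.ext (funext fun x =>
    AlgHomClass.commutes (ConcreteCategory.hom (stalkLocMap φ x.1)) k)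
  map_mem hf x := hom_map_mem (stalkLocMap φ x.1) (hf ⟨specMap φ x.1, x.2⟩)

/-- The morphism `SSpec B ⟶ SSpec A` of spaces with a presheaf of superalgebras. -/
def specPresheafedMap : B.specPresheafedSpace ⟶ A.specPresheafedSpace where
  base := specMap φ
  c := { app := fun U => sectionsMap φ U.unop
         naturality := fun _ _ _ => rfl }

theorem stalkMap_stalkEval (x : B.specTop)
    (z : ((evenSpace K).obj A.specPresheafedSpace).presheaf.stalk (specMap φ x)) :
    B.stalkEval x (((evenSpace K).map (specPresheafedMap φ)).stalkMap x z) =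
      evenMap (stalkLocMap φ x) (A.stalkEval (specMap φ x) z) := by
  obtain ⟨U, hxU, s, rfl⟩ :=
    ((evenSpace K).obj A.specPresheafedSpace).presheaf.exists_germ_eq z
  have h := PresheafedSpace.stalkMap_germ_apply ((evenSpace K).map (specPresheafedMap φ)) U x hxU s
  refine (congrArg (B.stalkEval x) h).trans ((B.germ_stalkEval_apply _ x hxU _).trans ?_)
  exact (congrArg (evenMap (stalkLocMap φ x)) (A.germ_stalkEval_apply U (specMap φ x) hxU s)).symm

theorem isLocalHom_stalkLocMap (x : B.specTop) : IsLocalHom (evenMap (stalkLocMap φ x)) := by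
  constructor
  intro z hz
  obtain ⟨a, ha, s, hz'⟩ := z.2
  have := (B.isUnit_mk_iff x (evenMap φ ⟨a, ha⟩) _ (evenMap (stalkLocMap φ x) z)
    (stalkLocMap_mk φ x a s.1 s.2 z.1 hz')).1 hz
  exact (A.isUnit_mk_iff (specMap φ x) ⟨a, ha⟩ s z hz').2 this

/-- The morphism `SSpec φ : SSpec B ⟶ SSpec A`. -/
def sspecMap : B.sspec ⟶ A.sspec where
  hom := specPresheafedMap φ
  isLocal x := by
    constructor
    intro z hz
    have h := hz.map (B.stalkEval x).hom
    have h' : IsUnit (evenMap (stalkLocMap φ x) (A.stalkEval (specMap φ x) z)) :=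
      (stalkMap_stalkEval φ x z) ▸ h
    exact (A.isLocalHom_stalkEval (specMap φ x)).map_nonunit z
      ((isLocalHom_stalkLocMap φ x).map_nonunit _ h')
end Functoriality

variable (K) in
/-- The functor `A ↦ SSpec A`. -/
def SSpec : (SAlg K)ᵒᵖ ⥤ GeomSuperspace K where
  obj A := A.unop.sspec
  map f := sspecMap f.unop
  map_id A := GeomSuperspace.Hom.ext (PresheafedSpace.hext _ _ rfl (heq_of_eq (by
    refine NatTrans.ext (funext fun U => ?_)
    refine GradedAlgHom.ext fun f => Subtype.ext (funext fun x => ?_)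
    exact locMapFun_id _ (fun _ h => h) (f.1 x))))
  map_comp {A B C} f g := GeomSuperspace.Hom.ext (PresheafedSpace.hext _ _ rfl (heq_of_eq (by
    refine NatTrans.ext (funext fun U => ?_)
    refine GradedAlgHom.ext fun s => Subtype.ext (funext fun x => ?_)
    exact locMapFun_comp g.unop f.unop _ _ _ (primeSubmonoid_le g.unop (specMap f.unop x.1))
      (primeSubmonoid_le f.unop x.1) (fun _ h => h) (s.1 ⟨specMap g.unop (specMap f.unop x.1), x.2⟩))))

end SAlg

/-! ### Functor of points and geometric realization -/

section Comparison

variable {K : Type u} [Field K]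

/-- A geometric superscheme is a geometric superspace which is covered by open subspaces
isomorphic to affine superspaces `SSpec A`. -/
def IsGeomSuperscheme : ObjectProperty (GeomSuperspace K) := fun X =>
  ∀ x : X.carrier, ∃ U : Opens X.carrier, x ∈ U ∧
    ∃ A : SAlg K, Nonempty (X.restrict U ≅ (SAlg.SSpec K).obj (op A))

variable (K) in
/-- The category `𝒮ℱ` of superschemes, a full subcategory of the category of `K`-functors. -/
abbrev Superscheme := (IsSuperscheme (K := K)).FullSubcategory

variable (K) in
/-- The category `𝒮𝒱` of geometric superschemes, a full subcategory of the category of geometric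
superspaces. -/
abbrev GeomSuperscheme := (IsGeomSuperscheme (K := K)).FullSubcategory

variable (K) in
/-- The functor of points `Y ↦ Y^◇`, where `Y^◇(R) = Mor(SSpec R, Y)`. -/
def functorOfPoints : GeomSuperspace K ⥤ KFunctor K :=
  yoneda ⋙ (Functor.whiskeringLeft _ _ _).obj (SAlg.SSpec K).rightOp

/-- The diagram `(R, x) ↦ SSpec R`, indexed by the opposite of the category of pairs `(R, x)` with
`x ∈ X(R)`, whose colimit is the geometric realization of `X`. -/
abbrev realizationDiagram (X : KFunctor K) : X.Elementsᵒᵖ ⥤ GeomSuperspace K :=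
  (CategoryOfElements.π X).op ⋙ SAlg.SSpec K

/-- The canonical morphism `i_x : SSpec R ⟶ |X|` for `x ∈ X(R)`. -/
abbrev realizationι (X : KFunctor K) [Limits.HasColimit (realizationDiagram X)] (R : SAlg K)
    (x : X.obj R) : (SAlg.SSpec K).obj (op R) ⟶ Limits.colimit (realizationDiagram X) :=
  Limits.colimit.ι (realizationDiagram X) (op ⟨R, x⟩)

/-- The morphism `|X| ⟶ |Y|` induced by `f : X ⟶ Y`, determined by `i_x ≫ |f| = i_{f(x)}`. -/
def realizationMap {X Y : KFunctor K} [Limits.HasColimit (realizationDiagram X)]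
    [Limits.HasColimit (realizationDiagram Y)] (f : X ⟶ Y) :
    Limits.colimit (realizationDiagram X) ⟶ Limits.colimit (realizationDiagram Y) :=
  Limits.colimit.desc (realizationDiagram X)
    { pt := Limits.colimit (realizationDiagram Y)
      ι := { app := fun p => realizationι Y p.unop.1 (f.app _ p.unop.2)
             naturality := fun p q g => by
               refine Eq.trans ?_ (Category.comp_id _).symm
               exact Limits.colimit.w (realizationDiagram Y)
                 ((NatTrans.mapElements f).map g.unop).op } }

theorem realizationι_map {X Y : KFunctor K} [Limits.HasColimit (realizationDiagram X)]
    [Limits.HasColimit (realizationDiagram Y)] (f : X ⟶ Y) (R : SAlg K) (x : X.obj R) :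
    realizationι X R x ≫ realizationMap f = realizationι Y R (f.app R x) :=
  Limits.colimit.ι_desc _ _

/-- The geometric realization `X ↦ |X|`, as a functor on any full subcategory of the category of
`K`-functors on which the colimits defining `|X|` exist. -/
def geometricRealization (P : ObjectProperty (KFunctor K))
    (h : ∀ X : KFunctor K, P X → Limits.HasColimit (realizationDiagram X)) :
    P.FullSubcategory ⥤ GeomSuperspace K where
  obj X :=
    have := h X.obj X.property
    Limits.colimit (realizationDiagram X.obj)
  map {X Y} f :=
    have := h X.obj X.property
    have := h Y.obj Y.property
    realizationMap f.hom
  map_id X := by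
    have := h X.obj X.property
    refine Limits.colimit.hom_ext fun p => ?_
    refine (realizationι_map _ p.unop.1 p.unop.2).trans ?_
    exact (Category.comp_id _).symm
  map_comp {X Y Z} f g := by
    have := h X.obj X.property
    have := h Y.obj Y.property
    have := h Z.obj Z.property
    refine Limits.colimit.hom_ext fun p => ?_
    refine (realizationι_map _ p.unop.1 p.unop.2).trans ?_
    refine Eq.trans ?_ (Category.assoc _ _ _)
    exact ((congrArg (· ≫ realizationMap g.hom) (realizationι_map f.hom p.unop.1 p.unop.2)).trans
      (realizationι_map g.hom p.unop.1 _)).symm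

end Comparison

end

/-! `SSpec` is fully faithful: a morphism of affine superspaces is recovered from its effect on
global sections, and locality on stalks fixes the underlying map (`exists_sspecMap_eq`,
`sspecMap_injective`). Since `2 ≠ 0`, odd elements square to zero, so each prime of `A₀` gives a
morphism from `A` to a residue field. Hence the condition `x(I)B = B` defining `D(I)` and the
covering condition on field extensions are both conditions on points of spectra.

If `Y` is covered by affine open subspaces, a morphism from `Y` to any geometric superspace `Z` is
the same as a compatible family of morphisms from the affine superspaces over `Y`
(`AffineGlueData.exists_hom`). So morphisms `Y → Z` are the natural transformations `Y^◇ → Z^◇`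
(`existsUnique_functorOfPoints_map`). The same gluing makes `Y^◇` a local functor, and affine open
immersions are open charts of it, so `Y^◇` is a superscheme. Cocones over the realization diagram of
`X` with vertex `Z` are the natural transformations `X → Z^◇`; thus any `X ≅ Y^◇` has colimit `Y`,
with the universal property in all of `𝒱` (`isColimitRealizationCocone`).

It remains to show that each superscheme `X` is isomorphic to some `Y^◇`. Its affine open
subfunctors form an atlas, and the charts glue to a superspace `OpenAtlas.glued` in which two
morphisms from charts agree if and only if they agree in `X` (`OpenAtlas.related_iff`). Local
functors covered by charts with the same relations are isomorphic (`nonempty_iso_of_charts`), so `X`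
is the functor of points of the glued space. Existence of `|X|` and invertibility of unit and counit
follow. -/

noncomputable section

namespace SAlg

variable {K : Type u} [Field K]

/-! ### Even and odd components -/

section Parity

variable (A : SAlg K)

/-- Supercommutativity gives `a a = -a a`. Every use of `2 ≠ 0` goes back to this. -/
theorem odd_mul_self (hK : (2 : K) ≠ 0) {a : A} (ha : a ∈ A.grading 1) : a * a = 0 := by
  have h := A.supercomm 1 1 a a ha ha
  have e : ((1 : ZMod 2).val * (1 : ZMod 2).val) = 1 := rfl
  rw [e, pow_one, neg_one_mul, eq_neg_iff_add_eq_zero] at h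
  have h2 : (2 : K) • (a * a) = 0 := by rw [two_smul]; exact h
  exact (smul_eq_zero.1 h2).resolve_left hK

theorem odd_mul_comm {a b : A} (ha : a ∈ A.grading 1) (hb : b ∈ A.grading 1) :
    a * b = -(b * a) := by
  have h := A.supercomm 1 1 a b ha hb
  have e : ((1 : ZMod 2).val * (1 : ZMod 2).val) = 1 := rfl
  rwa [e, pow_one, neg_one_mul] at h

/-- The even part of an element. -/
def evenProj (a : A) : A.Even := DirectSum.decompose A.grading a 0

/-- The odd part of an element. -/
def oddProj (a : A) : A.grading 1 := DirectSum.decompose A.grading a 1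

variable {A}

theorem evenProj_eq {a b c : A} (hb : b ∈ A.grading 0) (hc : c ∈ A.grading 1) (h : b + c = a) :
    A.evenProj a = ⟨b, hb⟩ := by
  subst h
  refine Subtype.ext ?_
  rw [evenProj, DirectSum.decompose_add, DirectSum.add_apply, Submodule.coe_add,
    DirectSum.decompose_of_mem_same A.grading hb,
    DirectSum.decompose_of_mem_ne A.grading hc one_ne_zero, add_zero]

theorem oddProj_eq {a b c : A} (hb : b ∈ A.grading 0) (hc : c ∈ A.grading 1) (h : b + c = a) :
    A.oddProj a = ⟨c, hc⟩ := by
  subst h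
  refine Subtype.ext ?_
  rw [oddProj, DirectSum.decompose_add, DirectSum.add_apply, Submodule.coe_add,
    DirectSum.decompose_of_mem_same A.grading hc,
    DirectSum.decompose_of_mem_ne A.grading hb zero_ne_one, zero_add]

theorem evenProj_add_oddProj (a : A) : (A.evenProj a : A) + (A.oddProj a : A) = a := by
  obtain ⟨b, hb, c, hc, h⟩ := A.exists_add a
  rw [evenProj_eq hb hc h, oddProj_eq hb hc h, h]

theorem evenProj_add (a b : A) : A.evenProj (a + b) = A.evenProj a + A.evenProj b := by
  rw [evenProj, DirectSum.decompose_add]; rfl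

theorem evenProj_of_even {a : A} (ha : a ∈ A.grading 0) : A.evenProj a = ⟨a, ha⟩ :=
  evenProj_eq ha (zero_mem _) (add_zero _)

theorem evenProj_of_odd {a : A} (ha : a ∈ A.grading 1) : A.evenProj a = 0 :=
  evenProj_eq (zero_mem _) ha (zero_add _)

theorem evenProj_hom {B : SAlg K} (φ : A ⟶ B) (a : A) :
    B.evenProj (φ a) = evenMap φ (A.evenProj a) := by
  refine evenProj_eq (hom_map_mem φ (A.evenProj a).2) (hom_map_mem φ (A.oddProj a).2) ?_
  rw [← map_add, evenProj_add_oddProj]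

theorem odd_mul_odd_mem {a b : A} (ha : a ∈ A.grading 1) (hb : b ∈ A.grading 1) :
    a * b ∈ A.grading 0 := SetLike.mul_mem_graded ha hb

theorem even_mul_odd_mem {a b : A} (ha : a ∈ A.grading 0) (hb : b ∈ A.grading 1) :
    a * b ∈ A.grading 1 := by
  have := SetLike.mul_mem_graded ha hb
  rwa [zero_add] at this

theorem even_mul_even_mem {a b : A} (ha : a ∈ A.grading 0) (hb : b ∈ A.grading 0) :
    a * b ∈ A.grading 0 := by
  have := SetLike.mul_mem_graded ha hb
  rwa [zero_add] at this

theorem odd_mul_even_mem {a b : A} (ha : a ∈ A.grading 1) (hb : b ∈ A.grading 0) :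
    a * b ∈ A.grading 1 := by
  have := SetLike.mul_mem_graded ha hb
  rwa [add_zero] at this

/-- The product of two odd elements, as an even element. -/
def oddMul (a b : A.grading 1) : A.Even := ⟨a.1 * b.1, odd_mul_odd_mem a.2 b.2⟩

theorem evenProj_mul (a b : A) : A.evenProj (a * b) =
    A.evenProj a * A.evenProj b + oddMul (A.oddProj a) (A.oddProj b) := by
  have ha := evenProj_add_oddProj a
  have hb := evenProj_add_oddProj b
  refine evenProj_eq (c := (A.evenProj a : A) * (A.oddProj b : A) + (A.oddProj a : A) * (A.evenProj b : A))
    (add_mem (even_mul_even_mem (A.evenProj a).2 (A.evenProj b).2)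
      (odd_mul_odd_mem (A.oddProj a).2 (A.oddProj b).2))
    (add_mem (even_mul_odd_mem (A.evenProj a).2 (A.oddProj b).2)
      (odd_mul_even_mem (A.oddProj a).2 (A.evenProj b).2)) ?_
  conv_rhs => rw [← ha, ← hb]
  simp only [add_mul, mul_add]
  abel

theorem oddMul_mul_self (hK : (2 : K) ≠ 0) (a b : A.grading 1) : oddMul a b * oddMul a b = 0 := by
  refine Subtype.ext ?_
  show a.1 * b.1 * (a.1 * b.1) = 0
  rw [A.odd_mul_comm a.2 b.2, neg_mul_neg, mul_assoc, ← mul_assoc a.1, A.odd_mul_comm a.2 b.2, neg_mul,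
    mul_assoc, A.odd_mul_self hK a.2]
  simp

/-- A product of two odd elements has square zero, so it lies in every prime. This is what makes the
even projection multiplicative modulo a prime. -/
theorem oddMul_mem (hK : (2 : K) ≠ 0) (x : PrimeSpectrum A.Even) (a b : A.grading 1) :
    oddMul a b ∈ x.asIdeal :=
  (x.isPrime.mem_or_mem ((oddMul_mul_self hK a b) ▸ zero_mem _ : _ ∈ x.asIdeal)).elim id id

end Parity

/-! ### Residue fields as purely even superalgebras -/

section ResidueField

/-- The grading of a commutative algebra concentrated in degree `0`. -/
def evenGrading (L : Type u) [CommRing L] [Algebra K L] (i : ZMod 2) : Submodule K L :=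
  if i = 0 then ⊤ else ⊥

section

variable (L : Type u) [CommRing L] [Algebra K L]

theorem evenGrading_zero : evenGrading (K := K) L 0 = ⊤ := if_pos rfl

theorem evenGrading_one : evenGrading (K := K) L 1 = ⊥ := if_neg one_ne_zero

theorem zmod_two_cases (i : ZMod 2) : i = 0 ∨ i = 1 := by revert i; decide

instance : SetLike.GradedMonoid (evenGrading (K := K) L) where
  one_mem := by rw [evenGrading_zero]; trivial
  mul_mem := by
    intro i j a b ha hb
    rcases zmod_two_cases i with rfl | rfl <;> rcases zmod_two_cases j with rfl | rfl <;>
      simp_all [evenGrading_zero, evenGrading_one]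

end

/-- A commutative algebra as a purely even superalgebra. -/
def purelyEven (L : Type u) [CommRing L] [Algebra K L] : SAlg K where
  carrier := L
  grading := evenGrading L
  graded := gradedOfIsCompl _ (by rw [evenGrading_zero, evenGrading_one]; exact isCompl_top_bot)
  supercomm i j a b ha hb := by
    rcases zmod_two_cases i with rfl | rfl <;> rcases zmod_two_cases j with rfl | rfl <;>
      simp_all [evenGrading_zero, evenGrading_one, mul_comm]

variable {A : SAlg K}

/-- The residue field of `A` at a prime superideal. -/
def residueField (x : PrimeSpectrum A.Even) : SAlg K :=
  purelyEven (K := K) x.asIdeal.ResidueField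

theorem residueField_isFieldExtension (x : PrimeSpectrum A.Even) :
    (residueField x).IsFieldExtension :=
  ⟨evenGrading_one _, Field.toIsField x.asIdeal.ResidueField⟩

/-- The evaluation map from `A` to the residue field at a prime superideal. -/
def toResidueField (hK : (2 : K) ≠ 0) (x : PrimeSpectrum A.Even) : A ⟶ residueField x :=
  have key (a : A.Even) (ha : a ∈ x.asIdeal) : algebraMap A.Even x.asIdeal.ResidueField a = 0 :=
    (Ideal.algebraMap_residueField_eq_zero).2 ha
  { toFun := fun a => algebraMap A.Even x.asIdeal.ResidueField (A.evenProj a)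
    map_one' := by
      rw [evenProj_of_even (SetLike.GradedOne.one_mem : (1 : A) ∈ A.grading 0)]
      exact map_one (algebraMap A.Even x.asIdeal.ResidueField)
    map_mul' := fun a b => by
      rw [evenProj_mul, map_add, map_mul, key _ (oddMul_mem hK x _ _), add_zero]
      rfl
    map_zero' := by
      rw [evenProj_of_even (zero_mem (A.grading 0))]
      exact map_zero (algebraMap A.Even x.asIdeal.ResidueField)
    map_add' := fun a b => by rw [evenProj_add, map_add]; rfl
    commutes' := fun k => by
      have : A.evenProj (algebraMap K A k) = algebraMap K A.Even k :=
        evenProj_of_even (algebraMap K A.Even k).2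
      rw [this]
      exact (IsScalarTower.algebraMap_apply K A.Even x.asIdeal.ResidueField k).symm
    map_mem := by
      intro i a ha
      show algebraMap A.Even x.asIdeal.ResidueField (A.evenProj a) ∈
        evenGrading (K := K) x.asIdeal.ResidueField i
      rcases zmod_two_cases i with rfl | rfl
      · rw [evenGrading_zero]; trivial
      · rw [evenProj_of_odd ha, map_zero]; exact zero_mem _ }

theorem toResidueField_eq_zero_iff (hK : (2 : K) ≠ 0) (x : PrimeSpectrum A.Even) (a : A) :
    toResidueField hK x a = 0 ↔ A.evenProj a ∈ x.asIdeal :=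
  Ideal.algebraMap_residueField_eq_zero

theorem IsFieldExtension.asIdeal_eq_bot {F : SAlg K} (hF : F.IsFieldExtension)
    (b : PrimeSpectrum F.Even) : b.asIdeal = ⊥ := by
  refine eq_bot_iff.2 fun a ha => ?_
  by_contra h
  have ha0 : a.1 ≠ 0 := fun e => h (Subtype.ext e)
  obtain ⟨c, hc⟩ := hF.2.mul_inv_cancel ha0
  obtain ⟨d, hd, e, he, rfl⟩ := F.exists_add c
  rw [hF.1, Submodule.mem_bot] at he
  subst he
  rw [add_zero] at hc
  have : a * ⟨d, hd⟩ = 1 := Subtype.ext hc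
  exact b.isPrime.ne_top ((Ideal.eq_top_iff_one _).2 (this ▸ Ideal.mul_mem_right _ _ ha))

theorem IsFieldExtension.nontrivial {F : SAlg K} (hF : F.IsFieldExtension) :
    Nontrivial F.Even := by
  obtain ⟨a, b, h⟩ := hF.2.exists_pair_ne
  refine ⟨0, 1, fun e => h ?_⟩
  have e' : (0 : F) = 1 := congrArg Subtype.val e
  rw [← mul_one a, ← mul_one b, ← e', mul_zero, mul_zero]

/-- The only prime of the residue field is zero, and its preimage is the kernel of evaluation on
`A₀`, that is `x`. Statements about field-valued points thereby become statements about points of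
the spectrum. -/
theorem specMap_toResidueField (hK : (2 : K) ≠ 0) (x : PrimeSpectrum A.Even)
    (b : PrimeSpectrum (residueField x).Even) : specMap (toResidueField hK x) b = x := by
  refine PrimeSpectrum.ext (Ideal.ext fun a => ?_)
  have hb := (residueField_isFieldExtension x).asIdeal_eq_bot b
  show evenMap (toResidueField hK x) a ∈ b.asIdeal ↔ _
  rw [hb, Submodule.mem_bot]
  refine Iff.trans ?_ ((toResidueField_eq_zero_iff hK x a.1).trans ?_)
  · exact Subtype.ext_iff
  · rw [evenProj_of_even a.2]

end ResidueField

/-! ### The subfunctors `D(I)` and open subsets of the spectrum -/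

section BasicOpen

variable {A B : SAlg K}

/-- The open subset of the spectrum defined by a superideal. -/
def openOfSuperideal (I : A.Superideal) : Opens A.specTop :=
  ⟨{x | ∃ a : A.Even, a.1 ∈ I ∧ a ∉ x.asIdeal}, by
    have : {x : PrimeSpectrum A.Even | ∃ a : A.Even, a.1 ∈ I ∧ a ∉ x.asIdeal} =
        ⋃ a : {a : A.Even // a.1 ∈ I}, (PrimeSpectrum.basicOpen a.1 : Set (PrimeSpectrum A.Even)) := by
      ext x; simp
    refine (congrArg IsOpen this).mpr (isOpen_iUnion fun a => (PrimeSpectrum.basicOpen a.1).isOpen)⟩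

/-- If a prime `b` of `B` is mapped outside the open set, `φ(I)` dies in the residue field at `b`
and cannot generate `1`. Conversely, if the images of the even elements of `I` generated a proper
ideal of `B₀`, a maximal ideal above it would contradict the hypothesis; so these elements alone
generate the unit ideal. -/
theorem mem_basicOpenSubfunctor_iff (hK : (2 : K) ≠ 0) (I : A.Superideal) (φ : A ⟶ B) :
    φ ∈ (basicOpenSubfunctor A I).obj B ↔ ∀ b, specMap φ b ∈ openOfSuperideal I := by
  show Ideal.span ((fun a : A => φ a) '' (I : Set A)) = ⊤ ↔ _
  constructor
  · intro h (b : PrimeSpectrum B.Even)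
    by_contra hb
    have hb' : ∀ a : A.Even, a.1 ∈ I → evenMap φ a ∈ b.asIdeal := fun a ha => by
      by_contra h'
      exact hb ⟨a, ha, h'⟩
    have hle : Ideal.span ((fun a : A => φ a) '' (I : Set A)) ≤
        RingHom.ker (ConcreteCategory.hom (toResidueField hK b)) := by
      refine Ideal.span_le.2 ?_
      rintro _ ⟨a, ha, rfl⟩
      refine (toResidueField_eq_zero_iff hK b _).2 ?_
      -- Homogeneity of `I` allows testing only its even elements.
      have e0 : (A.evenProj a).1 ∈ I := by
        have h0 := I.isHomogeneous 0 ha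
        exact h0
      have := hb' _ e0
      exact (evenProj_hom φ a).symm ▸ this
    rw [h] at hle
    have h1 : toResidueField hK b (1 : B) = 0 := hle (Submodule.mem_top (x := (1 : B)))
    have h2 := (toResidueField_eq_zero_iff hK b _).1 h1
    rw [evenProj_of_even (SetLike.GradedOne.one_mem : (1 : B) ∈ B.grading 0)] at h2
    exact b.isPrime.ne_top ((Ideal.eq_top_iff_one _).2 h2)
  · intro h
    have h' : Ideal.span {b : B.Even | ∃ a : A.Even, a.1 ∈ I ∧ evenMap φ a = b} = ⊤ := by
      by_contra hne
      obtain ⟨m, hm, hle⟩ := Ideal.exists_le_maximal _ hne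
      obtain ⟨a, ha, ha'⟩ := h ⟨m, hm.isPrime⟩
      exact ha' (hle (Ideal.subset_span ⟨a, ha, rfl⟩))
    have h'' := congrArg (Ideal.map (algebraMap B.Even B)) h'
    rw [Ideal.map_span, Ideal.map_top, ← top_le_iff] at h''
    refine top_le_iff.1 (h''.trans (Ideal.span_mono ?_))
    rintro _ ⟨_, ⟨a, ha, rfl⟩, rfl⟩
    exact ⟨a.1, ha, rfl⟩

/-- Every open subset of the spectrum is defined by a superideal. -/
theorem exists_openOfSuperideal_eq (hK : (2 : K) ≠ 0) (U : Opens A.specTop) :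
    ∃ I : A.Superideal, openOfSuperideal I = U := by
  obtain ⟨s, hs⟩ := (PrimeSpectrum.isOpen_iff (R := A.Even) U.1).1 U.2
  refine ⟨⟨Ideal.span (algebraMap A.Even A '' s), Ideal.homogeneous_span _ _ ?_⟩,
    Opens.ext (Set.ext fun (x : PrimeSpectrum A.Even) => ?_)⟩
  · rintro _ ⟨a, -, rfl⟩
    exact ⟨0, a.2⟩
  · have hx : x ∈ U.1 ↔ ¬ s ⊆ x.asIdeal := by
      refine (Iff.trans ?_ (not_congr (PrimeSpectrum.mem_zeroLocus x s)))
      rw [← hs]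
      exact not_not.symm
    refine Iff.trans ?_ hx.symm
    constructor
    · rintro ⟨a, ha, hax⟩ hsx
      -- The span in `A` has coefficients with odd parts; passing to the residue field at `x` shows
      -- that its even elements still lie in `x`.
      have hle : Ideal.span (algebraMap A.Even A '' s) ≤
          RingHom.ker (ConcreteCategory.hom (toResidueField hK x)) := by
        refine Ideal.span_le.2 ?_
        rintro _ ⟨b, hb, rfl⟩
        refine (toResidueField_eq_zero_iff hK x _).2 ?_
        have : A.evenProj (algebraMap A.Even A b) = b := evenProj_of_even b.2
        exact this.symm ▸ hsx hb
      have h := (toResidueField_eq_zero_iff hK x _).1 (hle ha)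
      rw [evenProj_of_even a.2] at h
      exact hax h
    · intro h
      obtain ⟨a, ha, hax⟩ := Set.not_subset.1 h
      exact ⟨a, Ideal.subset_span ⟨a, ha, rfl⟩, hax⟩

end BasicOpen

/-- A bijective morphism of superalgebras is an isomorphism. -/
theorem isIso_of_bijective {A B : SAlg K} (φ : A ⟶ B) (h : Function.Bijective φ) : IsIso φ := by
  let e : A ≃ₐ[K] B := AlgEquiv.ofBijective (ConcreteCategory.hom φ : A.grading →ₐᵍ[K] B.grading).toAlgHom h
  have he (b : B) : φ (e.symm b) = b := e.apply_symm_apply b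
  let ψ : B ⟶ A :=
    { (e.symm : B →ₐ[K] A) with
      map_mem := fun {i b} hb => by
        show e.symm b ∈ A.grading i
        -- Comparing components in `B`, `b` is the image of the degree `i` component of `e.symm b`,
        -- so `e.symm b` equals that component.
        have h1 := evenProj_add_oddProj (e.symm b)
        have h2 : φ (A.evenProj (e.symm b)) + φ (A.oddProj (e.symm b)) = b := by
          rw [← map_add, h1, he]
        rcases zmod_two_cases i with rfl | rfl
        · have := (B.eq_of_add_eq (hom_map_mem φ (A.evenProj (e.symm b)).2) hb
            (hom_map_mem φ (A.oddProj (e.symm b)).2) (zero_mem _) (h2.trans (add_zero b).symm)).1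
          rw [← this]
          exact (e.symm_apply_apply (A.evenProj (e.symm b) : A)).symm ▸ (A.evenProj (e.symm b)).2
        · have := (B.eq_of_add_eq (hom_map_mem φ (A.evenProj (e.symm b)).2) (zero_mem _)
            (hom_map_mem φ (A.oddProj (e.symm b)).2) hb (h2.trans (zero_add b).symm)).2
          rw [← this]
          exact (e.symm_apply_apply (A.oddProj (e.symm b) : A)).symm ▸ (A.oddProj (e.symm b)).2 }
  exact ⟨ψ, GradedAlgHom.ext fun a => e.symm_apply_apply a, GradedAlgHom.ext he⟩

/-! ### The even part of a localization -/

section Localization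

variable (A : SAlg K) (S : Submonoid A.Even)

theorem isUnit_evenMap_toLocalization (s : S) : IsUnit (evenMap (A.toLocalization S) s) :=
  IsUnit.of_mul_eq_one (⟨(LocalizedModule.mk 1 s : LocalizedModule S A),
      ⟨1, SetLike.GradedOne.one_mem, _, rfl⟩⟩ : (A.localization S).Even)
      (Subtype.ext (A.mul_eq_one S _ _ s 1 s.2 S.one_mem rfl rfl))

/-- An even fraction has an even numerator, so `(S⁻¹A)₀ = S⁻¹(A₀)`, and the topology of its spectrum
comes from commutative algebra. -/
theorem isLocalization_even : @IsLocalization _ _ S (A.localization S).Even _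
    (evenMap (A.toLocalization S)).toAlgebra := by
  let _ := (evenMap (A.toLocalization S)).toAlgebra
  refine ⟨fun s => A.isUnit_evenMap_toLocalization S s, ?_, ?_⟩
  · rintro ⟨_, a, ha, s, rfl⟩
    refine ⟨⟨⟨a, ha⟩, s⟩, Subtype.ext ?_⟩
    refine (LocalizedModule.mk_mul_mk (a₁ := a) (s₁ := s) (a₂ := s.1.1) (s₂ := 1)).trans ?_
    refine LocalizedModule.mk_eq.2 ⟨1, congrArg (1 • ·) ?_⟩
    rw [one_smul, mul_one]
    exact (A.even_comm s.1.2 a).symm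
  · intro a b h
    obtain ⟨u, hu⟩ := LocalizedModule.mk_eq.1 (congrArg Subtype.val h)
    refine ⟨u, Subtype.ext ?_⟩
    have hu' : u.1 • (1 : A.Even) • a.1 = u.1 • (1 : A.Even) • b.1 := hu
    rwa [one_smul, one_smul] at hu'

end Localization

end SAlg

namespace GeomSuperspace

variable {K : Type u} [Field K]

/-! ### Restriction and gluing of sections -/

section Sections

variable (X : GeomSuperspace K)

/-- The superalgebra of sections of a geometric superspace on an open subset. -/
abbrev Γ (U : Opens X.carrier) : SAlg K := X.presheaf.obj (op U)

/-- Restriction of sections. -/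
abbrev res {U V : Opens X.carrier} (h : V ≤ U) : X.Γ U ⟶ X.Γ V := X.presheaf.map (homOfLE h).op

variable {X}

theorem res_res {U V W : Opens X.carrier} (h : V ≤ U) (h' : W ≤ V) (s : X.Γ U) :
    X.res h' (X.res h s) = X.res (h'.trans h) s :=
  (ConcreteCategory.congr_hom (X.presheaf.map_comp (homOfLE h).op (homOfLE h').op) s).symm

/-- The sheaf of sets underlying the structure sheaf. -/
def typeSheaf (X : GeomSuperspace K) : TopCat.Sheaf (Type u) X.carrier := ⟨_, X.isSheaf⟩

theorem eq_of_locally_eq {U : Opens X.carrier} (s t : X.Γ U)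
    (h : ∀ x ∈ U, ∃ (V : Opens X.carrier) (hV : V ≤ U), x ∈ V ∧ X.res hV s = X.res hV t) :
    s = t := by
  choose V hV hx e using fun x : U => h x.1 x.2
  exact X.typeSheaf.eq_of_locally_eq' V U (fun x => homOfLE (hV x))
    (fun x hxU => Opens.mem_iSup.2 ⟨⟨x, hxU⟩, hx ⟨x, hxU⟩⟩) s t e

theorem exists_glue {ι : Type*} {U : Opens X.carrier} (V : ι → Opens X.carrier)
    (hV : ∀ i, V i ≤ U) (cov : ∀ x ∈ U, ∃ i, x ∈ V i) (s : ∀ i, X.Γ (V i))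
    (h : ∀ i j, X.res (inf_le_left : V i ⊓ V j ≤ V i) (s i) =
      X.res (inf_le_right : V i ⊓ V j ≤ V j) (s j)) :
    ∃ t : X.Γ U, ∀ i, X.res (hV i) t = s i := by
  obtain ⟨t, ht, -⟩ := X.typeSheaf.existsUnique_gluing' V U (fun i => homOfLE (hV i))
    (fun x hxU => Opens.mem_iSup.2 (cov x hxU))
    (show ∀ i, ToType (X.typeSheaf.1.obj (op (V i))) from s) (fun i j => h i j)
  exact ⟨t, ht⟩

end Sections

/-! ### Open immersions of geometric superspaces -/

section Morphisms

variable {X Y Z : GeomSuperspace K}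

/-- The forgetful functor to spaces with a presheaf of superalgebras. -/
def toPresheafedSpaceFunctor : GeomSuperspace K ⥤ PresheafedSpace.{u, u + 1, u} (SAlg K) where
  obj X := X.toPresheafedSpace
  map f := f.hom

/-- The action of a morphism on sections. -/
abbrev app (f : X ⟶ Y) (V : Opens Y.carrier) : Y.Γ V ⟶ X.Γ ((Opens.map f.hom.base).obj V) :=
  f.hom.c.app (op V)

theorem app_res (f : X ⟶ Y) {V V' : Opens Y.carrier} (h : V' ≤ V) (s : Y.Γ V) :
    app f V' (Y.res h s) =
      X.res (show (Opens.map f.hom.base).obj V' ≤ (Opens.map f.hom.base).obj V from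
        fun _ hx => h hx) (app f V s) :=
  ConcreteCategory.congr_hom (f.hom.c.naturality (homOfLE h).op) s

/-- Open immersions of geometric superspaces. -/
abbrev IsOpenImm (f : X ⟶ Y) : Prop := PresheafedSpace.IsOpenImmersion f.hom

/-- The functor `evenPart` preserves isomorphisms. Stalks are only formed on even parts, so this
gives access to the stalk isomorphisms of open immersions. -/
theorem isOpenImmersion_evenSpace {X Y : PresheafedSpace.{u, u + 1, u} (SAlg K)} (f : X ⟶ Y)
    [PresheafedSpace.IsOpenImmersion f] :
    PresheafedSpace.IsOpenImmersion ((evenSpace K).map f) where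
  base_open := PresheafedSpace.IsOpenImmersion.base_open (f := f)
  c_iso U := by
    have h := PresheafedSpace.IsOpenImmersion.c_iso (f := f) U
    exact @Functor.map_isIso _ _ _ _ _ _ (SAlg.evenPart K) _ h

theorem isLocalOnStalks_of_isOpenImmersion
    {X Y : PresheafedSpace.{u, u + 1, u} CommRingCat.{u}} (f : X ⟶ Y)
    [PresheafedSpace.IsOpenImmersion f] : IsLocalOnStalks f := fun x => by
  have : IsIso (f.stalkMap x) := PresheafedSpace.IsOpenImmersion.stalk_iso f x
  exact isLocalHom_of_isIso _

/-- Lets locality of a glued morphism at a point be checked after composing with a chart through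
that point. -/
theorem isLocalHom_stalkMap_of_comp {X Y Z : PresheafedSpace.{u, u + 1, u} CommRingCat.{u}}
    (f : X ⟶ Y) (g : Y ⟶ Z) (x : X) (h : IsLocalHom ((f ≫ g).stalkMap x).hom) :
    IsLocalHom (g.stalkMap (f.base x)).hom := by
  constructor
  intro a ha
  refine h.map_nonunit a ?_
  have := ha.map (f.stalkMap x).hom
  rw [PresheafedSpace.stalkMap.comp]
  exact this

theorem isLocalHom_stalkMap_of_comp_isOpenImmersion
    {X Y Z : PresheafedSpace.{u, u + 1, u} CommRingCat.{u}}
    (f : X ⟶ Y) (g : Y ⟶ Z) [PresheafedSpace.IsOpenImmersion g] (x : X)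
    (h : IsLocalHom ((f ≫ g).stalkMap x).hom) :
    IsLocalHom (f.stalkMap x).hom := by
  constructor
  intro a ha
  have hi : IsIso (g.stalkMap (f.base x)) := inferInstance
  obtain ⟨b, rfl⟩ := (ConcreteCategory.bijective_of_isIso (g.stalkMap (f.base x))).2 a
  have hb : IsUnit b := h.map_nonunit b (by
    rw [PresheafedSpace.stalkMap.comp]
    exact ha)
  exact hb.map (g.stalkMap (f.base x)).hom

/-- A morphism with range in that of an open immersion factors through it. -/
theorem exists_lift (f : X ⟶ Z) (g : Y ⟶ Z) [IsOpenImm g]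
    (h : ∀ x, ∃ y, g.hom.base y = f.hom.base x) : ∃ l : X ⟶ Y, l ≫ g = f := by
  have h' : Set.range f.hom.base ⊆ Set.range g.hom.base := by
    rintro _ ⟨x, rfl⟩; exact h x
  have e := PresheafedSpace.IsOpenImmersion.lift_fac g.hom f.hom h'
  refine ⟨⟨PresheafedSpace.IsOpenImmersion.lift g.hom f.hom h', fun x => ?_⟩, Hom.ext e⟩
  have := isOpenImmersion_evenSpace g.hom
  refine isLocalHom_stalkMap_of_comp_isOpenImmersion _ ((evenSpace K).map g.hom) x ?_
  rw [← Functor.map_comp, e]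
  exact f.isLocal x

instance (g : Y ⟶ Z) [IsOpenImm g] : Mono g where
  right_cancellation _ _ h := Hom.ext ((cancel_mono g.hom).1 (congrArg Hom.hom h))

instance (f : X ⟶ Y) [IsIso f] : IsIso f.hom :=
  inferInstanceAs (IsIso (toPresheafedSpaceFunctor.map f))

instance (f : X ⟶ Y) (g : Y ⟶ Z) [IsOpenImm f] [IsOpenImm g] : IsOpenImm (f ≫ g) :=
  inferInstanceAs (PresheafedSpace.IsOpenImmersion (f.hom ≫ g.hom))

/-- The inclusion of an open subspace. -/
def ofRestrict (X : GeomSuperspace K) (U : Opens X.carrier) : X.restrict U ⟶ X where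
  hom := X.toPresheafedSpace.ofRestrict U.isOpenEmbedding
  isLocal :=
    have : PresheafedSpace.IsOpenImmersion (X := (X.restrict U).toPresheafedSpace)
        (X.toPresheafedSpace.ofRestrict U.isOpenEmbedding) :=
      PresheafedSpace.IsOpenImmersion.ofRestrict X.toPresheafedSpace U.isOpenEmbedding
    have := isOpenImmersion_evenSpace (X := (X.restrict U).toPresheafedSpace)
      (X.toPresheafedSpace.ofRestrict U.isOpenEmbedding)
    isLocalOnStalks_of_isOpenImmersion _

instance (X : GeomSuperspace K) (U : Opens X.carrier) : IsOpenImm (X.ofRestrict U) :=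
  PresheafedSpace.IsOpenImmersion.ofRestrict X.toPresheafedSpace U.isOpenEmbedding

/-- The range of an open immersion. -/
def opensRange (f : X ⟶ Y) [IsOpenImm f] : Opens Y.carrier :=
  ⟨Set.range f.hom.base, (PresheafedSpace.IsOpenImmersion.base_open (f := f.hom)).isOpen_range⟩

theorem injective (f : X ⟶ Y) [IsOpenImm f] : Function.Injective f.hom.base :=
  (PresheafedSpace.IsOpenImmersion.base_open (f := f.hom)).injective

/-- The source of an open immersion is isomorphic to its range. -/
theorem nonempty_restrict_opensRange_iso (f : X ⟶ Y) [IsOpenImm f] :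
    Nonempty (Y.restrict (opensRange f) ≅ X) := by
  obtain ⟨a, ha⟩ := exists_lift (Y.ofRestrict (opensRange f)) f (fun x => x.2)
  obtain ⟨b, hb⟩ := exists_lift f (Y.ofRestrict (opensRange f))
    (fun x => ⟨⟨f.hom.base x, x, rfl⟩, rfl⟩)
  exact ⟨⟨a, b, (cancel_mono (Y.ofRestrict (opensRange f))).1 (by simp [ha, hb]),
    (cancel_mono f).1 (by simp [ha, hb])⟩⟩

/-- The image of an open subset under an open immersion. -/
def image (f : X ⟶ Y) [IsOpenImm f] (U : Opens X.carrier) : Opens Y.carrier :=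
  ⟨f.hom.base '' U, (PresheafedSpace.IsOpenImmersion.base_open (f := f.hom)).isOpenMap _ U.2⟩

theorem app_bijective (f : X ⟶ Y) [IsOpenImm f] (V : Opens Y.carrier)
    (hV : V ≤ opensRange f) : Function.Bijective (app f V) := by
  have hV' : V = (PresheafedSpace.IsOpenImmersion.opensFunctor f.hom).obj
      ((Opens.map f.hom.base).obj V) := by
    refine Opens.ext (Set.ext fun y => ⟨fun hy => ?_, ?_⟩)
    · obtain ⟨x, rfl⟩ := hV hy
      exact ⟨x, hy, rfl⟩
    · rintro ⟨x, hx, rfl⟩; exact hx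
  have : IsIso (app f V) := PresheafedSpace.IsOpenImmersion.c_iso' f.hom _ hV'
  exact ConcreteCategory.bijective_of_isIso (app f V)

end Morphisms

end GeomSuperspace

namespace SAlg

variable {K : Type u} [Field K]

/-! ### Global sections and unit germs on affine superspaces -/

section Fractions

variable (A : SAlg K)

/-- The section `a / t` of the structure sheaf. -/
def fracSection (a : A) (t : A.Even) (V : Opens A.specTop)
    (h : ∀ x : A.specTop, x ∈ V → t ∈ A.primeSubmonoid x) : A.sections V :=
  ⟨fun y => (LocalizedModule.mk a ⟨t, h y.1 y.2⟩ : LocalizedModule (A.primeSubmonoid y.1) A),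
    mem_sections fun y => ⟨V, y.2, le_rfl, a, t, fun y => ⟨h y.1 y.2, rfl⟩⟩⟩

/-- The canonical map from `A` to the sections of the structure sheaf. -/
def toSections (U : Opens A.specTop) : A ⟶ A.sections U where
  toFun a := A.fracSection a 1 U (fun x _ => (A.primeSubmonoid x).one_mem)
  map_one' := Subtype.ext (funext fun x => map_one (ConcreteCategory.hom (A.toLocalization (A.primeSubmonoid x.1))))
  map_mul' a b := Subtype.ext (funext fun x => map_mul (ConcreteCategory.hom (A.toLocalization (A.primeSubmonoid x.1))) a b)
  map_zero' := Subtype.ext (funext fun x => map_zero (ConcreteCategory.hom (A.toLocalization (A.primeSubmonoid x.1))))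
  map_add' a b := Subtype.ext (funext fun x => map_add (ConcreteCategory.hom (A.toLocalization (A.primeSubmonoid x.1))) a b)
  commutes' k := Subtype.ext (funext fun x => AlgHomClass.commutes (ConcreteCategory.hom (A.toLocalization (A.primeSubmonoid x.1))) k)
  map_mem ha x := hom_map_mem (A.toLocalization (A.primeSubmonoid x.1)) ha

/-- Apart from multiplication and grading, the structure sheaf is the sheaf of the `A₀`-module `A`,
whose global sections are `A`. -/
theorem toSections_top_bijective : Function.Bijective (A.toSections ⊤) :=
  StructureSheaf.toOpenₗ_top_bijective (R := A.Even) (M := A)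

theorem toSections_bijective {U : Opens A.specTop} (hU : U = ⊤) :
    Function.Bijective (A.toSections U) := by
  subst hU; exact A.toSections_top_bijective

variable {A}

theorem eq_of_forall_toLocalization_eq {a b : A}
    (h : ∀ x : PrimeSpectrum A.Even,
      A.toLocalization (A.primeSubmonoid x) a = A.toLocalization (A.primeSubmonoid x) b) : a = b :=
  A.toSections_top_bijective.1 (Subtype.ext (funext fun x => h x.1))

theorem mk_mul_toLocalization (S : Submonoid A.Even) (a : A) (t : S) :
    (show A.localization S from (LocalizedModule.mk a t : LocalizedModule S A)) *
      A.toLocalization S t.1.1 = A.toLocalization S a := by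
  refine (LocalizedModule.mk_mul_mk (a₁ := a) (s₁ := t) (a₂ := t.1.1) (s₂ := 1)).trans ?_
  refine LocalizedModule.mk_eq.2 ⟨1, congrArg (1 • ·) ?_⟩
  rw [one_smul, mul_one]
  exact (A.even_comm t.1.2 a).symm

theorem isUnit_toLocalization (S : Submonoid A.Even) (t : S) :
    IsUnit (A.toLocalization S t.1.1) :=
  (A.isUnit_evenMap_toLocalization S t).map (algebraMap (A.localization S).Even (A.localization S))

theorem isUnit_germ_iff (U : Opens A.specTop) (x : A.specTop) (hx : x ∈ U)
    (s : (A.sections U).Even) :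
    IsUnit (((evenSpace K).obj A.specPresheafedSpace).presheaf.germ U x hx s) ↔
      IsUnit (⟨s.1.1 ⟨x, hx⟩, s.2 ⟨x, hx⟩⟩ : (A.atPrime x).Even) := by
  rw [← A.germ_stalkEval_apply U x hx s]
  have := A.isLocalHom_stalkEval x
  exact (isUnit_map_iff (A.stalkEval x).hom _).symm

theorem isUnit_germ_toSections_iff (U : Opens A.specTop) (x : A.specTop) (hx : x ∈ U)
    (a : A.Even) :
    IsUnit (((evenSpace K).obj A.specPresheafedSpace).presheaf.germ U x hx
      (evenMap (A.toSections U) a)) ↔ a ∉ x.asIdeal :=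
  (isUnit_germ_iff U x hx _).trans (A.isUnit_mk_iff x a 1 _ rfl)

end Fractions

end SAlg

/-! ### Values of sections at points, and full faithfulness of `SSpec` -/

namespace GeomSuperspace

open SAlg

variable {K : Type u} [Field K] {A B C : SAlg K} {Y Z : GeomSuperspace K}

/-- Pull back a section along a morphism from an affine superspace and evaluate at a point. -/
def ev (c : B.sspec ⟶ Y) (V : Opens Y.carrier) (p : B.specTop) (hp : c.hom.base p ∈ V) :
    Y.Γ V ⟶ B.atPrime p :=
  app c V ≫ B.evalSection ((Opens.map c.hom.base).obj V) p hp

theorem ev_res (c : B.sspec ⟶ Y) {V V' : Opens Y.carrier} (h : V' ≤ V) (p : B.specTop)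
    (hp : c.hom.base p ∈ V') (s : Y.Γ V) :
    ev c V' p hp (Y.res h s) = ev c V p (h hp) s :=
  congrArg (B.evalSection _ p hp) (app_res c h s)

theorem ev_congr {c c' : B.sspec ⟶ Y} (h : c = c') (V : Opens Y.carrier) (p : B.specTop)
    (hp : c.hom.base p ∈ V) (s : Y.Γ V) : ev c V p hp s = ev c' V p (h ▸ hp) s := by
  subst h; rfl

/-- Sections on an affine superspace are functions with values in the `B_p`, so values determine the
comorphism. Sections are compared through `ev` from here on, rather than through germs. -/
theorem hom_ext_ev {c c' : B.sspec ⟶ Y} (hb : ∀ p, c.hom.base p = c'.hom.base p)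
    (h : ∀ (V : Opens Y.carrier) (p : B.specTop) (hp : c.hom.base p ∈ V)
      (hp' : c'.hom.base p ∈ V) (s : Y.Γ V), ev c V p hp s = ev c' V p hp' s) : c = c' := by
  obtain ⟨⟨b, f⟩, l⟩ := c
  obtain ⟨⟨b', f'⟩, l'⟩ := c'
  obtain rfl : b = b' := TopCat.hom_ext (ContinuousMap.ext hb)
  obtain rfl : f = f' := by
    refine NatTrans.ext (funext fun V => GradedAlgHom.ext fun s => Subtype.ext (funext fun p => ?_))
    exact h V.unop p.1 p.2 p.2 s
  rfl

section FullyFaithful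

/-- The pull back of the global section `a` has value `φ(a) / 1` at each prime, and an element of
`B` is determined by its images in all `B_p`. -/
theorem sspecMap_injective {φ ψ : A ⟶ B} (h : sspecMap φ = sspecMap ψ) : φ = ψ := by
  refine GradedAlgHom.ext fun a => eq_of_forall_toLocalization_eq fun x => ?_
  have h' := ev_congr (Y := A.sspec) h ⊤ x trivial (A.toSections ⊤ a)
  have e (χ : A ⟶ B) : ev (Y := A.sspec) (sspecMap χ) ⊤ x trivial (A.toSections ⊤ a) =
      B.toLocalization (B.primeSubmonoid x) (χ a) := by
    refine (stalkLocMap_mk χ x a 1 (Submonoid.one_mem _) _ rfl).trans ?_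
    show LocalizedModule.mk _ _ = LocalizedModule.mk _ _
    congr 1
    exact Subtype.ext (map_one (evenMap χ))
  exact (e φ).symm.trans (h'.trans (e ψ))

theorem exists_toSections_app (g : B.sspec ⟶ A.sspec) : ∃ φ : A ⟶ B, ∀ a,
    app g ⊤ (A.toSections ⊤ a) = B.toSections _ (φ a) := by
  let U : Opens B.specTop := (Opens.map g.hom.base).obj ⊤
  obtain ⟨ψ, -, h2⟩ := isIso_of_bijective (B.toSections U) (B.toSections_bijective rfl)
  let γ : A.sections ⊤ ⟶ B.sections U := app g ⊤
  refine ⟨A.toSections ⊤ ≫ γ ≫ ψ, fun a => ?_⟩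
  exact (ConcreteCategory.congr_hom h2 (γ (A.toSections ⊤ a))).symm

theorem ev_toSections {g : B.sspec ⟶ A.sspec} {φ : A ⟶ B}
    (h : ∀ a, app g ⊤ (A.toSections ⊤ a) = B.toSections _ (φ a)) (V : Opens A.specTop)
    (p : B.specTop) (hp : g.hom.base p ∈ V) (a : A) :
    ev g V p hp (A.toSections V a) = B.toLocalization (B.primeSubmonoid p) (φ a) := by
  have e : A.toSections V a = A.sspec.res (le_top : V ≤ ⊤) (A.toSections ⊤ a) := rfl
  rw [e]
  refine (ev_res g le_top p hp _).trans ?_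
  exact congrArg (B.evalSection ((Opens.map g.hom.base).obj ⊤) p trivial) (h a)

theorem isUnit_iff_of_isLocalHom {R S : Type*} [CommRing R] [CommRing S] (f : R →+* S)
    (hf : IsLocalHom f) (a : R) : IsUnit (f a) ↔ IsUnit a :=
  isUnit_map_iff f a

/-- Locality on stalks is decisive: `a ∉ g(p)` means that the germ of `a` at `g(p)` is a unit,
equivalently that its pull back at `p` is one, that is `φ(a) ∉ p`. -/
theorem base_eq_specMap {g : B.sspec ⟶ A.sspec} {φ : A ⟶ B}
    (h : ∀ a, app g ⊤ (A.toSections ⊤ a) = B.toSections _ (φ a)) (p : B.specTop) :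
    g.hom.base p = specMap φ p := by
  refine PrimeSpectrum.ext (Ideal.ext fun a => not_iff_not.1 ?_)
  have h1 := isUnit_germ_toSections_iff (A := A) ⊤ (g.hom.base p) trivial a
  have h2 := isUnit_germ_toSections_iff (A := B) ((Opens.map g.hom.base).obj ⊤) p trivial
    (evenMap φ a)
  have h3 := PresheafedSpace.stalkMap_germ_apply ((evenSpace K).map g.hom) ⊤ p trivial
    (evenMap (A.toSections ⊤) a)
  have h4 : ((evenSpace K).map g.hom).c.app (op ⊤) (evenMap (A.toSections ⊤) a) =
      evenMap (B.toSections ((Opens.map g.hom.base).obj ⊤)) (evenMap φ a) :=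
    Subtype.ext (h a.1)
  have h5 := isUnit_iff_of_isLocalHom _ (g.isLocal p)
    (((evenSpace K).obj A.specPresheafedSpace).presheaf.germ ⊤ (g.hom.base p) trivial
      (evenMap (A.toSections ⊤) a))
  refine h1.symm.trans (h5.symm.trans (Iff.trans ?_ h2))
  refine iff_of_eq (congrArg IsUnit ?_)
  exact h3.trans (congrArg _ h4)

/-- Take the `φ` given by `g` on global sections. A section is locally `a / t`, so `s t = a`; `g`
and `sspecMap φ` give `a` and `t` the same values, and the value of `t` is a unit, which can be
cancelled. -/
theorem exists_sspecMap_eq (g : B.sspec ⟶ A.sspec) : ∃ φ : A ⟶ B, sspecMap φ = g := by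
  obtain ⟨φ, h⟩ := exists_toSections_app g
  have h' : ∀ a, app (sspecMap φ) ⊤ (A.toSections ⊤ a) = B.toSections _ (φ a) := fun a => by
    refine Subtype.ext (funext fun x => ?_)
    refine (stalkLocMap_mk φ x.1 a 1 (Submonoid.one_mem _) _ rfl).trans ?_
    show LocalizedModule.mk _ _ = LocalizedModule.mk _ _
    congr 1
    exact Subtype.ext (map_one (evenMap φ))
  refine ⟨φ, hom_ext_ev (fun p => (base_eq_specMap h p).symm) fun V p hp hp' s => ?_⟩
  obtain ⟨V', hpV', hV', a, t, hat⟩ := exists_fraction s.2 ⟨specMap φ p, hp⟩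
  have hpg : g.hom.base p ∈ V' := (base_eq_specMap h p).symm ▸ hpV'
  have key : (show A.sections V' from A.sspec.res hV' s) * A.toSections V' t.1 = A.toSections V' a := by
    refine Subtype.ext (funext fun y => ?_)
    obtain ⟨ht, e⟩ := hat y
    exact (congrArg (· * _) e).trans (mk_mul_toLocalization (A.primeSubmonoid y.1) a ⟨t, ht⟩)
  have ht : evenMap φ t ∈ B.primeSubmonoid p := (hat ⟨_, hpV'⟩).1
  have hu := isUnit_toLocalization (B.primeSubmonoid p) ⟨_, ht⟩
  have k1 := (map_mul (ConcreteCategory.hom (ev g V' p hpg)) _ _).symm.trans (congrArg (ev g V' p hpg) key)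
  have k2 := (map_mul (ConcreteCategory.hom (ev (sspecMap φ) V' p hpV')) _ _).symm.trans (congrArg (ev (sspecMap φ) V' p hpV') key)
  have e1 := ev_toSections h V' p hpg
  have e2 := ev_toSections h' V' p hpV'
  refine (ev_res (sspecMap φ) hV' p hpV' s).symm.trans (Eq.trans ?_ (ev_res g hV' p hpg s))
  refine hu.mul_right_cancel ?_
  refine Eq.trans (congrArg (_ * ·) (e2 t.1).symm) (Eq.trans (k2.trans ?_) (congrArg (_ * ·) (e1 t.1)))
  exact (e2 a).trans ((e1 a).symm.trans k1.symm)

end FullyFaithful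

end GeomSuperspace

/-! ### Stalks of localizations and basic open subsets -/

namespace SAlg

variable {K : Type u} [Field K] {A : SAlg K}

theorem mk_eq_zero_iff (S : Submonoid A.Even) (a : A) (s : S) :
    (LocalizedModule.mk a s : LocalizedModule S A) = 0 ↔ ∃ u : S, u.1 • a = 0 := by
  rw [← LocalizedModule.zero_mk 1, LocalizedModule.mk_eq]
  refine exists_congr fun u => ?_
  show u.1 • (1 : A.Even) • a = u.1 • s.1 • (0 : A) ↔ _
  rw [one_smul, smul_zero, smul_zero]

/-- If `a` dies in `(S⁻¹A)_q`, it is killed by a fraction `u / v` outside `q`; then `w u a = 0` in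
`A` for some `w ∈ S`, and `w u` lies outside the preimage of `q`. Equality of values at a point can
therefore be tested after localization. -/
theorem stalkLocMap_toLocalization_injective (S : Submonoid A.Even)
    (q : (A.localization S).specTop) :
    Function.Injective (stalkLocMap (A.toLocalization S) q) := by
  refine (injective_iff_map_eq_zero (ConcreteCategory.hom (stalkLocMap (A.toLocalization S) q))).2
    fun z hz => ?_
  obtain ⟨⟨a, s, hs⟩, rfl⟩ := Quotient.exists_rep z
  have h := (stalkLocMap_mk (A.toLocalization S) q a s hs _ rfl).symm.trans hz
  obtain ⟨⟨⟨_, u, hu, v, rfl⟩, huq⟩, hu'⟩ := (mk_eq_zero_iff _ _ _).1 h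
  have hu'' : (LocalizedModule.mk u v : LocalizedModule S A) * LocalizedModule.mk a 1 = 0 := hu'
  rw [LocalizedModule.mk_mul_mk] at hu''
  obtain ⟨w, hw⟩ := (mk_eq_zero_iff _ _ _).1 hu''
  refine (mk_eq_zero_iff _ _ _).2 ⟨⟨w.1 * ⟨u, hu⟩, ?_⟩, ?_⟩
  · intro hmem
    have hmem' : evenMap (A.toLocalization S) (w.1 * ⟨u, hu⟩) ∈ q.asIdeal := hmem
    rw [map_mul] at hmem'
    rcases q.isPrime.mem_or_mem hmem' with h1 | h1
    · exact q.isPrime.ne_top (Ideal.eq_top_of_isUnit_mem _ h1 (A.isUnit_evenMap_toLocalization S w))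
    · refine huq ?_
      have e : (⟨(LocalizedModule.mk u v : LocalizedModule S A), ⟨u, hu, v, rfl⟩⟩ :
          (A.localization S).Even) * evenMap (A.toLocalization S) v.1 =
          evenMap (A.toLocalization S) ⟨u, hu⟩ :=
        Subtype.ext (mk_mul_toLocalization S u v)
      rw [← e] at h1
      refine (q.isPrime.mem_or_mem h1).resolve_right fun h2 => ?_
      exact q.isPrime.ne_top (Ideal.eq_top_of_isUnit_mem _ h2 (A.isUnit_evenMap_toLocalization S v))
  · exact (mul_assoc w.1.1 u a).trans hw

/-- The localization `A_f`. -/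
abbrev away (f : A.Even) : SAlg K := A.localization (Submonoid.powers f)

/-- The canonical map `A → A_f`. -/
abbrev toAway (f : A.Even) : A ⟶ away f := A.toLocalization (Submonoid.powers f)

theorem isOpenEmbedding_specMap_toAway (f : A.Even) :
    Topology.IsOpenEmbedding (specMap (toAway f)) := by
  let _ := (evenMap (toAway f)).toAlgebra
  have : IsLocalization.Away f (away f).Even := A.isLocalization_even _
  exact PrimeSpectrum.localization_away_isOpenEmbedding (away f).Even f

theorem exists_specMap_toAway_eq_iff (f : A.Even) (x : A.specTop) :
    (∃ q, specMap (toAway f) q = x) ↔ f ∉ x.asIdeal := by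
  let _ := (evenMap (toAway f)).toAlgebra
  have : IsLocalization.Away f (away f).Even := A.isLocalization_even _
  have h := PrimeSpectrum.localization_away_comap_range (away f).Even f
  exact Set.ext_iff.1 h x

theorem exists_away_subset (U : Opens A.specTop) (x : A.specTop) (hx : x ∈ U) :
    ∃ f : A.Even, (∃ q, specMap (toAway f) q = x) ∧ ∀ q, specMap (toAway f) q ∈ U := by
  obtain ⟨_, ⟨f, rfl⟩, hxf, hf⟩ :=
    (PrimeSpectrum.isTopologicalBasis_basic_opens (R := A.Even)).exists_subset_of_mem_open hx U.2
  exact ⟨f, (exists_specMap_toAway_eq_iff f x).2 hxf, fun q =>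
    hf ((exists_specMap_toAway_eq_iff f _).1 ⟨q, rfl⟩)⟩

end SAlg

/-! ### Open immersions and affine coverings tested on values -/

namespace GeomSuperspace

open SAlg

variable {K : Type u} [Field K] {A B C : SAlg K} {Y Z : GeomSuperspace K}

/-- A criterion for open immersions from affine superspaces in terms of values of sections. -/
theorem isOpenImm_of_ev (c : B.sspec ⟶ Y) (hb : Topology.IsOpenEmbedding c.hom.base)
    (inj : ∀ (V : Opens Y.carrier), (∀ y ∈ V, ∃ p, c.hom.base p = y) → ∀ s t : Y.Γ V,
      (∀ p hp, ev c V p hp s = ev c V p hp t) → s = t)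
    (surj : ∀ (U : Opens B.specTop) (σ : B.sections U) (p : B.specTop), p ∈ U →
      ∃ V : Opens Y.carrier, c.hom.base p ∈ V ∧ ∃ τ : Y.Γ V, ∀ (q : B.specTop)
        (hq : c.hom.base q ∈ V), ∃ hqU : q ∈ U, ev c V q hq τ = σ.1 ⟨q, hqU⟩) :
    IsOpenImm c where
  base_open := hb
  c_iso U := by
    refine isIso_of_bijective _ ⟨fun s t h => ?_, fun σ => ?_⟩
    · refine inj _ ?_ s t fun p hp => ?_
      · rintro _ ⟨p, -, rfl⟩; exact ⟨p, rfl⟩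
      · exact congrArg (B.evalSection _ p hp) h
    · let V₀ : Opens Y.carrier := hb.functor.obj U
      let U₀ : Opens B.specTop := (Opens.map c.hom.base).obj V₀
      have hV₀ : ∀ y ∈ V₀, ∃ p, c.hom.base p = y := by
        rintro _ ⟨p, -, rfl⟩; exact ⟨p, rfl⟩
      choose V hV τ hτ using fun p : U₀ => surj U₀ σ p.1 p.2
      have hW (p : U₀) : V p ⊓ V₀ ≤ V₀ := inf_le_right
      -- The local preimages agree on overlaps by `inj`, since they have the same values there.
      obtain ⟨t, ht⟩ := Y.exists_glue (U := V₀) (fun p => V p ⊓ V₀) hW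
        (fun y hy => by
          obtain ⟨p, rfl⟩ := hV₀ y hy
          exact ⟨⟨p, hy⟩, hV ⟨p, hy⟩, hy⟩)
        (fun p => Y.res inf_le_left (τ p)) (fun p q => by
          refine inj _ (fun y (hy : y ∈ (V p ⊓ V₀) ⊓ (V q ⊓ V₀)) => hV₀ y hy.1.2) _ _ fun r hr => ?_
          rw [res_res, res_res, ev_res, ev_res]
          obtain ⟨_, e1⟩ := hτ p r hr.1.1
          obtain ⟨_, e2⟩ := hτ q r hr.2.1
          exact e1.trans e2.symm)
      refine ⟨t, Subtype.ext (funext fun p => ?_)⟩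
      have hp : c.hom.base p.1 ∈ V ⟨p.1, p.2⟩ ⊓ V₀ := ⟨hV _, p.2⟩
      have h1 := ev_res c (hW ⟨p.1, p.2⟩) p.1 hp t
      have h2 := ev_res c (inf_le_left : V ⟨p.1, p.2⟩ ⊓ V₀ ≤ _) p.1 hp (τ ⟨p.1, p.2⟩)
      obtain ⟨_, e⟩ := hτ ⟨p.1, p.2⟩ p.1 (hV _)
      exact h1.symm.trans ((congrArg (ev c _ p.1 hp) (ht ⟨p.1, p.2⟩)).trans (h2.trans e))

/-- Injectivity on sections is injectivity on stalks. For surjectivity, a section over `A_f` is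
locally `r / s` with `r = b / n`, `s = t / m` and `n`, `m` powers of `f`; over `A` it is represented
by `m b / (n t)`. -/
instance isOpenImm_toAway (f : A.Even) : IsOpenImm (sspecMap (toAway f)) := by
  refine isOpenImm_of_ev (Y := A.sspec) _ (isOpenEmbedding_specMap_toAway f) ?_ ?_
  · intro V hV s t h
    refine Subtype.ext (funext fun x => ?_)
    obtain ⟨x, hx⟩ := x
    obtain ⟨q, rfl⟩ := hV x hx
    exact stalkLocMap_toLocalization_injective _ q (h q hx)
  · intro U σ p hp
    obtain ⟨U', hpU', hU', r, s, H⟩ := exists_fraction σ.2 ⟨p, hp⟩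
    obtain ⟨⟨b, n⟩, hr⟩ := Quotient.exists_rep r
    obtain ⟨t, ht, m, hs⟩ := s.2
    have er : r * toAway f n.1.1 = toAway f b := by
      rw [← hr]; exact mk_mul_toLocalization (Submonoid.powers f) b n
    have es : s.1 * toAway f m.1.1 = toAway f t := by
      rw [hs]; exact mk_mul_toLocalization (Submonoid.powers f) t m
    have hV (q : (away f).specTop) (hq : q ∈ U') :
        n.1 * ⟨t, ht⟩ ∈ A.primeSubmonoid (specMap (toAway f) q) := by
      refine mul_mem (fun h => ?_) (fun h => ?_)
      · exact q.isPrime.ne_top (Ideal.eq_top_of_isUnit_mem _ h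
          (A.isUnit_evenMap_toLocalization (Submonoid.powers f) n))
      · have h' : s * evenMap (toAway f) m.1 ∈ q.asIdeal := by
          have e : s * evenMap (toAway f) m.1 = evenMap (toAway f) ⟨t, ht⟩ := Subtype.ext es
          rw [e]; exact h
        refine (q.isPrime.mem_or_mem h').elim (H ⟨q, hq⟩).1 fun h2 => ?_
        exact q.isPrime.ne_top (Ideal.eq_top_of_isUnit_mem _ h2
          (A.isUnit_evenMap_toLocalization (Submonoid.powers f) m))
    refine ⟨⟨specMap (toAway f) '' U', (isOpenEmbedding_specMap_toAway f).isOpenMap _ U'.2⟩,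
      ⟨p, hpU', rfl⟩, A.fracSection (m.1.1 * b) (n.1 * ⟨t, ht⟩) _ ?_, ?_⟩
    · rintro _ ⟨q, hq, rfl⟩
      exact hV q hq
    · intro q hq
      obtain ⟨q', hq', e⟩ := hq
      obtain rfl : q' = q := (isOpenEmbedding_specMap_toAway f).injective e
      refine ⟨hU' hq', ?_⟩
      obtain ⟨hs', e'⟩ := H ⟨q', hq'⟩
      refine Eq.trans ?_ e'.symm
      refine (stalkLocMap_mk (toAway f) q' (m.1.1 * b) _ (hV q' hq') _ rfl).trans ?_
      refine LocalizedModule.mk_eq.2 ⟨1, congrArg (1 • ·) ?_⟩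
      show s.1 * toAway f (m.1.1 * b) = toAway f (n.1.1 * t) * r
      rw [map_mul, map_mul, ← mul_assoc, es, ← er, ← mul_assoc,
        ← (away f).even_comm (hom_map_mem (toAway f) n.1.2) (toAway f t * r), mul_assoc]

/-- Sections are determined by their values along an affine open covering. -/
theorem eq_of_forall_ev_eq (S : ∀ B : SAlg K, (B.sspec ⟶ Y) → Prop)
    (cov : ∀ y : Y.carrier, ∃ (B : SAlg K) (c : B.sspec ⟶ Y), S B c ∧ IsOpenImm c ∧
      ∃ p, c.hom.base p = y) {V : Opens Y.carrier} {s t : Y.Γ V}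
    (h : ∀ (B : SAlg K) (c : B.sspec ⟶ Y), S B c → IsOpenImm c → ∀ p hp,
      ev c V p hp s = ev c V p hp t) : s = t := by
  refine eq_of_locally_eq s t fun y hy => ?_
  obtain ⟨B, c, hc, hoc, p, rfl⟩ := cov y
  have hle : V ⊓ opensRange c ≤ V := inf_le_left
  refine ⟨V ⊓ opensRange c, hle, ⟨hy, p, rfl⟩, ?_⟩
  refine (app_bijective c _ inf_le_right).1 (Subtype.ext (funext fun q => ?_))
  have e := h B c hc hoc q.1 q.2.1
  rw [← ev_res c hle q.1 q.2, ← ev_res c hle q.1 q.2] at e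
  exact e

/-- A section all of whose values are homogeneous is homogeneous. -/
theorem mem_grading_of_forall_ev_mem (S : ∀ B : SAlg K, (B.sspec ⟶ Y) → Prop)
    (cov : ∀ y : Y.carrier, ∃ (B : SAlg K) (c : B.sspec ⟶ Y), S B c ∧ IsOpenImm c ∧
      ∃ p, c.hom.base p = y) {V : Opens Y.carrier} {s : Y.Γ V} {i : ZMod 2}
    (h : ∀ (B : SAlg K) (c : B.sspec ⟶ Y), S B c → IsOpenImm c → ∀ p hp,
      ev c V p hp s ∈ (B.atPrime p).grading i) : s ∈ (Y.Γ V).grading i := by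
  have hs := evenProj_add_oddProj s
  rcases zmod_two_cases i with rfl | rfl
  · have e : ((Y.Γ V).oddProj s).1 = 0 := eq_of_forall_ev_eq S cov fun B c hc hoc p hp => by
      refine ((B.atPrime p).eq_of_add_eq (hom_map_mem (ev c V p hp) ((Y.Γ V).evenProj s).2)
        (h B c hc hoc p hp) (hom_map_mem (ev c V p hp) ((Y.Γ V).oddProj s).2) (zero_mem _) ?_).2.trans
        (map_zero (ConcreteCategory.hom (ev c V p hp))).symm
      rw [← map_add, hs, add_zero]
    rw [← hs, e, add_zero]
    exact ((Y.Γ V).evenProj s).2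
  · have e : ((Y.Γ V).evenProj s).1 = 0 := eq_of_forall_ev_eq S cov fun B c hc hoc p hp => by
      refine ((B.atPrime p).eq_of_add_eq (hom_map_mem (ev c V p hp) ((Y.Γ V).evenProj s).2)
        (zero_mem _) (hom_map_mem (ev c V p hp) ((Y.Γ V).oddProj s).2) (h B c hc hoc p hp) ?_).1.trans
        (map_zero (ConcreteCategory.hom (ev c V p hp))).symm
      rw [← map_add, hs, zero_add]
    rw [← hs, e, zero_add]
    exact ((Y.Γ V).oddProj s).2

/-- Two morphisms which agree on an affine open covering agree. -/
theorem hom_ext_of_cover (S : ∀ B : SAlg K, (B.sspec ⟶ Y) → Prop)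
    (cov : ∀ y : Y.carrier, ∃ (B : SAlg K) (c : B.sspec ⟶ Y), S B c ∧ IsOpenImm c ∧
      ∃ p, c.hom.base p = y) {g g' : Y ⟶ Z}
    (h : ∀ (B : SAlg K) (c : B.sspec ⟶ Y), S B c → c ≫ g = c ≫ g') : g = g' := by
  have hb : g.hom.base = g'.hom.base := by
    refine TopCat.hom_ext (ContinuousMap.ext fun y => ?_)
    obtain ⟨B, c, hc, -, p, rfl⟩ := cov y
    exact congrArg (fun k : B.sspec ⟶ Z => k.hom.base p) (h B c hc)
  obtain ⟨⟨b, f⟩, l⟩ := g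
  obtain ⟨⟨b', f'⟩, l'⟩ := g'
  obtain rfl : b = b' := hb
  obtain rfl : f = f' := by
    refine NatTrans.ext (funext fun V => GradedAlgHom.ext fun s => ?_)
    refine eq_of_forall_ev_eq (Y := Y) S cov fun B c hc _ p hp => ?_
    exact ev_congr (h B c hc) V.unop p hp s
  rfl

end GeomSuperspace

/-! ### Gluing morphisms along affine coverings -/

namespace GeomSuperspace

open SAlg

variable {K : Type u} [Field K] {A B B' C : SAlg K} {Y Z : GeomSuperspace K}

/-- Two affine morphisms, the second an open immersion, through the same point of `Y` agree on a
neighbourhood of that point. -/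
theorem exists_away_factorization (c : B.sspec ⟶ Y) (c' : B'.sspec ⟶ Y) [IsOpenImm c']
    (p : B.specTop) (p' : B'.specTop) (e : c'.hom.base p' = c.hom.base p) :
    ∃ (f : B.Even) (q : (away f).specTop) (h : B' ⟶ away f), specMap (toAway f) q = p ∧
      specMap h q = p' ∧ sspecMap (toAway f) ≫ c = sspecMap h ≫ c' := by
  -- On a basic open neighbourhood of `p` mapped by `c` into the range of `c'`, `c` lifts through
  -- `c'`; fullness of `SSpec` turns the lift into an algebra morphism.
  obtain ⟨f, ⟨q, hq⟩, hf⟩ := exists_away_subset ((Opens.map c.hom.base).obj (opensRange c')) p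
    ⟨p', e⟩
  obtain ⟨l, hl⟩ := exists_lift (sspecMap (toAway f) ≫ c) c' fun x => hf x
  obtain ⟨h, rfl⟩ := exists_sspecMap_eq l
  refine ⟨f, q, h, hq, injective c' ?_, hl.symm⟩
  rw [e, ← hq]
  exact congrArg (fun k : (away f).sspec ⟶ Y => k.hom.base q) hl

/-- Moves an equality between the values of a section on `Y` and one on `Z` from one affine morphism
to another through the same point: both sides are compared in a stalk of `B_f`, into which the stalk
of `B` injects. -/
theorem ev_eq_ev_of_factorization {c : B.sspec ⟶ Y} {c' : B'.sspec ⟶ Y} {d : B.sspec ⟶ Z}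
    {d' : B'.sspec ⟶ Z} {f : B.Even} {h : B' ⟶ away f} (q : (away f).specTop)
    (e : sspecMap (toAway f) ≫ c = sspecMap h ≫ c')
    (e' : sspecMap (toAway f) ≫ d = sspecMap h ≫ d')
    {V : Opens Y.carrier} {W : Opens Z.carrier} (t : Y.Γ V) (s : Z.Γ W)
    (h1 : c.hom.base (specMap (toAway f) q) ∈ V) (h1' : c'.hom.base (specMap h q) ∈ V)
    (h2 : d.hom.base (specMap (toAway f) q) ∈ W) (h2' : d'.hom.base (specMap h q) ∈ W)
    (H : ev c' V (specMap h q) h1' t = ev d' W (specMap h q) h2' s) :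
    ev c V (specMap (toAway f) q) h1 t = ev d W (specMap (toAway f) q) h2 s := by
  refine stalkLocMap_toLocalization_injective _ q ?_
  refine (ev_congr e V q h1 t).trans (Eq.trans ?_ (ev_congr e' W q h2 s).symm)
  exact congrArg (stalkLocMap h q) H

section Glue

/-- A compatible family of morphisms to `Z` on a sieve of affine morphisms to `Y`, which contains an
open covering of `Y`. -/
structure AffineGlueData (Y Z : GeomSuperspace K) where
  /-- The affine morphisms belonging to the sieve. -/
  S : ∀ B : SAlg K, (B.sspec ⟶ Y) → Prop
  closed : ∀ (B C : SAlg K) (c : B.sspec ⟶ Y) (h : B ⟶ C), S B c → S C (sspecMap h ≫ c)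
  cov : ∀ y : Y.carrier, ∃ (B : SAlg K) (c : B.sspec ⟶ Y), S B c ∧ IsOpenImm c ∧
      ∃ p, c.hom.base p = y
  /-- The family of morphisms. -/
  φ : ∀ (B : SAlg K) (c : B.sspec ⟶ Y), S B c → (B.sspec ⟶ Z)
  nat : ∀ (B C : SAlg K) (c : B.sspec ⟶ Y) (h : B ⟶ C) (hc : S B c),
    φ C (sspecMap h ≫ c) (closed B C c h hc) = sspecMap h ≫ φ B c hc

namespace AffineGlueData

variable (D : AffineGlueData Y Z)

/-- By `D.nat` both sides are the member of the family at the same composite morphism. -/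
theorem factorization {c : B.sspec ⟶ Y} {c' : B'.sspec ⟶ Y} (hc : D.S B c) (hc' : D.S B' c')
    (h : B ⟶ C) (h' : B' ⟶ C) (e : sspecMap h ≫ c = sspecMap h' ≫ c') :
    sspecMap h ≫ D.φ B c hc = sspecMap h' ≫ D.φ B' c' hc' := by
  rw [← D.nat, ← D.nat]
  have : ∀ (d d' : C.sspec ⟶ Y) (hd : D.S C d) (hd' : D.S C d'), d = d' → D.φ C d hd = D.φ C d' hd' := by
    rintro d _ hd hd' rfl; rfl
  exact this _ _ _ _ e

theorem base_eq {c : B.sspec ⟶ Y} {c' : B'.sspec ⟶ Y} (hc : D.S B c) (hc' : D.S B' c')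
    [IsOpenImm c'] (p : B.specTop) (p' : B'.specTop) (e : c'.hom.base p' = c.hom.base p) :
    (D.φ B c hc).hom.base p = (D.φ B' c' hc').hom.base p' := by
  obtain ⟨f, q, h, rfl, rfl, e'⟩ := exists_away_factorization c c' p p' e
  exact congrArg (fun k : (away f).sspec ⟶ Z => k.hom.base q)
    (D.factorization hc hc' _ _ e')

/-- The continuous map underlying the glued morphism. -/
theorem exists_base : ∃ F : Y.carrier ⟶ Z.carrier, ∀ (B : SAlg K) (c : B.sspec ⟶ Y)
    (hc : D.S B c) (p : B.specTop), F (c.hom.base p) = (D.φ B c hc).hom.base p := by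
  choose B c hc hoc p hp using D.cov
  have hF (B' : SAlg K) (c' : B'.sspec ⟶ Y) (hc' : D.S B' c') (p' : B'.specTop) :
      (D.φ _ _ (hc (c'.hom.base p'))).hom.base (p (c'.hom.base p')) = (D.φ B' c' hc').hom.base p' :=
    have := hoc (c'.hom.base p')
    (D.base_eq hc' (hc _) p' _ (hp _)).symm
  refine ⟨TopCat.ofHom ⟨fun y => (D.φ _ _ (hc y)).hom.base (p y), ?_⟩, hF⟩
  refine continuous_def.2 fun V hV => isOpen_iff_forall_mem_open.2 fun y hy => ?_
  have := hoc y
  refine ⟨(c y).hom.base '' ((D.φ _ _ (hc y)).hom.base ⁻¹' V), ?_,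
    (PresheafedSpace.IsOpenImmersion.base_open (f := (c y).hom)).isOpenMap _
      (((D.φ _ _ (hc y)).hom.base.hom.continuous.isOpen_preimage V hV)), ⟨p y, hy, hp y⟩⟩
  rintro _ ⟨p', hp', rfl⟩
  exact (congrArg (· ∈ V) (hF _ _ (hc y) p')).mpr hp'

/-- On the range of a chart, the pull back of `s` is transported through the bijection on sections
given by the chart. These local sections have the required values along every member of the sieve,
not only along their own chart, and hence glue. -/
theorem exists_section (F : Y.carrier ⟶ Z.carrier) (hF : ∀ (B : SAlg K) (c : B.sspec ⟶ Y)
    (hc : D.S B c) (p : B.specTop), F (c.hom.base p) = (D.φ B c hc).hom.base p)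
    (V : Opens Z.carrier) (s : Z.Γ V) :
    ∃ t : Y.Γ ((Opens.map F).obj V), ∀ (B : SAlg K) (c : B.sspec ⟶ Y) (hc : D.S B c) (p : B.specTop)
      (hp : F (c.hom.base p) ∈ V) (hp' : (D.φ B c hc).hom.base p ∈ V),
      ev c ((Opens.map F).obj V) p hp t = ev (D.φ B c hc) V p hp' s := by
  choose B c hc hoc p hp using D.cov
  let U : Opens Y.carrier := (Opens.map F).obj V
  let W (y : Y.carrier) : Opens Y.carrier := U ⊓ opensRange (c y)
  have hW (y : Y.carrier) : W y ≤ U := inf_le_left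
  have hle (y : Y.carrier) : (Opens.map (c y).hom.base).obj (W y) ≤
      (Opens.map (D.φ _ _ (hc y)).hom.base).obj V := fun q hq => by
    exact (congrArg (· ∈ V) (hF _ _ (hc y) q)).mp hq.1
  choose t ht using fun y => (app_bijective (c y) (W y) inf_le_right).2
    ((B y).sectionsRes (hle y) (app (D.φ _ _ (hc y)) V s))
  have key (y : Y.carrier) (B' : SAlg K) (c' : B'.sspec ⟶ Y) (hc' : D.S B' c') (p' : B'.specTop)
      (hp' : c'.hom.base p' ∈ W y) (hp'' : (D.φ B' c' hc').hom.base p' ∈ V) :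
      ev c' (W y) p' hp' (t y) = ev (D.φ B' c' hc') V p' hp'' s := by
    obtain ⟨q, hq⟩ := hp'.2
    obtain ⟨f, q', h, rfl, rfl, e'⟩ := exists_away_factorization c' (c y) p' q hq
    refine ev_eq_ev_of_factorization q' e' (D.factorization hc' (hc y) _ _ e') _ _ _
      (hq ▸ hp') _ (hle y (hq ▸ hp' : (c y).hom.base _ ∈ W y)) ?_
    exact congrArg ((B y).evalSection ((Opens.map (c y).hom.base).obj (W y)) _ _) (ht y)
  obtain ⟨T, hT⟩ := Y.exists_glue (U := U) W hW (fun y hy => ⟨y, hy, p y, hp y⟩) t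
    (fun y z => eq_of_forall_ev_eq D.S D.cov fun B' c' hc' _ p' hp' => by
      have h1 : F (c'.hom.base p') ∈ V := hp'.1.1
      rw [ev_res, ev_res, key y B' c' hc' p' _ (hF _ _ hc' p' ▸ h1),
        key z B' c' hc' p' _ (hF _ _ hc' p' ▸ h1)])
  refine ⟨T, fun B' c' hc' p' hp' hp'' => ?_⟩
  have hm : c'.hom.base p' ∈ W (c'.hom.base p') := ⟨hp', p _, hp _⟩
  rw [← key _ B' c' hc' p' hm hp'', ← hT]
  exact (ev_res c' (hW _) p' hm T).symm

/-- Morphisms of geometric superspaces can be glued along an affine open covering. -/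
theorem exists_hom :
    ∃ g : Y ⟶ Z, ∀ (B : SAlg K) (c : B.sspec ⟶ Y) (hc : D.S B c), c ≫ g = D.φ B c hc := by
  obtain ⟨F, hF⟩ := D.exists_base
  choose t ht using D.exists_section F hF
  have ht' (V : Opens Z.carrier) (s : Z.Γ V) (B : SAlg K) (c : B.sspec ⟶ Y) (hc : D.S B c)
      (p : B.specTop) (hp : c.hom.base p ∈ (Opens.map F).obj V) :
      ev c ((Opens.map F).obj V) p hp (t V s) =
        ev (D.φ B c hc) V p (hF B c hc p ▸ (hp : F (c.hom.base p) ∈ V)) s :=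
    ht V s B c hc p hp _
  let τ (V : Opens Z.carrier) : Z.Γ V ⟶ Y.Γ ((Opens.map F).obj V) :=
    { toFun := t V
      map_one' := eq_of_forall_ev_eq D.S D.cov fun B c hc _ p hp => by
        rw [ht' V _ B c hc, map_one, map_one]
      map_mul' := fun a b => eq_of_forall_ev_eq D.S D.cov fun B c hc _ p hp => by
        rw [ht' V _ B c hc, map_mul, map_mul, ht' V _ B c hc, ht' V _ B c hc]
      map_zero' := eq_of_forall_ev_eq D.S D.cov fun B c hc _ p hp => by
        rw [ht' V _ B c hc, map_zero, map_zero]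
      map_add' := fun a b => eq_of_forall_ev_eq D.S D.cov fun B c hc _ p hp => by
        rw [ht' V _ B c hc, map_add, map_add, ht' V _ B c hc, ht' V _ B c hc]
      commutes' := fun k => eq_of_forall_ev_eq D.S D.cov fun B c hc _ p hp => by
        refine (ht' _ _ B c hc p hp).trans ?_
        exact (AlgHomClass.commutes (ConcreteCategory.hom (ev (D.φ B c hc) V p _)) k).trans
          (AlgHomClass.commutes (ConcreteCategory.hom (ev c _ p hp)) k).symm
      map_mem := fun {i a} ha => mem_grading_of_forall_ev_mem D.S D.cov fun B c hc _ p hp => by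
        refine (ht' V a B c hc p hp).symm ▸ ?_
        exact hom_map_mem (ev (D.φ B c hc) V p _) ha }
  let G : Y.toPresheafedSpace ⟶ Z.toPresheafedSpace :=
    { base := F
      c := { app := fun V => τ V.unop
             naturality := fun V V' i => GradedAlgHom.ext fun s =>
               eq_of_forall_ev_eq D.S D.cov fun B c hc _ p hp => by
                 refine (ht' V'.unop (Z.presheaf.map i s) B c hc p hp).trans ?_
                 refine (ev_res (D.φ B c hc) i.unop.le p _ s).trans ?_
                 refine (ht' V.unop s B c hc p (i.unop.le hp)).symm.trans ?_
                 exact (ev_res c (show (Opens.map F).obj V'.unop ≤ (Opens.map F).obj V.unop from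
                   fun _ h => i.unop.le h) p hp (t V.unop s)).symm } }
  have hG (B : SAlg K) (c : B.sspec ⟶ Y) (hc : D.S B c) : c.hom ≫ G = (D.φ B c hc).hom := by
    have hb (p : B.specTop) : F (c.hom.base p) = (D.φ B c hc).hom.base p := hF B c hc p
    have ht'' (V : Opens Z.carrier) (s : Z.Γ V) (p : B.specTop) (hp : F (c.hom.base p) ∈ V)
        (hp' : (D.φ B c hc).hom.base p ∈ V) : ev c ((Opens.map F).obj V) p hp (τ V s) =
        ev (D.φ B c hc) V p hp' s := ht V s B c hc p hp hp'
    -- With a variable in place of `D.φ B c hc`, its underlying map can be substituted, and the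
    -- comorphisms are compared without transport.
    generalize D.φ B c hc = d at hb ht''
    obtain ⟨⟨b, f⟩, l⟩ := d
    obtain rfl : c.hom.base ≫ F = b := TopCat.hom_ext (ContinuousMap.ext hb)
    obtain rfl : (c.hom ≫ G).c = f := by
      refine NatTrans.ext (funext fun V => GradedAlgHom.ext fun s =>
        Subtype.ext (funext fun p => ?_))
      exact ht'' V.unop s p.1 p.2 p.2
    rfl
  refine ⟨⟨G, fun y => ?_⟩, fun B c hc => Hom.ext (hG B c hc)⟩
  obtain ⟨B, c, hc, -, p, rfl⟩ := D.cov y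
  refine isLocalHom_stalkMap_of_comp ((evenSpace K).map c.hom) ((evenSpace K).map G) p ?_
  rw [← Functor.map_comp, hG B c hc]
  exact (D.φ B c hc).isLocal p

end AffineGlueData

end Glue

end GeomSuperspace

section

open SAlg

variable {K : Type u} [Field K]

namespace KFunctor

variable {X : KFunctor K} {A B C R : SAlg K}

theorem map_map (φ : A ⟶ B) (ψ : B ⟶ C) (x : X.obj A) :
    X.map ψ (X.map φ x) = X.map (φ ≫ ψ) x :=
  (ConcreteCategory.congr_hom (X.map_comp φ ψ) x).symm

theorem map_one (x : X.obj A) : X.map (𝟙 A) x = x :=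
  ConcreteCategory.congr_hom (X.map_id A) x

theorem naturality {X Y : KFunctor K} (f : X ⟶ Y) (φ : A ⟶ B) (x : X.obj A) :
    f.app B (X.map φ x) = Y.map φ (f.app A x) :=
  ConcreteCategory.congr_hom (f.naturality φ) x

end KFunctor

/-! ### Open charts and atlases of `K`-functors -/

section Charts

/-- An element `y` of `X(A)` is an open chart if it identifies `SSp A` with an open subfunctor
of `X`. -/
structure IsOpenChart (X : KFunctor K) (A : SAlg K) (y : X.obj A) : Prop where
  inj : ∀ (B : SAlg K) (φ ψ : A ⟶ B), X.map φ y = X.map ψ y → φ = ψ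
  locus : ∀ (R : SAlg K) (x : X.obj R), ∃ U : Opens R.specTop, ∀ (B : SAlg K) (h : R ⟶ B),
    (∃ φ : A ⟶ B, X.map φ y = X.map h x) ↔ ∀ b, specMap h b ∈ U

/-- An atlas of a `K`-functor consisting of affine open charts. -/
structure OpenAtlas (X : KFunctor K) where
  ι : Type u
  A : ι → SAlg K
  y : ∀ i, X.obj (A i)
  chart : ∀ i, IsOpenChart X (A i) (y i)
  cover : ∀ (R : SAlg K) (x : X.obj R) (r : R.specTop), ∃ (i : ι) (f : R.Even),
    (∃ q, specMap (toAway f) q = r) ∧ ∃ φ : A i ⟶ away f, X.map φ (y i) = X.map (toAway f) x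

/-- By Yoneda each affine open subfunctor has a universal element `y i`, and openness turns
membership into a condition on points of the spectrum. The covering condition at the residue field
of `r` puts `r` in one of these open loci, hence also a basic open neighbourhood of `r`. -/
theorem nonempty_openAtlas (hK : (2 : K) ≠ 0) {X : KFunctor K} (hX : IsSuperscheme X) :
    Nonempty (OpenAtlas X) := by
  obtain ⟨-, ι, Y, ⟨hopen, hcov⟩, haff⟩ := hX
  choose A α using haff
  let e (i : ι) : SSp (A i) ≅ (Y i).toFunctor := (α i).some.symm
  let y (i : ι) : X.obj (A i) := ((e i).hom.app (A i) (𝟙 (A i))).1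
  have hy (i : ι) (B : SAlg K) (φ : A i ⟶ B) :
      ((e i).hom.app B (show (SSp (A i)).obj B from φ)).1 = X.map φ (y i) := by
    have h := KFunctor.naturality (e i).hom φ (show (SSp (A i)).obj (A i) from 𝟙 (A i))
    have h' : (SSp (A i)).map φ (show (SSp (A i)).obj (A i) from 𝟙 (A i)) =
      (show (SSp (A i)).obj B from φ) := Category.id_comp φ
    rw [h'] at h
    exact congrArg Subtype.val h
  have hb (i : ι) (B : SAlg K) : Function.Bijective ((e i).hom.app B) :=
    ConcreteCategory.bijective_of_isIso ((e i).hom.app B)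
  have hmem (i : ι) (B : SAlg K) (x : X.obj B) :
      (∃ φ : A i ⟶ B, X.map φ (y i) = x) ↔ x ∈ (Y i).obj B := by
    constructor
    · rintro ⟨φ, rfl⟩
      rw [← hy]
      exact ((e i).hom.app B _).2
    · intro hx
      obtain ⟨φ, hφ⟩ := (hb i B).2 ⟨x, hx⟩
      exact ⟨φ, (hy i B φ).symm.trans (congrArg Subtype.val hφ)⟩
  have hlocus (i : ι) (R : SAlg K) (x : X.obj R) : ∃ U : Opens R.specTop,
      ∀ (B : SAlg K) (h : R ⟶ B),
        (∃ φ : A i ⟶ B, X.map φ (y i) = X.map h x) ↔ ∀ b, specMap h b ∈ U := by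
    obtain ⟨I, hI⟩ := hopen i R (coyonedaEquiv.symm x)
    refine ⟨openOfSuperideal I, fun B h => ?_⟩
    rw [hmem, ← mem_basicOpenSubfunctor_iff hK, ← hI]
    rfl
  refine ⟨⟨ι, A, y, fun i => ⟨fun B φ ψ h => ?_, hlocus i⟩, fun R x r => ?_⟩⟩
  · rw [← hy, ← hy] at h
    exact (hb i B).1 (Subtype.ext h)
  · obtain ⟨i, hi⟩ := hcov _ (residueField_isFieldExtension r) (X.map (toResidueField hK r) x)
    obtain ⟨U, hU⟩ := hlocus i R x
    have hF := (hU _ (toResidueField hK r)).1 ((hmem i _ _).2 hi)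
    have := (residueField_isFieldExtension r).nontrivial
    obtain ⟨b⟩ : Nonempty (PrimeSpectrum (residueField r).Even) := inferInstance
    have hr : r ∈ U := (specMap_toResidueField hK r b) ▸ hF b
    obtain ⟨f, hfr, hf⟩ := exists_away_subset U r hr
    exact ⟨i, f, hfr, (hU _ (toAway f)).2 hf⟩

/-- The subfunctor defined by an element of `X(A)`. -/
def imageSubfunctor {X : KFunctor K} {A : SAlg K} (y : X.obj A) : Subfunctor X where
  obj B := {x | ∃ φ : A ⟶ B, X.map φ y = x}
  map h := by
    rintro _ ⟨φ, rfl⟩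
    exact ⟨φ ≫ h, (KFunctor.map_map φ h y).symm⟩

/-- The locus of a chart is an open set of primes, and each such set comes from a superideal. -/
theorem IsOpenChart.isOpenSubfunctor (hK : (2 : K) ≠ 0) {X : KFunctor K} {A : SAlg K} {y : X.obj A}
    (hy : IsOpenChart X A y) : IsOpenSubfunctor (imageSubfunctor y) := by
  intro R f
  obtain ⟨U, hU⟩ := hy.locus R (f.app R (𝟙 R))
  obtain ⟨I, rfl⟩ := exists_openOfSuperideal_eq hK U
  refine ⟨I, Subfunctor.ext (funext fun B => Set.ext fun h => ?_)⟩
  refine Iff.trans ?_ ((hU B h).trans (mem_basicOpenSubfunctor_iff hK I h).symm)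
  have e : f.app B h = X.map (show R ⟶ B from h) (f.app R (𝟙 R)) := by
    rw [← KFunctor.naturality]
    exact congrArg (f.app B) (Category.id_comp (show R ⟶ B from h)).symm
  exact iff_of_eq (congrArg (· ∈ (imageSubfunctor y).obj B) e)

theorem IsOpenChart.nonempty_iso {X : KFunctor K} {A : SAlg K} {y : X.obj A}
    (hy : IsOpenChart X A y) : Nonempty ((imageSubfunctor y).toFunctor ≅ SSp A) := by
  let τ : SSp A ⟶ (imageSubfunctor y).toFunctor :=
    { app := fun B => ↾fun φ => ⟨X.map (show A ⟶ B from φ) y, φ, rfl⟩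
      naturality := fun B C h => by
        ext φ
        exact Subtype.ext (KFunctor.map_map _ _ _).symm }
  have (B : SAlg K) : IsIso (τ.app B) := by
    refine (ConcreteCategory.isIso_iff_bijective (τ.app B)).2 ⟨fun φ ψ h => ?_, ?_⟩
    · exact hy.inj B _ _ (congrArg Subtype.val h)
    · rintro ⟨_, φ, rfl⟩
      exact ⟨φ, rfl⟩
  have := NatIso.isIso_of_isIso_app τ
  exact ⟨(asIso τ).symm⟩

/-- A field extension has a single prime, so a chart whose locus contains this prime contains the
whole `F`-valued point. -/
theorem OpenAtlas.isSuperscheme (hK : (2 : K) ≠ 0) {X : KFunctor K} (hX : IsLocalFunctor X)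
    (𝒜 : OpenAtlas X) : IsSuperscheme X := by
  refine ⟨hX, 𝒜.ι, fun i => imageSubfunctor (𝒜.y i), ⟨fun i => (𝒜.chart i).isOpenSubfunctor hK,
    fun F hF x => ?_⟩, fun i => ⟨𝒜.A i, (𝒜.chart i).nonempty_iso⟩⟩
  have := hF.nontrivial
  obtain ⟨b⟩ : Nonempty (PrimeSpectrum F.Even) := inferInstance
  obtain ⟨i, f, ⟨q, hq⟩, hφ⟩ := 𝒜.cover F x b
  obtain ⟨U, hU⟩ := (𝒜.chart i).locus F x
  have hb : b ∈ U := hq ▸ (hU _ (toAway f)).1 hφ q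
  obtain ⟨φ, hφ⟩ := (hU F (𝟙 F)).2 fun (b' : PrimeSpectrum F.Even) => by
    have : specMap (𝟙 F) b' = b := by
      refine PrimeSpectrum.ext ?_
      exact (hF.asIdeal_eq_bot _).trans (hF.asIdeal_eq_bot b).symm
    exact this ▸ hb
  exact ⟨i, φ, hφ.trans (KFunctor.map_one x)⟩

end Charts

/-! ### Gluing elements of local functors -/

section LocalFunctors

variable {X : KFunctor K} {R : SAlg K}

/-- The morphism `R_f → B_{h(f)}` induced by `h : R → B`. -/
def awayMap {R B : SAlg K} (h : R ⟶ B) (f : R.Even) : away f ⟶ away (evenMap h f) :=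
  locMap h _ _ (Submonoid.powers_le.2 (Submonoid.mem_powers (evenMap h f)))

theorem toAway_awayMap {R B : SAlg K} (h : R ⟶ B) (f : R.Even) :
    toAway f ≫ awayMap h f = h ≫ toAway (evenMap h f) := by
  refine GradedAlgHom.ext fun a => ?_
  refine (locMapFun_mk h _ _ (Submonoid.powers_le.2 (Submonoid.mem_powers (evenMap h f))) a 1).trans
    ?_
  show LocalizedModule.mk _ _ = LocalizedModule.mk _ _
  congr 1
  exact Subtype.ext (_root_.map_one (evenMap h))

/-- Quasi-compactness of the spectrum, in the form that the finite families in `IsLocalFunctor`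
require. -/
theorem exists_finite_span_eq_top (f : R.specTop → R.Even)
    (hf : ∀ r : R.specTop, ∃ q, specMap (toAway (f r)) q = r) :
    ∃ (n : ℕ) (g : Fin n → R.specTop), Ideal.span (Set.range fun k => f (g k)) = ⊤ := by
  have h : Ideal.span (Set.range f) = ⊤ := by
    by_contra hne
    obtain ⟨m, hm, hle⟩ := Ideal.exists_le_maximal _ hne
    exact (exists_specMap_toAway_eq_iff _ _).1 (hf ⟨m, hm.isPrime⟩)
      (hle (Ideal.subset_span ⟨_, rfl⟩))
  obtain ⟨s, hs, hs'⟩ := (Ideal.span_eq_top_iff_finite _).1 h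
  choose g hg using fun k : s => hs k.2
  refine ⟨_, fun k => g (s.equivFin.symm k), top_le_iff.1 (hs' ▸ Ideal.span_mono fun a ha => ?_)⟩
  exact ⟨s.equivFin ⟨a, ha⟩, (congrArg (fun k => f (g k)) (s.equivFin.symm_apply_apply ⟨a, ha⟩)).trans (hg ⟨a, ha⟩)⟩

theorem IsLocalFunctor.existsUnique (hX : IsLocalFunctor X) {n : ℕ} (f : Fin n → R.Even)
    (hf : Ideal.span (Set.range f) = ⊤) (x : ∀ i, X.obj (away (f i)))
    (hx : ∀ (i j : Fin n) (B : SAlg K) (φ : away (f i) ⟶ B) (ψ : away (f j) ⟶ B),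
      toAway (f i) ≫ φ = toAway (f j) ≫ ψ → X.map φ (x i) = X.map ψ (x j)) :
    ∃! t : X.obj R, ∀ i, X.map (toAway (f i)) t = x i :=
  Presieve.isSheafFor_arrows_iff _ _ |>.1 (hX R n f hf) x fun i j Z gi gj h =>
    hx i j Z.unop gi.unop gj.unop (congrArg Quiver.Hom.unop h)

theorem isLocalFunctor_of_existsUnique (h : ∀ (R : SAlg K) (n : ℕ) (f : Fin n → R.Even),
    Ideal.span (Set.range f) = ⊤ → ∀ x : ∀ i, X.obj (away (f i)),
    (∀ (i j : Fin n) (B : SAlg K) (φ : away (f i) ⟶ B) (ψ : away (f j) ⟶ B),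
      toAway (f i) ≫ φ = toAway (f j) ≫ ψ → X.map φ (x i) = X.map ψ (x j)) →
    ∃! t : X.obj R, ∀ i, X.map (toAway (f i)) t = x i) : IsLocalFunctor X := by
  intro R n f hf
  refine (Presieve.isSheafFor_arrows_iff _ _).2 fun x hx => h R n f hf x fun i j B φ ψ e => ?_
  exact hx i j (op B) φ.op ψ.op (congrArg Quiver.Hom.op e)

theorem IsLocalFunctor.ext (hX : IsLocalFunctor X) {x x' : X.obj R}
    (h : ∀ r : R.specTop, ∃ f : R.Even, (∃ q, specMap (toAway f) q = r) ∧
      X.map (toAway f) x = X.map (toAway f) x') : x = x' := by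
  choose f hf e using h
  obtain ⟨n, g, hg⟩ := exists_finite_span_eq_top f hf
  refine (hX.existsUnique _ hg (fun i => X.map (toAway (f (g i))) x) ?_).unique (fun i => rfl)
    fun i => (e (g i)).symm
  intro i j B φ ψ h
  rw [KFunctor.map_map, KFunctor.map_map, h]

/-- Extends the sheaf condition from finite families to sieves containing a basic open neighbourhood
of each point. A finite subfamily yields `x`; its value along any `h` in the sieve is checked
locally on `B`, on the localizations at the elements `h(f)`. -/
theorem IsLocalFunctor.glue (hX : IsLocalFunctor X) (S : ∀ B : SAlg K, (R ⟶ B) → Prop)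
    (hS : ∀ (B C : SAlg K) (h : R ⟶ B) (k : B ⟶ C), S B h → S C (h ≫ k))
    (cov : ∀ r : R.specTop, ∃ f : R.Even, (∃ q, specMap (toAway f) q = r) ∧ S _ (toAway f))
    (φ : ∀ (B : SAlg K) (h : R ⟶ B), S B h → X.obj B)
    (nat : ∀ (B C : SAlg K) (h : R ⟶ B) (k : B ⟶ C) (hh : S B h),
      φ C (h ≫ k) (hS B C h k hh) = X.map k (φ B h hh)) :
    ∃ x : X.obj R, ∀ (B : SAlg K) (h : R ⟶ B) (hh : S B h), X.map h x = φ B h hh := by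
  have congr {B : SAlg K} : ∀ (h h' : R ⟶ B) (hh : S B h) (hh' : S B h'), h = h' →
      φ B h hh = φ B h' hh' := by
    rintro h _ hh hh' rfl; rfl
  choose f hf hSf using cov
  obtain ⟨n, g, hg⟩ := exists_finite_span_eq_top f hf
  obtain ⟨x, hx, -⟩ := hX.existsUnique _ hg (fun i => φ _ _ (hSf (g i))) fun i j B α β e => by
    rw [← nat, ← nat]; exact congr _ _ _ _ e
  refine ⟨x, fun B h hh => hX.ext fun b => ?_⟩
  obtain ⟨i, hi⟩ : ∃ i, f (g i) ∉ (specMap h b).asIdeal := by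
    by_contra hcon
    push Not at hcon
    refine (specMap h b).isPrime.ne_top (top_le_iff.1 (hg ▸ Ideal.span_le.2 ?_))
    rintro _ ⟨i, rfl⟩
    exact hcon i
  refine ⟨evenMap h (f (g i)), (exists_specMap_toAway_eq_iff _ _).2 hi, ?_⟩
  have hk := toAway_awayMap h (f (g i))
  rw [KFunctor.map_map, ← hk, ← KFunctor.map_map, hx, ← nat, ← nat]
  exact congr _ _ _ _ hk

end LocalFunctors

end

section

open SAlg GeomSuperspace

variable {K : Type u} [Field K]

/-! ### The functor of points of a geometric superscheme -/

section FunctorOfPoints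

variable {A B C R : SAlg K} {Y Z : GeomSuperspace K}

theorem sspecMap_comp (φ : A ⟶ B) (ψ : B ⟶ C) :
    sspecMap (φ ≫ ψ) = sspecMap ψ ≫ sspecMap φ :=
  (SSpec K).map_comp ψ.op φ.op

/-- Morphisms are glued over the sieve of affine morphisms factoring through some `SSpec R_{f_i}`.
The value on such a morphism uses a chosen factorization, and compatibility makes the choice
irrelevant. -/
theorem isLocalFunctor_functorOfPoints (Y : GeomSuperspace K) :
    IsLocalFunctor ((functorOfPoints K).obj Y) := by
  refine isLocalFunctor_of_existsUnique fun R n f hf x hx => ?_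
  let x' (i : Fin n) : (away (f i)).sspec ⟶ Y := x i
  -- Faithfulness of `SSpec` restates compatibility in terms of morphisms of superspaces.
  have hx' (i j : Fin n) (B : SAlg K) (φ : away (f i) ⟶ B) (ψ : away (f j) ⟶ B)
      (h : sspecMap φ ≫ sspecMap (toAway (f i)) = sspecMap ψ ≫ sspecMap (toAway (f j))) :
      sspecMap φ ≫ x' i = sspecMap ψ ≫ x' j :=
    hx i j B φ ψ (sspecMap_injective (by rw [sspecMap_comp, sspecMap_comp, h]))
  have cov (r : R.specTop) : ∃ i, ∃ q, specMap (toAway (f i)) q = r := by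
    by_contra hcon
    push Not at hcon
    refine r.isPrime.ne_top (top_le_iff.1 (hf ▸ Ideal.span_le.2 ?_))
    rintro _ ⟨i, rfl⟩
    by_contra hi
    obtain ⟨q, hq⟩ := (exists_specMap_toAway_eq_iff (f i) r).2 hi
    exact hcon i q hq
  let S (B : SAlg K) (c : B.sspec ⟶ R.sspec) : Prop :=
    ∃ (i : Fin n) (l : away (f i) ⟶ B), sspecMap l ≫ sspecMap (toAway (f i)) = c
  have hS (B C : SAlg K) (c : B.sspec ⟶ R.sspec) (h : B ⟶ C) (hc : S B c) :
      S C (sspecMap h ≫ c) := by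
    obtain ⟨i, l, rfl⟩ := hc
    exact ⟨i, l ≫ h, by rw [sspecMap_comp, Category.assoc]⟩
  have hSi (i : Fin n) : S _ (sspecMap (toAway (f i))) := ⟨i, 𝟙 _, by
    have : sspecMap (𝟙 (away (f i))) = 𝟙 _ := (SSpec K).map_id (op (away (f i)))
    rw [this, Category.id_comp]⟩
  have covS (r : R.specTop) : ∃ (B : SAlg K) (c : B.sspec ⟶ R.sspec), S B c ∧ IsOpenImm c ∧
      ∃ p, c.hom.base p = r := by
    obtain ⟨i, hi⟩ := cov r
    exact ⟨_, _, hSi i, isOpenImm_toAway (f i), hi⟩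
  let D : AffineGlueData R.sspec Y :=
    { S := S
      closed := hS
      cov := covS
      φ := fun B c hc => sspecMap hc.choose_spec.choose ≫ x' hc.choose
      nat := fun B C c h hc => by
        rw [← Category.assoc, ← sspecMap_comp]
        refine hx' _ _ C _ _ ?_
        rw [(hS B C c h hc).choose_spec.choose_spec, sspecMap_comp, Category.assoc,
          hc.choose_spec.choose_spec] }
  obtain ⟨g, hg⟩ := D.exists_hom
  refine ⟨g, fun i => ?_, fun g' hg' => ?_⟩
  · refine (hg _ _ (hSi i)).trans ?_
    have h := (hSi i).choose_spec.choose_spec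
    refine (hx' _ i _ _ (𝟙 _) (h.trans ?_)).trans ?_
    · have : sspecMap (𝟙 (away (f i))) = 𝟙 _ := (SSpec K).map_id (op (away (f i)))
      rw [this, Category.id_comp]
    · have : sspecMap (𝟙 (away (f i))) = 𝟙 _ := (SSpec K).map_id (op (away (f i)))
      rw [this, Category.id_comp]
  · let k : R.sspec ⟶ Y := g'
    have hk : ∀ i, sspecMap (toAway (f i)) ≫ k = x' i := hg'
    have e : k = g := hom_ext_of_cover S covS fun B c hc => by
      rw [hg B c hc]
      show _ = sspecMap hc.choose_spec.choose ≫ x' hc.choose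
      rw [← hk, ← Category.assoc, hc.choose_spec.choose_spec]
    exact e

/-- An open immersion is a monomorphism. Its locus is the preimage of its range: there a morphism
lifts, and fullness makes the lift an algebra morphism. -/
theorem isOpenChart_of_isOpenImm (y : A.sspec ⟶ Y) [IsOpenImm y] :
    IsOpenChart ((functorOfPoints K).obj Y) A y where
  inj B φ ψ h := by
    have h' : sspecMap φ ≫ y = sspecMap ψ ≫ y := h
    exact sspecMap_injective ((cancel_mono y).1 h')
  locus R x := by
    let x' : R.sspec ⟶ Y := x
    refine ⟨(Opens.map x'.hom.base).obj (opensRange y), fun B h => ⟨?_, fun H => ?_⟩⟩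
    · rintro ⟨φ, hφ⟩ b
      have hφ' : sspecMap φ ≫ y = sspecMap h ≫ x' := hφ
      exact ⟨specMap φ b, congrArg (fun k : B.sspec ⟶ Y => k.hom.base b) hφ'⟩
    · obtain ⟨l, hl⟩ := exists_lift (sspecMap h ≫ x') y H
      obtain ⟨φ, rfl⟩ := exists_sspecMap_eq l
      exact ⟨φ, hl⟩

theorem isGeomSuperscheme_iff : IsGeomSuperscheme Y ↔ ∀ y : Y.carrier,
    ∃ (A : SAlg K) (c : A.sspec ⟶ Y), IsOpenImm c ∧ ∃ p, c.hom.base p = y := by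
  constructor
  · intro h y
    obtain ⟨U, hyU, A, ⟨e⟩⟩ := h y
    let c : A.sspec ⟶ Y.restrict U := e.inv
    have : IsOpenImm c := inferInstanceAs (IsOpenImm e.inv)
    refine ⟨A, c ≫ Y.ofRestrict U, inferInstance, e.hom.hom.base ⟨y, hyU⟩, ?_⟩
    exact congrArg (fun k : Y.restrict U ⟶ Y.restrict U => (k.hom.base ⟨y, hyU⟩).1) e.hom_inv_id
  · intro h y
    obtain ⟨A, c, hc, p, rfl⟩ := h y
    exact ⟨opensRange c, ⟨p, rfl⟩, A, nonempty_restrict_opensRange_iso c⟩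

theorem IsGeomSuperscheme.of_iso (e : Y ≅ Z) (h : IsGeomSuperscheme Y) : IsGeomSuperscheme Z := by
  rw [isGeomSuperscheme_iff] at h ⊢
  intro z
  obtain ⟨A, c, hc, p, hp⟩ := h (e.inv.hom.base z)
  refine ⟨A, c ≫ e.hom, inferInstance, p, ?_⟩
  refine (congrArg e.hom.hom.base hp).trans ?_
  exact congrArg (fun k : Z ⟶ Z => k.hom.base z) e.inv_hom_id

theorem exists_away_factors (y : A.sspec ⟶ Y) [IsOpenImm y] (x : R.sspec ⟶ Y) (r : R.specTop)
    (h : ∃ p, y.hom.base p = x.hom.base r) : ∃ f : R.Even, (∃ q, specMap (toAway f) q = r) ∧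
      ∃ φ : A ⟶ away f, sspecMap φ ≫ y = sspecMap (toAway f) ≫ x := by
  obtain ⟨p, hp⟩ := h
  obtain ⟨f, q, φ, hq, -, e⟩ := exists_away_factorization x y r p hp
  exact ⟨f, ⟨q, hq⟩, φ, e.symm⟩

/-- The functor of points of a geometric superscheme has an open atlas. -/
theorem nonempty_openAtlas_functorOfPoints (hY : IsGeomSuperscheme Y) :
    Nonempty (OpenAtlas ((functorOfPoints K).obj Y)) := by
  choose A c hc hp using isGeomSuperscheme_iff.1 hY
  -- The charts are indexed by the points of `Y`, one affine neighbourhood for each.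
  exact ⟨⟨Y.carrier, A, c, fun i => isOpenChart_of_isOpenImm (c i), fun R x r =>
    ⟨(show R.sspec ⟶ Y from x).hom.base r, exists_away_factors (c _) x r (hp _)⟩⟩⟩

theorem isSuperscheme_functorOfPoints (hK : (2 : K) ≠ 0) (hY : IsGeomSuperscheme Y) :
    IsSuperscheme ((functorOfPoints K).obj Y) := by
  obtain ⟨𝒜⟩ := nonempty_openAtlas_functorOfPoints hY
  exact 𝒜.isSuperscheme hK (isLocalFunctor_functorOfPoints Y)

/-- A natural transformation is a compatible family on the sieve of all affine morphisms to `Y`.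
That `Z` is an arbitrary superspace is essential for a colimit in all of `𝒱`. -/
theorem existsUnique_functorOfPoints_map (hY : IsGeomSuperscheme Y)
    (τ : (functorOfPoints K).obj Y ⟶ (functorOfPoints K).obj Z) :
    ∃! g : Y ⟶ Z, ∀ (B : SAlg K) (c : B.sspec ⟶ Y), c ≫ g = τ.app B c := by
  have cov : ∀ y : Y.carrier, ∃ (B : SAlg K) (c : B.sspec ⟶ Y), True ∧ IsOpenImm c ∧
      ∃ p, c.hom.base p = y := fun y => by
    obtain ⟨A, c, h⟩ := isGeomSuperscheme_iff.1 hY y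
    exact ⟨A, c, trivial, h⟩
  let D : AffineGlueData Y Z :=
    { S := fun _ _ => True
      closed := fun _ _ _ _ _ => trivial
      cov := cov
      φ := fun B c _ => τ.app B c
      nat := fun B C c h _ => KFunctor.naturality τ h c }
  obtain ⟨g, hg⟩ := D.exists_hom
  refine ⟨g, fun B c => hg B c trivial, fun g' hg' => ?_⟩
  exact hom_ext_of_cover (fun _ _ => True) cov fun B c _ => (hg' B c).trans (hg B c trivial).symm

end FunctorOfPoints

/-! ### Local functors are determined by the relations between their charts -/

section Comparison

variable {X X' : KFunctor K} {R : SAlg K}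

/-- An element of a functor covered by affine charts induces one of any local functor with
elements satisfying the same relations. -/
theorem exists_comparison {ι : Type*} {A : ι → SAlg K} (y : ∀ i, X.obj (A i))
    (y' : ∀ i, X'.obj (A i)) (hX' : IsLocalFunctor X')
    (cov : ∀ (R : SAlg K) (x : X.obj R) (r : R.specTop), ∃ (i : ι) (f : R.Even),
      (∃ q, specMap (toAway f) q = r) ∧ ∃ φ : A i ⟶ away f, X.map φ (y i) = X.map (toAway f) x)
    (H : ∀ (i j : ι) (B : SAlg K) (φ : A i ⟶ B) (ψ : A j ⟶ B), X.map φ (y i) = X.map ψ (y j) →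
      X'.map φ (y' i) = X'.map ψ (y' j)) (x : X.obj R) :
    ∃ x' : X'.obj R, ∀ (B : SAlg K) (h : R ⟶ B) (i : ι) (φ : A i ⟶ B),
      X.map φ (y i) = X.map h x → X'.map φ (y' i) = X'.map h x' := by
  -- On the sieve where `x` comes from a chart its image is prescribed, and `H` makes it independent
  -- of the chosen chart.
  let S (B : SAlg K) (h : R ⟶ B) : Prop := ∃ (i : ι) (φ : A i ⟶ B), X.map φ (y i) = X.map h x
  have hS (B C : SAlg K) (h : R ⟶ B) (k : B ⟶ C) (hh : S B h) : S C (h ≫ k) := by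
    obtain ⟨i, φ, e⟩ := hh
    exact ⟨i, φ ≫ k, by rw [← KFunctor.map_map, e, KFunctor.map_map]⟩
  obtain ⟨x', hx'⟩ := hX'.glue S hS
    (fun r => by
      obtain ⟨i, f, hf, φ, e⟩ := cov R x r
      exact ⟨f, hf, i, φ, e⟩)
    (fun B h hh => X'.map hh.choose_spec.choose (y' hh.choose))
    (fun B C h k hh => by
      rw [KFunctor.map_map]
      refine H _ _ _ _ _ ?_
      rw [(hS B C h k hh).choose_spec.choose_spec, ← KFunctor.map_map, ← KFunctor.map_map,
        hh.choose_spec.choose_spec])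
  refine ⟨x', fun B h i φ e => ?_⟩
  have hh : S B h := ⟨i, φ, e⟩
  rw [hx' B h hh]
  exact H _ _ _ _ _ (e.trans hh.choose_spec.choose_spec.symm)

/-- Two local functors with coverings by affine charts which satisfy the same relations are
isomorphic. -/
theorem nonempty_iso_of_charts {ι : Type*} {A : ι → SAlg K} (y : ∀ i, X.obj (A i))
    (y' : ∀ i, X'.obj (A i)) (hX : IsLocalFunctor X) (hX' : IsLocalFunctor X')
    (cov : ∀ (R : SAlg K) (x : X.obj R) (r : R.specTop), ∃ (i : ι) (f : R.Even),
      (∃ q, specMap (toAway f) q = r) ∧ ∃ φ : A i ⟶ away f, X.map φ (y i) = X.map (toAway f) x)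
    (cov' : ∀ (R : SAlg K) (x : X'.obj R) (r : R.specTop), ∃ (i : ι) (f : R.Even),
      (∃ q, specMap (toAway f) q = r) ∧ ∃ φ : A i ⟶ away f, X'.map φ (y' i) = X'.map (toAway f) x)
    (H : ∀ (i j : ι) (B : SAlg K) (φ : A i ⟶ B) (ψ : A j ⟶ B), X.map φ (y i) = X.map ψ (y j) ↔
      X'.map φ (y' i) = X'.map ψ (y' j)) : Nonempty (X ≅ X') := by
  -- Both comparison maps are characterized on charts, so that they are inverse and natural is
  -- checked locally by `IsLocalFunctor.ext`.
  choose F hF using fun (R : SAlg K) (x : X.obj R) =>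
    exists_comparison y y' hX' cov (fun i j B φ ψ => (H i j B φ ψ).1) x
  choose G hG using fun (R : SAlg K) (x : X'.obj R) =>
    exists_comparison y' y hX cov' (fun i j B φ ψ => (H i j B φ ψ).2) x
  have hGF (R : SAlg K) (x : X.obj R) : G R (F R x) = x := hX.ext fun r => by
    obtain ⟨i, f, hf, φ, e⟩ := cov R x r
    exact ⟨f, hf, (hG R _ _ _ _ φ (hF R x _ _ _ φ e)).symm.trans e⟩
  have hFG (R : SAlg K) (x : X'.obj R) : F R (G R x) = x := hX'.ext fun r => by
    obtain ⟨i, f, hf, φ, e⟩ := cov' R x r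
    exact ⟨f, hf, (hF R _ _ _ _ φ (hG R x _ _ _ φ e)).symm.trans e⟩
  let τ : X ⟶ X' :=
    { app := fun R => ↾(F R)
      naturality := fun R B h => by
        ext x
        refine hX'.ext fun b => ?_
        obtain ⟨i, f, hf, φ, e⟩ := cov B (X.map h x) b
        refine ⟨f, hf, (hF B _ _ _ _ φ e).symm.trans ?_⟩
        rw [KFunctor.map_map] at e
        exact (hF R _ _ _ _ φ e).trans (KFunctor.map_map _ _ _).symm }
  have (R : SAlg K) : IsIso (τ.app R) :=
    (ConcreteCategory.isIso_iff_bijective (τ.app R)).2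
      ⟨(show Function.LeftInverse (G R) (F R) from hGF R).injective,
        (show Function.RightInverse (G R) (F R) from hFG R).surjective⟩
  have := NatIso.isIso_of_isIso_app τ
  exact ⟨asIso τ⟩

end Comparison

end

section

open SAlg GeomSuperspace

variable {K : Type u} [Field K]

/-! ### Transition maps between charts -/

section ChartMorphisms

/-- For `V` the image in `Z` of an open subset of `X`, the maps on sections of `g` and of `f ≫ g`
over `V` are bijective, hence so is that of `f`. -/
theorem GeomSuperspace.isOpenImm_of_comp {X Y Z : GeomSuperspace K} (f : X ⟶ Y) (g : Y ⟶ Z)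
    [hg : IsOpenImm g] [hfg : IsOpenImm (f ≫ g)] : IsOpenImm f where
  base_open := Topology.IsOpenEmbedding.of_comp f.hom.base hg.base_open hfg.base_open
  c_iso U := by
    have hf : Topology.IsOpenEmbedding f.hom.base :=
      Topology.IsOpenEmbedding.of_comp f.hom.base hg.base_open hfg.base_open
    let V : Opens Z.carrier := image g (hf.functor.obj U)
    have hV : V ≤ opensRange g := by rintro _ ⟨y, -, rfl⟩; exact ⟨y, rfl⟩
    have hV' : V ≤ opensRange (f ≫ g) := by rintro _ ⟨_, ⟨x, -, rfl⟩, rfl⟩; exact ⟨x, rfl⟩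
    have h1 := app_bijective g V hV
    have h2 := app_bijective (f ≫ g) V hV'
    have e : (Opens.map g.hom.base).obj V = hf.functor.obj U :=
      Opens.ext (Set.preimage_image_eq _ (injective g))
    have h3 : Function.Bijective (app f ((Opens.map g.hom.base).obj V)) := by
      have h2' : Function.Bijective (app f ((Opens.map g.hom.base).obj V) ∘ app g V) := h2
      exact (Function.Bijective.of_comp_iff _ h1).1 h2'
    rw [e] at h3
    exact isIso_of_bijective _ h3

variable {X : KFunctor K} {A R : SAlg K} {y : X.obj A}

/-- The morphism to an open chart from the open subspace of an affine superspace on which a given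
element lies in the chart. -/
theorem IsOpenChart.exists_hom (hy : IsOpenChart X A y) (x : X.obj R) :
    ∃ (U : Opens R.specTop) (g : R.sspec.restrict U ⟶ A.sspec),
      (∀ (B : SAlg K) (h : R ⟶ B), (∀ b, specMap h b ∈ U) → ∃ φ : A ⟶ B, X.map φ y = X.map h x) ∧
      ∀ (B : SAlg K) (h : R ⟶ B) (φ : A ⟶ B), X.map φ y = X.map h x →
        ∃ c : B.sspec ⟶ R.sspec.restrict U, c ≫ R.sspec.ofRestrict U = sspecMap h ∧
          c ≫ g = sspecMap φ := by
  obtain ⟨U, hU⟩ := hy.locus R x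
  -- By fullness an affine morphism to the open subspace is an `R ⟶ B` with points in `U`. The chart
  -- then provides an `A ⟶ B`, unique by `hy.inj`; these form the family to be glued.
  choose H hH using fun (B : SAlg K) (c : B.sspec ⟶ R.sspec.restrict U) =>
    exists_sspecMap_eq (c ≫ R.sspec.ofRestrict U)
  have hHU (B : SAlg K) (c : B.sspec ⟶ R.sspec.restrict U) (b : B.specTop) :
      specMap (H B c) b ∈ U := by
    have := congrArg (fun k : B.sspec ⟶ R.sspec => k.hom.base b) (hH B c)
    exact (congrArg (· ∈ U) this).mpr (c.hom.base b).2
  choose φ hφ using fun (B : SAlg K) (c : B.sspec ⟶ R.sspec.restrict U) =>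
    (hU B (H B c)).2 (hHU B c)
  have hoi : IsOpenImm (R.sspec.ofRestrict U) :=
    PresheafedSpace.IsOpenImmersion.ofRestrict _ U.isOpenEmbedding
  have hlift (B : SAlg K) (h : R ⟶ B) (hh : ∀ b, specMap h b ∈ U) :
      ∃ c : B.sspec ⟶ R.sspec.restrict U, c ≫ R.sspec.ofRestrict U = sspecMap h :=
    exists_lift (sspecMap h) (R.sspec.ofRestrict U) fun b => ⟨⟨specMap h b, hh b⟩, rfl⟩
  have key (B : SAlg K) (c : B.sspec ⟶ R.sspec.restrict U) (h : R ⟶ B)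
      (hc : c ≫ R.sspec.ofRestrict U = sspecMap h) (ψ : A ⟶ B) (hψ : X.map ψ y = X.map h x) :
      φ B c = ψ := by
    refine hy.inj _ _ _ ((hφ B c).trans (Eq.trans ?_ hψ.symm))
    rw [sspecMap_injective ((hH B c).trans hc)]
  let D : AffineGlueData (R.sspec.restrict U) A.sspec :=
    { S := fun _ _ => True
      closed := fun _ _ _ _ _ => trivial
      cov := fun r => by
        obtain ⟨f, ⟨q, hq⟩, hf⟩ := exists_away_subset U r.1 r.2
        obtain ⟨c, hc⟩ := hlift _ (toAway f) hf
        have : IsOpenImm (c ≫ R.sspec.ofRestrict U) := hc ▸ isOpenImm_toAway f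
        refine ⟨_, c, trivial, isOpenImm_of_comp c (R.sspec.ofRestrict U), q, Subtype.ext ?_⟩
        exact (congrArg (fun k : (away f).sspec ⟶ R.sspec => k.hom.base q) hc).trans hq
      φ := fun B c _ => sspecMap (φ B c)
      nat := fun B C c h _ => by
        rw [← sspecMap_comp]
        refine congrArg sspecMap (key C _ (H B c ≫ h) ?_ _ ?_)
        · rw [sspecMap_comp, hH, Category.assoc]
        · rw [← KFunctor.map_map, hφ, KFunctor.map_map] }
  obtain ⟨g, hg⟩ := D.exists_hom
  refine ⟨U, g, fun B h => (hU B h).2, fun B h ψ hψ => ?_⟩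
  obtain ⟨c, hc⟩ := hlift B h ((hU B h).1 ⟨ψ, hψ⟩)
  exact ⟨c, hc, (hg B c trivial).trans (congrArg sspecMap (key B c h hc ψ hψ))⟩

/-- The pointwise description of the morphism to an open chart. -/
theorem IsOpenChart.exists_transition (hy : IsOpenChart X A y) (x : X.obj R) :
    ∃ (U : Opens R.specTop) (G : U → A.specTop),
      (∀ (B : SAlg K) (h : R ⟶ B), (∀ b, specMap h b ∈ U) → ∃ φ : A ⟶ B, X.map φ y = X.map h x) ∧
      (∀ (B : SAlg K) (h : R ⟶ B) (φ : A ⟶ B), X.map φ y = X.map h x →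
        ∀ b, ∃ hb : specMap h b ∈ U, G ⟨specMap h b, hb⟩ = specMap φ b) ∧
      (∀ V : Opens A.specTop, IsOpen {r : R.specTop | ∃ hr : r ∈ U, G ⟨r, hr⟩ ∈ V}) ∧
      ∀ (V : Opens A.specTop) (σ : A.sections V) (W : Opens R.specTop),
        (∀ r ∈ W, ∃ hr : r ∈ U, G ⟨r, hr⟩ ∈ V) → ∃ τ : R.sections W, ∀ (B : SAlg K) (h : R ⟶ B)
          (φ : A ⟶ B), X.map φ y = X.map h x → ∀ (b : B.specTop) (hb : specMap h b ∈ W)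
          (hb' : specMap φ b ∈ V), ev (Y := R.sspec) (sspecMap h) W b hb τ =
            ev (Y := A.sspec) (sspecMap φ) V b hb' σ := by
  obtain ⟨U, g, h1, h2⟩ := hy.exists_hom x
  refine ⟨U, fun r => g.hom.base r, h1, fun B h φ e b => ?_, fun V => ?_, fun V σ W hW => ?_⟩
  · obtain ⟨c, hc, hc'⟩ := h2 B h φ e
    have e1 := congrArg (fun k : B.sspec ⟶ R.sspec => k.hom.base b) hc
    have e2 := congrArg (fun k : B.sspec ⟶ A.sspec => k.hom.base b) hc'
    have hb : specMap h b ∈ U := (congrArg (· ∈ U) e1).mp (c.hom.base b).2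
    refine ⟨hb, Eq.trans (congrArg g.hom.base ?_) e2⟩
    exact Subtype.ext e1.symm
  · have : {r : R.specTop | ∃ hr : r ∈ U, g.hom.base ⟨r, hr⟩ ∈ V} =
        Subtype.val '' (g.hom.base ⁻¹' (V : Set A.specTop)) := by
      ext r
      exact ⟨fun ⟨hr, h⟩ => ⟨⟨r, hr⟩, h, rfl⟩, fun ⟨⟨_, hr⟩, h, e⟩ => by subst e; exact ⟨hr, h⟩⟩
    refine (congrArg IsOpen this).mpr ?_
    exact U.isOpenEmbedding.isOpenMap _ (g.hom.base.hom.continuous.isOpen_preimage _ V.2)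
  · let W' : Opens (R.sspec.restrict U).carrier := (Opens.map g.hom.base).obj V
    let V' : Opens R.specTop := U.isOpenEmbedding.functor.obj W'
    have hWV : W ≤ V' := fun r hr => ⟨⟨r, (hW r hr).1⟩, (hW r hr).2, rfl⟩
    let σ' : (R.sspec.restrict U).Γ W' := app g V σ
    -- Sections of the open subspace over `W'` are by definition sections of `SSpec R` over its
    -- image `V'`.
    let σ'' : R.sspec.Γ V' := σ'
    refine ⟨R.sspec.res hWV σ'', fun B h φ e b hb hb' => ?_⟩
    obtain ⟨c, hc, hc'⟩ := h2 B h φ e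
    have hle : (Opens.map (R.sspec.ofRestrict U).hom.base).obj V' ≤ W' := by
      rintro r ⟨r', hr', e⟩
      exact Subtype.ext e ▸ hr'
    have e3 : app (R.sspec.ofRestrict U) V' σ'' = (R.sspec.restrict U).res hle σ' := rfl
    have hbV : specMap h b ∈ V' := hWV hb
    refine (ev_res (Y := R.sspec) (sspecMap h) hWV b hb σ'').trans ?_
    refine (ev_congr hc.symm V' b hbV σ'').trans ?_
    refine (congrArg (B.evalSection _ b _) (congrArg (app c _) e3)).trans ?_
    have hbW : c.hom.base b ∈ (Opens.map (R.sspec.ofRestrict U).hom.base).obj V' := by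
      have e1 := congrArg (fun k : B.sspec ⟶ R.sspec => k.hom.base b) hc
      exact (congrArg (· ∈ V') e1).mpr hbV
    refine (ev_res c hle b hbW σ').trans ?_
    exact ev_congr hc' V b (hle hbW) σ

end ChartMorphisms

end

section

open SAlg GeomSuperspace

namespace OpenAtlas

variable {K : Type u} [Field K] {X : KFunctor K} (𝒜 : OpenAtlas X)

/-! ### The topological space glued from an atlas -/

section Space

/-- The open subset of the `j`-th chart on which it overlaps with the `i`-th chart. -/
def overlap (i j : 𝒜.ι) : Opens (𝒜.A j).specTop :=
  ((𝒜.chart i).exists_transition (𝒜.y j)).choose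

/-- The transition map from the `j`-th to the `i`-th chart. -/
def transition (i j : 𝒜.ι) : 𝒜.overlap i j → (𝒜.A i).specTop :=
  ((𝒜.chart i).exists_transition (𝒜.y j)).choose_spec.choose

/-- The relation between morphisms from two charts of being identified in `X`. -/
def Related {i j : 𝒜.ι} {B : SAlg K} (φ : 𝒜.A i ⟶ B) (ψ : 𝒜.A j ⟶ B) : Prop :=
  X.map φ (𝒜.y i) = X.map ψ (𝒜.y j)

variable {𝒜} {i j k : 𝒜.ι} {B C : SAlg K}

theorem Related.comp {φ : 𝒜.A i ⟶ B} {ψ : 𝒜.A j ⟶ B} (h : 𝒜.Related φ ψ) (χ : B ⟶ C) :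
    𝒜.Related (φ ≫ χ) (ψ ≫ χ) :=
  (KFunctor.map_map φ χ _).symm.trans ((congrArg (X.map χ) h).trans (KFunctor.map_map ψ χ _))

theorem Related.symm {φ : 𝒜.A i ⟶ B} {ψ : 𝒜.A j ⟶ B} (h : 𝒜.Related φ ψ) : 𝒜.Related ψ φ :=
  Eq.symm h

theorem Related.trans {φ : 𝒜.A i ⟶ B} {ψ : 𝒜.A j ⟶ B} {χ : 𝒜.A k ⟶ B} (h : 𝒜.Related φ ψ)
    (h' : 𝒜.Related ψ χ) : 𝒜.Related φ χ :=
  Eq.trans h h'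

theorem exists_related (h : 𝒜.A j ⟶ B) (hb : ∀ b, specMap h b ∈ 𝒜.overlap i j) :
    ∃ φ : 𝒜.A i ⟶ B, 𝒜.Related φ h :=
  ((𝒜.chart i).exists_transition (𝒜.y j)).choose_spec.choose_spec.1 B h hb

theorem Related.transition_eq {φ : 𝒜.A i ⟶ B} {h : 𝒜.A j ⟶ B} (e : 𝒜.Related φ h)
    (b : B.specTop) : ∃ hb : specMap h b ∈ 𝒜.overlap i j,
      𝒜.transition i j ⟨specMap h b, hb⟩ = specMap φ b :=
  ((𝒜.chart i).exists_transition (𝒜.y j)).choose_spec.choose_spec.2.1 B h φ e b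

theorem isOpen_transition (V : Opens (𝒜.A i).specTop) :
    IsOpen {r : (𝒜.A j).specTop | ∃ hr : r ∈ 𝒜.overlap i j, 𝒜.transition i j ⟨r, hr⟩ ∈ V} :=
  ((𝒜.chart i).exists_transition (𝒜.y j)).choose_spec.choose_spec.2.2.1 V

theorem exists_transition_section (V : Opens (𝒜.A i).specTop) (σ : (𝒜.A i).sections V)
    (W : Opens (𝒜.A j).specTop)
    (hW : ∀ r ∈ W, ∃ hr : r ∈ 𝒜.overlap i j, 𝒜.transition i j ⟨r, hr⟩ ∈ V) :
    ∃ τ : (𝒜.A j).sections W, ∀ (B : SAlg K) (h : 𝒜.A j ⟶ B) (φ : 𝒜.A i ⟶ B), 𝒜.Related φ h →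
      ∀ (b : B.specTop) (hb : specMap h b ∈ W) (hb' : specMap φ b ∈ V),
        ev (Y := (𝒜.A j).sspec) (sspecMap h) W b hb τ =
          ev (Y := (𝒜.A i).sspec) (sspecMap φ) V b hb' σ :=
  ((𝒜.chart i).exists_transition (𝒜.y j)).choose_spec.choose_spec.2.2.2 V σ W hW

theorem exists_toAway_related {q : (𝒜.A j).specTop} (hq : q ∈ 𝒜.overlap i j) :
    ∃ f : (𝒜.A j).Even, (∃ q', specMap (toAway f) q' = q) ∧
      ∃ φ : 𝒜.A i ⟶ away f, 𝒜.Related φ (toAway f) := by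
  obtain ⟨f, hf, hf'⟩ := exists_away_subset _ q hq
  exact ⟨f, hf, exists_related (toAway f) hf'⟩

variable (𝒜)

/-- The relation of representing the same point. -/
def PointRel {i j : 𝒜.ι} (p : (𝒜.A i).specTop) (q : (𝒜.A j).specTop) : Prop :=
  ∃ (B : SAlg K) (φ : 𝒜.A i ⟶ B) (ψ : 𝒜.A j ⟶ B) (r : B.specTop),
    𝒜.Related φ ψ ∧ specMap φ r = p ∧ specMap ψ r = q

variable {𝒜}

/-- Links the symmetric description, suited to an equivalence relation, with the transition map,
suited to topology. A basic open neighbourhood of `q` inside the overlap supplies the related pair.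
-/
theorem pointRel_iff {p : (𝒜.A i).specTop} {q : (𝒜.A j).specTop} :
    𝒜.PointRel p q ↔ ∃ hq : q ∈ 𝒜.overlap i j, 𝒜.transition i j ⟨q, hq⟩ = p := by
  constructor
  · rintro ⟨B, φ, ψ, r, e, rfl, rfl⟩
    exact e.transition_eq r
  · rintro ⟨hq, rfl⟩
    obtain ⟨f, ⟨q', rfl⟩, φ, e⟩ := exists_toAway_related hq
    exact ⟨_, φ, toAway f, q', e, (e.transition_eq q').choose_spec.symm, rfl⟩

theorem PointRel.symm {p : (𝒜.A i).specTop} {q : (𝒜.A j).specTop} (h : 𝒜.PointRel p q) :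
    𝒜.PointRel q p := by
  obtain ⟨B, φ, ψ, r, e, h1, h2⟩ := h
  exact ⟨B, ψ, φ, r, e.symm, h2, h1⟩

/-- Both relations are realized on a common basic open neighbourhood of the middle point, where the
related pairs compose. -/
theorem PointRel.trans {p : (𝒜.A i).specTop} {q : (𝒜.A j).specTop} {r : (𝒜.A k).specTop}
    (h : 𝒜.PointRel p q) (h' : 𝒜.PointRel q r) : 𝒜.PointRel p r := by
  obtain ⟨hq, rfl⟩ := pointRel_iff.1 h
  obtain ⟨hq', rfl⟩ := pointRel_iff.1 h'.symm
  obtain ⟨f, ⟨q', rfl⟩, hf⟩ := exists_away_subset (𝒜.overlap i j ⊓ 𝒜.overlap k j) q ⟨hq, hq'⟩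
  obtain ⟨φ, hφ⟩ := exists_related (i := i) (toAway f) fun b => (hf b).1
  obtain ⟨ψ, hψ⟩ := exists_related (i := k) (toAway f) fun b => (hf b).2
  exact ⟨_, φ, ψ, q', hφ.trans hψ.symm, (hφ.transition_eq q').choose_spec.symm,
    (hψ.transition_eq q').choose_spec.symm⟩

variable (𝒜)

/-- The points of the charts up to identification. -/
def pointSetoid : Setoid (Σ i, (𝒜.A i).specTop) where
  r a b := 𝒜.PointRel a.2 b.2
  iseqv :=
    { refl := fun a => by
        obtain ⟨f, ⟨q, hq⟩, -⟩ := exists_away_subset ⊤ a.2 trivial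
        exact ⟨_, toAway f, toAway f, q, rfl, hq, hq⟩
      symm := PointRel.symm
      trans := PointRel.trans }

/-- The space obtained by gluing the charts. -/
def space : TopCat.{u} := TopCat.of (Quotient 𝒜.pointSetoid)

/-- The inclusion of a chart. -/
def incl (i : 𝒜.ι) : (𝒜.A i).specTop ⟶ 𝒜.space :=
  TopCat.ofHom ⟨fun p => Quotient.mk 𝒜.pointSetoid ⟨i, p⟩,
    continuous_quotient_mk'.comp continuous_sigmaMk⟩

variable {𝒜}

theorem incl_eq_iff {p : (𝒜.A i).specTop} {q : (𝒜.A j).specTop} :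
    𝒜.incl i p = 𝒜.incl j q ↔ 𝒜.PointRel p q :=
  Quotient.eq

theorem incl_eq_iff_transition {p : (𝒜.A i).specTop} {q : (𝒜.A j).specTop} :
    𝒜.incl i p = 𝒜.incl j q ↔ ∃ hq : q ∈ 𝒜.overlap i j, 𝒜.transition i j ⟨q, hq⟩ = p :=
  incl_eq_iff.trans pointRel_iff

theorem Related.incl_eq {φ : 𝒜.A i ⟶ B} {ψ : 𝒜.A j ⟶ B} (e : 𝒜.Related φ ψ) (b : B.specTop) :
    𝒜.incl i (specMap φ b) = 𝒜.incl j (specMap ψ b) :=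
  incl_eq_iff.2 ⟨B, φ, ψ, b, e, rfl, rfl⟩

theorem exists_incl_eq (x : 𝒜.space) : ∃ i p, 𝒜.incl i p = x := by
  obtain ⟨⟨i, p⟩, rfl⟩ := Quotient.exists_rep x
  exact ⟨i, p, rfl⟩

theorem incl_injective (i : 𝒜.ι) : Function.Injective (𝒜.incl i) := by
  intro p q h
  obtain ⟨B, φ, ψ, r, e, rfl, rfl⟩ := incl_eq_iff.1 h
  rw [(𝒜.chart i).inj B φ ψ e]

/-- Seen in the `j`-th chart, the image of `V` is the set of points of the overlap that the
transition map sends into `V`. -/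
theorem isOpenMap_incl (i : 𝒜.ι) : IsOpenMap (𝒜.incl i) := by
  intro V hV
  refine isOpen_coinduced.2 (isOpen_sigma_iff.2 fun j => ?_)
  convert isOpen_transition (i := i) (j := j) ⟨V, hV⟩ using 1
  ext r
  refine ⟨fun ⟨p, hp, e⟩ => ?_, fun ⟨hr, h⟩ => ⟨_, h, incl_eq_iff_transition.2 ⟨hr, rfl⟩⟩⟩
  obtain ⟨hr, rfl⟩ := incl_eq_iff_transition.1 e
  exact ⟨hr, hp⟩

theorem isOpenEmbedding_incl (i : 𝒜.ι) : Topology.IsOpenEmbedding (𝒜.incl i) :=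
  .of_continuous_injective_isOpenMap (𝒜.incl i).hom.continuous (incl_injective i) (isOpenMap_incl i)

end Space

end OpenAtlas

end

section

open SAlg GeomSuperspace

namespace OpenAtlas

variable {K : Type u} [Field K] {X : KFunctor K} (𝒜 : OpenAtlas X)

/-! ### The structure sheaf of the glued space -/

section Sheaf

/-- The part of an open subset in the `i`-th chart. -/
abbrev pre (i : 𝒜.ι) (U : Opens 𝒜.space) : Opens (𝒜.A i).specTop := (Opens.map (𝒜.incl i)).obj U

/-- The value at a point of the pull back of a section in a chart. -/
abbrev val {i : 𝒜.ι} {B : SAlg K} (φ : 𝒜.A i ⟶ B) (U : Opens 𝒜.space) (b : B.specTop)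
    (hb : specMap φ b ∈ 𝒜.pre i U) : (𝒜.A i).sections (𝒜.pre i U) ⟶ B.atPrime b :=
  ev (Y := (𝒜.A i).sspec) (sspecMap φ) (𝒜.pre i U) b hb

/-- Sections in the charts which agree on the overlaps. -/
def IsCompatible (U : Opens 𝒜.space) (s : ∀ i, (𝒜.A i).sections (𝒜.pre i U)) : Prop :=
  ∀ (i j : 𝒜.ι) (B : SAlg K) (φ : 𝒜.A i ⟶ B) (ψ : 𝒜.A j ⟶ B), 𝒜.Related φ ψ →
    ∀ (b : B.specTop) (hi : specMap φ b ∈ 𝒜.pre i U) (hj : specMap ψ b ∈ 𝒜.pre j U),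
      𝒜.val φ U b hi (s i) = 𝒜.val ψ U b hj (s j)

/-- The algebra of compatible families of sections. -/
def gluedSubalgebra (U : Opens 𝒜.space) :
    Subalgebra K (∀ i, (𝒜.A i).sections (𝒜.pre i U)) where
  carrier := {s | 𝒜.IsCompatible U s}
  add_mem' {s t} hs ht i j B φ ψ e b hi hj :=
    (map_add (ConcreteCategory.hom (𝒜.val φ U b hi)) (s i) (t i)).trans
      ((congrArg₂ (· + ·) (hs i j B φ ψ e b hi hj) (ht i j B φ ψ e b hi hj)).trans
        (map_add (ConcreteCategory.hom (𝒜.val ψ U b hj)) (s j) (t j)).symm)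
  mul_mem' {s t} hs ht i j B φ ψ e b hi hj :=
    (map_mul (ConcreteCategory.hom (𝒜.val φ U b hi)) (s i) (t i)).trans
      ((congrArg₂ (· * ·) (hs i j B φ ψ e b hi hj) (ht i j B φ ψ e b hi hj)).trans
        (map_mul (ConcreteCategory.hom (𝒜.val ψ U b hj)) (s j) (t j)).symm)
  algebraMap_mem' k _ _ _ φ ψ _ b hi hj :=
    (AlgHomClass.commutes (ConcreteCategory.hom (𝒜.val φ U b hi)) k).trans
      (AlgHomClass.commutes (ConcreteCategory.hom (𝒜.val ψ U b hj)) k).symm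

/-- The homogeneous families of sections. -/
def gluedGrading (U : Opens 𝒜.space) (d : ZMod 2) : Submodule K (𝒜.gluedSubalgebra U) where
  carrier := {s | ∀ i, s.1 i ∈ ((𝒜.A i).sections (𝒜.pre i U)).grading d}
  add_mem' hs ht i := add_mem (hs i) (ht i)
  zero_mem' _ := zero_mem _
  smul_mem' k _ hs i := Submodule.smul_mem _ k (hs i)

instance (U : Opens 𝒜.space) : SetLike.GradedMonoid (𝒜.gluedGrading U) where
  one_mem _ := SetLike.GradedOne.one_mem
  mul_mem _ _ _ _ hs ht i := SetLike.mul_mem_graded (hs i) (ht i)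

variable {𝒜} in
theorem IsCompatible.evenProj {U : Opens 𝒜.space} {s : ∀ i, (𝒜.A i).sections (𝒜.pre i U)}
    (hs : 𝒜.IsCompatible U s) : 𝒜.IsCompatible U fun i => (SAlg.evenProj _ (s i)).1 := by
  intro i j B φ ψ e b hi hj
  have h1 := SAlg.evenProj_hom (𝒜.val φ U b hi) (s i)
  have h2 := SAlg.evenProj_hom (𝒜.val ψ U b hj) (s j)
  have h := congrArg (SAlg.evenProj _) (hs i j B φ ψ e b hi hj)
  exact congrArg Subtype.val (h1.symm.trans (h.trans h2))

theorem gluedGrading_isCompl (U : Opens 𝒜.space) :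
    IsCompl (𝒜.gluedGrading U 0) (𝒜.gluedGrading U 1) := by
  constructor
  · rw [Submodule.disjoint_def]
    intro s h0 h1
    exact Subtype.ext (funext fun i => SAlg.eq_zero_of_mem _ (h0 i) (h1 i))
  · rw [codisjoint_iff, eq_top_iff]
    rintro ⟨s, hs⟩ -
    let t : 𝒜.gluedSubalgebra U := ⟨_, IsCompatible.evenProj hs⟩
    have ht : (⟨s, hs⟩ : 𝒜.gluedSubalgebra U) - t ∈ 𝒜.gluedGrading U 1 := fun i => by
      have h : s i - (SAlg.evenProj _ (s i)).1 = (SAlg.oddProj _ (s i)).1 :=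
        sub_eq_of_eq_add' (evenProj_add_oddProj (s i)).symm
      exact (congrArg (· ∈ ((𝒜.A i).sections (𝒜.pre i U)).grading 1) h).mpr
        (SAlg.oddProj _ (s i)).2
    exact Submodule.mem_sup.2 ⟨t, fun i => (SAlg.evenProj _ (s i)).2, _, ht,
      add_sub_cancel t ⟨s, hs⟩⟩

/-- The superalgebra of compatible families of sections. -/
def gluedSections (U : Opens 𝒜.space) : SAlg K where
  carrier := 𝒜.gluedSubalgebra U
  grading := 𝒜.gluedGrading U
  graded := gradedOfIsCompl _ (𝒜.gluedGrading_isCompl U)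
  supercomm d d' s t hs ht := by
    have h : ∀ i, s.1 i * t.1 i = (-1) ^ (d.val * d'.val) * (t.1 i * s.1 i) :=
      fun i => SAlg.supercomm _ d d' _ _ (hs i) (ht i)
    rcases Nat.even_or_odd (d.val * d'.val) with e | e
    · have h' : ∀ i, s.1 i * t.1 i = t.1 i * s.1 i := fun i => by
        rw [h i, e.neg_one_pow, one_mul]
      exact (Subtype.ext (funext h')).trans
        ((congrArg (· * (t * s)) e.neg_one_pow).trans (one_mul _)).symm
    · have h' : ∀ i, s.1 i * t.1 i = -(t.1 i * s.1 i) := fun i => by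
        rw [h i, e.neg_one_pow, neg_one_mul]
      exact (Subtype.ext (funext h')).trans
        ((congrArg (· * (t * s)) e.neg_one_pow).trans (neg_one_mul _)).symm

/-- Restriction of families of sections. -/
def gluedRes {U V : Opens 𝒜.space} (h : V ≤ U) : 𝒜.gluedSections U ⟶ 𝒜.gluedSections V where
  toFun s := ⟨fun i => (𝒜.A i).sectionsRes (show 𝒜.pre i V ≤ 𝒜.pre i U from fun _ hx => h hx)
      (s.1 i), fun i j B φ ψ e b hi hj => s.2 i j B φ ψ e b (h hi) (h hj)⟩
  map_one' := rfl
  map_mul' _ _ := rfl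
  map_zero' := rfl
  map_add' _ _ := rfl
  commutes' _ := rfl
  map_mem hs i := hom_map_mem _ (hs i)

/-- The glued structure presheaf. -/
def gluedPresheaf : TopCat.Presheaf (SAlg K) 𝒜.space where
  obj U := 𝒜.gluedSections U.unop
  map i := 𝒜.gluedRes i.unop.le

/-- Sections are glued in each chart separately. Compatibility of the result is checked at single
points, and related points have the same image in the glued space, so they lie over a common `U a`.
-/
theorem gluedPresheaf_isSheaf :
    TopCat.Presheaf.IsSheaf (𝒜.gluedPresheaf ⋙ forget (SAlg K)) := by
  refine TopCat.Presheaf.isSheaf_of_isSheafUniqueGluing_types _ fun ι U sf hsf => ?_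
  let s (a : ι) : 𝒜.gluedSections (U a) := sf a
  have hs (a b : ι) : 𝒜.gluedRes (inf_le_left : U a ⊓ U b ≤ U a) (s a) =
      𝒜.gluedRes (inf_le_right : U a ⊓ U b ≤ U b) (s b) := hsf a b
  have hle (i : 𝒜.ι) (a : ι) : 𝒜.pre i (U a) ≤ 𝒜.pre i (iSup U) := fun x hx =>
    Opens.mem_iSup.2 ⟨a, hx⟩
  have hcov (i : 𝒜.ι) (x : (𝒜.A i).specTop) (hx : x ∈ 𝒜.pre i (iSup U)) :
      ∃ a, x ∈ 𝒜.pre i (U a) := (Opens.mem_iSup (x := 𝒜.incl i x)).1 hx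
  choose t ht using fun i : 𝒜.ι => exists_glue (X := (𝒜.A i).sspec) (U := 𝒜.pre i (iSup U))
    (fun a => 𝒜.pre i (U a)) (hle i) (hcov i) (fun a => (s a).1 i) fun a b =>
      congrArg (fun z : 𝒜.gluedSections (U a ⊓ U b) => z.1 i) (hs a b)
  have htc : 𝒜.IsCompatible (iSup U) t := by
    intro i j B φ ψ e b hi hj
    obtain ⟨a, ha⟩ := hcov i _ hi
    have ha' : specMap ψ b ∈ 𝒜.pre j (U a) :=
      (congrArg (· ∈ U a) (e.incl_eq b)).mp ha
    have h := (s a).2 i j B φ ψ e b ha ha'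
    refine (ev_res (Y := (𝒜.A i).sspec) (sspecMap φ) (hle i a) b ha (t i)).symm.trans ?_
    refine Eq.trans ?_ (ev_res (Y := (𝒜.A j).sspec) (sspecMap ψ) (hle j a) b ha' (t j))
    exact (congrArg (𝒜.val φ (U a) b ha) (ht i a)).trans
      (h.trans (congrArg (𝒜.val ψ (U a) b ha') (ht j a)).symm)
  refine ⟨(show 𝒜.gluedSections (iSup U) from ⟨t, htc⟩), fun a => ?_, fun t' ht' => ?_⟩
  · exact Subtype.ext (funext fun i => ht i a)
  · let t'' : 𝒜.gluedSections (iSup U) := t'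
    have ht'' (a : ι) : 𝒜.gluedRes (le_iSup U a) t'' = s a := ht' a
    refine Subtype.ext (funext fun i => ?_)
    refine eq_of_locally_eq (X := (𝒜.A i).sspec) (t''.1 i) (t i) fun x hx => ?_
    obtain ⟨a, ha⟩ := hcov i x hx
    refine ⟨_, hle i a, ha, Eq.trans ?_ (ht i a).symm⟩
    exact congrArg (fun z : 𝒜.gluedSections (U a) => z.1 i) (ht'' a)

/-- The glued space with its structure presheaf. -/
def gluedPresheafedSpace : PresheafedSpace.{u, u + 1, u} (SAlg K) where
  carrier := 𝒜.space
  presheaf := 𝒜.gluedPresheaf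

/-- The restriction of a family of sections to a chart. -/
def proj (i : 𝒜.ι) (U : Opens 𝒜.space) :
    𝒜.gluedSections U ⟶ (𝒜.A i).sections (𝒜.pre i U) where
  toFun s := s.1 i
  map_one' := rfl
  map_mul' _ _ := rfl
  map_zero' := rfl
  map_add' _ _ := rfl
  commutes' _ := rfl
  map_mem hs := hs i

/-- The inclusion of a chart as a morphism of spaces with a presheaf of superalgebras. -/
def inclPresheafed (i : 𝒜.ι) : (𝒜.A i).specPresheafedSpace ⟶ 𝒜.gluedPresheafedSpace where
  base := 𝒜.incl i
  c := { app := fun U => 𝒜.proj i U.unop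
         naturality := fun _ _ _ => rfl }

/-- Compatibility speaks of morphisms out of charts; the localizations among them already determine
a section. -/
theorem sections_ext_of_toAway {A : SAlg K} {W : Opens A.specTop} {σ τ : A.sections W}
    (h : ∀ q ∈ W, ∃ (f : A.Even) (q' : (away f).specTop), specMap (toAway f) q' = q ∧
      ∀ hq : specMap (toAway f) q' ∈ W, ev (Y := A.sspec) (sspecMap (toAway f)) W q' hq σ =
        ev (Y := A.sspec) (sspecMap (toAway f)) W q' hq τ) : σ = τ := by
  refine Subtype.ext (funext fun ⟨q, hq⟩ => ?_)
  obtain ⟨f, q', rfl, e⟩ := h q hq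
  exact stalkLocMap_toLocalization_injective _ q' (e hq)

/-- Over an open subset of the `i`-th chart, the transition maps determine all components of a
compatible family from the `i`-th, and conversely spread a section of the `i`-th chart to every
chart. -/
theorem proj_bijective (i : 𝒜.ι) (V : Opens 𝒜.space) (hV : ∀ x ∈ V, ∃ p, 𝒜.incl i p = x) :
    Function.Bijective (𝒜.proj i V) := by
  have hov (j : 𝒜.ι) (q : (𝒜.A j).specTop) (hq : q ∈ 𝒜.pre j V) :
      ∃ hq' : q ∈ 𝒜.overlap i j, 𝒜.transition i j ⟨q, hq'⟩ ∈ 𝒜.pre i V := by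
    obtain ⟨p, hp⟩ := hV _ hq
    obtain ⟨hq', rfl⟩ := incl_eq_iff_transition.1 hp
    exact ⟨hq', (congrArg (· ∈ V) hp).mpr hq⟩
  constructor
  · intro s t h
    refine Subtype.ext (funext fun j => sections_ext_of_toAway fun q hq => ?_)
    obtain ⟨f, ⟨q', rfl⟩, φ, e⟩ := exists_toAway_related (hov j q hq).1
    refine ⟨f, q', rfl, fun hq => ?_⟩
    have hi : specMap φ q' ∈ 𝒜.pre i V := (congrArg (· ∈ V) (e.incl_eq q')).mpr hq
    exact (s.2 i j _ φ _ e q' hi hq).symm.trans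
      ((congrArg (𝒜.val φ V q' hi) h).trans (t.2 i j _ φ _ e q' hi hq))
  · intro σ
    choose τ hτ using fun j => exists_transition_section (j := j) (𝒜.pre i V) σ (𝒜.pre j V) (hov j)
    have hc : 𝒜.IsCompatible V τ := by
      intro j k B φ ψ e b hj hk
      -- After inverting `φ(f)` in `B`, both `φ` and `ψ` become related to one morphism from the
      -- `i`-th chart, and both values become the value of `σ` along it.
      obtain ⟨f, ⟨q', hq'⟩, χ, eχ⟩ := exists_toAway_related (hov j _ hj).1
      obtain ⟨b', rfl⟩ := (exists_specMap_toAway_eq_iff (evenMap φ f) b).2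
        ((exists_specMap_toAway_eq_iff f (specMap φ b)).1 ⟨q', hq'⟩)
      have h1 : 𝒜.Related (χ ≫ awayMap φ f) (φ ≫ toAway (evenMap φ f)) :=
        toAway_awayMap φ f ▸ eχ.comp (awayMap φ f)
      have h2 : 𝒜.Related (χ ≫ awayMap φ f) (ψ ≫ toAway (evenMap φ f)) := h1.trans (e.comp _)
      have hi : specMap (χ ≫ awayMap φ f) b' ∈ 𝒜.pre i V :=
        (congrArg (· ∈ V) (h1.incl_eq b')).mpr hj
      have e1 := hτ j _ _ _ h1 b' hj hi
      have e2 := hτ k _ _ _ h2 b' hk hi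
      have e3 := ev_congr (Y := (𝒜.A j).sspec) (sspecMap_comp φ (toAway (evenMap φ f)))
        (𝒜.pre j V) b' hj (τ j)
      have e4 := ev_congr (Y := (𝒜.A k).sspec) (sspecMap_comp ψ (toAway (evenMap φ f)))
        (𝒜.pre k V) b' hk (τ k)
      exact stalkLocMap_toLocalization_injective _ b'
        (e3.symm.trans (e1.trans (e2.symm.trans e4)))
    refine ⟨(⟨τ, hc⟩ : 𝒜.gluedSubalgebra V), sections_ext_of_toAway fun q hq => ?_⟩
    -- A morphism from the `i`-th chart is related to itself, so `τ i` and `σ` have the same values.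
    obtain ⟨f, ⟨q', rfl⟩, -⟩ := exists_away_subset ⊤ q trivial
    exact ⟨f, q', rfl, fun hq => hτ i _ (toAway f) (toAway f) rfl q' hq hq⟩

instance (i : 𝒜.ι) : PresheafedSpace.IsOpenImmersion (𝒜.inclPresheafed i) where
  base_open := isOpenEmbedding_incl i
  c_iso U := isIso_of_bijective _ (𝒜.proj_bijective i _ (by rintro _ ⟨p, -, rfl⟩; exact ⟨p, rfl⟩))

/-- The geometric superspace obtained by gluing the charts. -/
def glued : GeomSuperspace K where
  toPresheafedSpace := 𝒜.gluedPresheafedSpace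
  isSheaf := 𝒜.gluedPresheaf_isSheaf
  isLocalRing x := by
    obtain ⟨i, p, rfl⟩ := 𝒜.exists_incl_eq x
    have := isOpenImmersion_evenSpace (𝒜.inclPresheafed i)
    -- A ring with a local homomorphism to a local ring, here the stalk of a chart, is itself local.
    have h := isLocalOnStalks_of_isOpenImmersion ((evenSpace K).map (𝒜.inclPresheafed i)) p
    have : IsLocalRing (((evenSpace K).obj (𝒜.A i).specPresheafedSpace).presheaf.stalk p) :=
      (𝒜.A i).sspec.isLocalRing p
    exact @RingHom.domain_isLocalRing _ _ _ _ this
      (((evenSpace K).map (𝒜.inclPresheafed i)).stalkMap p).hom h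

/-- The inclusion of a chart. -/
def inclHom (i : 𝒜.ι) : (𝒜.A i).sspec ⟶ 𝒜.glued where
  hom := 𝒜.inclPresheafed i
  isLocal :=
    have := isOpenImmersion_evenSpace (𝒜.inclPresheafed i)
    isLocalOnStalks_of_isOpenImmersion ((evenSpace K).map (𝒜.inclPresheafed i))

instance (i : 𝒜.ι) : IsOpenImm (𝒜.inclHom i) :=
  inferInstanceAs (PresheafedSpace.IsOpenImmersion (𝒜.inclPresheafed i))

theorem isGeomSuperscheme_glued : IsGeomSuperscheme 𝒜.glued :=
  isGeomSuperscheme_iff.2 fun x => by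
    obtain ⟨i, p, hp⟩ := 𝒜.exists_incl_eq x
    exact ⟨_, 𝒜.inclHom i, inferInstance, p, hp⟩

variable {𝒜} in
theorem Related.inclHom_eq {i j : 𝒜.ι} {B : SAlg K} {φ : 𝒜.A i ⟶ B} {ψ : 𝒜.A j ⟶ B}
    (e : 𝒜.Related φ ψ) : sspecMap φ ≫ 𝒜.inclHom i = sspecMap ψ ≫ 𝒜.inclHom j :=
  hom_ext_ev (fun b => e.incl_eq b) fun _ b hi hj s => s.2 i j B φ ψ e b hi hj

-- The glued space identifies no more than `X` does: if the composites agree, `ψ` lands in the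
-- overlap and is related to some `χ`, which equals `φ` because `inclHom i` is a monomorphism.
variable {𝒜} in
theorem related_iff {i j : 𝒜.ι} {B : SAlg K} {φ : 𝒜.A i ⟶ B} {ψ : 𝒜.A j ⟶ B} :
    𝒜.Related φ ψ ↔ sspecMap φ ≫ 𝒜.inclHom i = sspecMap ψ ≫ 𝒜.inclHom j := by
  refine ⟨Related.inclHom_eq, fun h => ?_⟩
  obtain ⟨χ, hχ⟩ := exists_related (i := i) ψ fun b =>
    (incl_eq_iff_transition.1 (congrArg (fun k : B.sspec ⟶ 𝒜.glued => k.hom.base b) h)).1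
  have e : sspecMap χ = sspecMap φ := (cancel_mono (𝒜.inclHom i)).1 (hχ.inclHom_eq.trans h.symm)
  exact sspecMap_injective e ▸ hχ

end Sheaf

/-- A local `K`-functor with an open atlas is the functor of points of the glued space. -/
theorem nonempty_iso_functorOfPoints_glued (hX : IsLocalFunctor X) :
    Nonempty (X ≅ (functorOfPoints K).obj 𝒜.glued) := by
  refine nonempty_iso_of_charts 𝒜.y (fun i => 𝒜.inclHom i) hX (isLocalFunctor_functorOfPoints _)
    𝒜.cover (fun R x r => ?_) fun i j B φ ψ => 𝒜.related_iff
  obtain ⟨i, p, hp⟩ := 𝒜.exists_incl_eq ((show R.sspec ⟶ 𝒜.glued from x).hom.base r)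
  exact ⟨i, exists_away_factors (𝒜.inclHom i) x r ⟨p, hp⟩⟩

end OpenAtlas

theorem exists_iso_functorOfPoints {K : Type u} [Field K] (hK : (2 : K) ≠ 0) {X : KFunctor K}
    (hX : IsSuperscheme X) :
    ∃ Y : GeomSuperspace K, IsGeomSuperscheme Y ∧ Nonempty (X ≅ (functorOfPoints K).obj Y) := by
  obtain ⟨𝒜⟩ := nonempty_openAtlas hK hX
  exact ⟨_, 𝒜.isGeomSuperscheme_glued, 𝒜.nonempty_iso_functorOfPoints_glued hX.1⟩

end

/-! ### Geometric realization, unit and counit -/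

section Realization

variable {K : Type u} [Field K] {X : KFunctor K} {Y Z : GeomSuperspace K}

/-- A morphism from `X` to the functor of points of `Y` as a cocone. -/
def realizationCocone (τ : X ⟶ (functorOfPoints K).obj Y) :
    Limits.Cocone (realizationDiagram X) where
  pt := Y
  ι :=
    { app := fun p => τ.app p.unop.1 p.unop.2
      naturality := fun p q g => by
        refine Eq.trans ?_ (Category.comp_id _).symm
        refine (KFunctor.naturality τ g.unop.1 q.unop.2).symm.trans ?_
        exact congrArg (τ.app p.unop.1) g.unop.2 }

/-- The morphism from `X` to the functor of points of the vertex of a cocone. -/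
def realizationPoints (s : Limits.Cocone (realizationDiagram X)) :
    X ⟶ (functorOfPoints K).obj s.pt where
  app R := ↾fun x => s.ι.app (op ⟨R, x⟩)
  naturality R B h := by
    ext x
    let p : X.Elements := ⟨R, x⟩
    let q : X.Elements := ⟨B, X.map h x⟩
    exact (s.w (CategoryOfElements.homMk p q h rfl).op).symm

/-- A geometric superscheme is the geometric realization of its functor of points. -/
def isColimitRealizationCocone (hY : IsGeomSuperscheme Y) (α : X ≅ (functorOfPoints K).obj Y) :
    Limits.IsColimit (realizationCocone α.hom) := by
  -- A cocone is a natural transformation from `X` to the functor of points of its vertex;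
  -- transported along `α`, it comes from a unique morphism out of `Y`.
  have h (s : Limits.Cocone (realizationDiagram X)) :=
    existsUnique_functorOfPoints_map hY (α.inv ≫ realizationPoints s)
  refine { desc := fun s => (h s).choose, fac := fun s p => ?_, uniq := fun s m hm => ?_ }
  · refine ((h s).choose_spec.1 _ _).trans ?_
    exact congrArg ((realizationPoints s).app p.unop.1)
      (ConcreteCategory.congr_hom (α.hom_inv_id_app p.unop.1) p.unop.2)
  · refine (h s).choose_spec.2 m fun B c => ?_
    have e : α.hom.app B (α.inv.app B c) = c :=
      ConcreteCategory.congr_hom (α.inv_hom_id_app B) c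
    exact (congrArg (fun c' : B.sspec ⟶ Y => c' ≫ m) e).symm.trans (hm (op ⟨B, α.inv.app B c⟩))

theorem hasColimit_realizationDiagram (hK : (2 : K) ≠ 0) (hX : IsSuperscheme X) :
    Limits.HasColimit (realizationDiagram X) := by
  obtain ⟨Y, hY, ⟨α⟩⟩ := exists_iso_functorOfPoints hK hX
  exact ⟨⟨⟨_, isColimitRealizationCocone hY α⟩⟩⟩

theorem isGeomSuperscheme_colimit (hK : (2 : K) ≠ 0) (hX : IsSuperscheme X)
    [Limits.HasColimit (realizationDiagram X)] :
    IsGeomSuperscheme (Limits.colimit (realizationDiagram X)) := by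
  obtain ⟨Y, hY, ⟨α⟩⟩ := exists_iso_functorOfPoints hK hX
  exact hY.of_iso ((isColimitRealizationCocone hY α).coconePointUniqueUpToIso
    (Limits.colimit.isColimit _))

/-- The canonical morphism `X ⟶ |X|^◇`. -/
abbrev realizationUnit (X : KFunctor K) [Limits.HasColimit (realizationDiagram X)] :
    X ⟶ (functorOfPoints K).obj (Limits.colimit (realizationDiagram X)) :=
  realizationPoints (Limits.colimit.cocone (realizationDiagram X))

/-- The unit is `α` followed by the image of the canonical isomorphism between the two colimits `Y`
and `|X|`. -/
theorem isIso_realizationUnit (hK : (2 : K) ≠ 0) (hX : IsSuperscheme X)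
    [Limits.HasColimit (realizationDiagram X)] : IsIso (realizationUnit X) := by
  obtain ⟨Y, hY, ⟨α⟩⟩ := exists_iso_functorOfPoints hK hX
  let e := (isColimitRealizationCocone hY α).coconePointUniqueUpToIso
    (Limits.colimit.isColimit (realizationDiagram X))
  have h : realizationUnit X = α.hom ≫ (functorOfPoints K).map e.hom := by
    ext R x
    exact ((isColimitRealizationCocone hY α).comp_coconePointUniqueUpToIso_hom
      (Limits.colimit.isColimit (realizationDiagram X)) (op ⟨R, x⟩)).symm
  exact h ▸ (α ≪≫ (functorOfPoints K).mapIso e).isIso_hom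

/-- The canonical morphism `|Y^◇| ⟶ Y`. -/
def realizationCounit (Y : GeomSuperspace K)
    [Limits.HasColimit (realizationDiagram ((functorOfPoints K).obj Y))] :
    Limits.colimit (realizationDiagram ((functorOfPoints K).obj Y)) ⟶ Y :=
  Limits.colimit.desc _ (realizationCocone (𝟙 ((functorOfPoints K).obj Y)))

theorem realizationι_counit (Y : GeomSuperspace K)
    [Limits.HasColimit (realizationDiagram ((functorOfPoints K).obj Y))] (R : SAlg K)
    (c : R.sspec ⟶ Y) : realizationι ((functorOfPoints K).obj Y) R c ≫ realizationCounit Y = c :=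
  Limits.colimit.ι_desc (realizationCocone (𝟙 ((functorOfPoints K).obj Y))) (op ⟨R, c⟩)

theorem isIso_realizationCounit (hY : IsGeomSuperscheme Y)
    [Limits.HasColimit (realizationDiagram ((functorOfPoints K).obj Y))] :
    IsIso (realizationCounit Y) :=
  ((Limits.colimit.isColimit _).coconePointUniqueUpToIso
    (isColimitRealizationCocone hY (Iso.refl _))).isIso_hom

theorem realizationMap_counit [Limits.HasColimit (realizationDiagram ((functorOfPoints K).obj Y))]
    [Limits.HasColimit (realizationDiagram ((functorOfPoints K).obj Z))] (f : Y ⟶ Z) :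
    realizationMap ((functorOfPoints K).map f) ≫ realizationCounit Z =
      realizationCounit Y ≫ f := by
  refine Limits.colimit.hom_ext fun p => ?_
  have h1 := realizationι_map ((functorOfPoints K).map f) p.unop.1 p.unop.2
  have h2 := realizationι_counit Z p.unop.1 (((functorOfPoints K).map f).app p.unop.1 p.unop.2)
  have h3 := realizationι_counit Y p.unop.1 p.unop.2
  refine (Category.assoc _ _ _).symm.trans ((congrArg (· ≫ realizationCounit Z) h1).trans ?_)
  exact h2.trans ((congrArg (· ≫ f) h3).symm.trans (Category.assoc _ _ _))

end Realization

end

theorem theorem5 (K : Type u) [Field K] (hK : (2 : K) ≠ 0) :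
    ∃ (hcolim : ∀ X : KFunctor K, IsSuperscheme X → Limits.HasColimit (realizationDiagram X))
      (hreal : ∀ X : Superscheme K,
        IsGeomSuperscheme ((geometricRealization IsSuperscheme hcolim).obj X))
      (hpoints : ∀ Y : GeomSuperscheme K, IsSuperscheme ((functorOfPoints K).obj Y.obj))
      (e : Superscheme K ≌ GeomSuperscheme K),
      e.functor = ObjectProperty.lift IsGeomSuperscheme
        (geometricRealization IsSuperscheme hcolim) hreal ∧
      e.inverse = ObjectProperty.lift IsSuperscheme
        (ObjectProperty.ι IsGeomSuperscheme ⋙ functorOfPoints K) hpoints := by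
  have hcolim (X : KFunctor K) (hX : IsSuperscheme X) := hasColimit_realizationDiagram hK hX
  have hreal (X : Superscheme K) :
      IsGeomSuperscheme ((geometricRealization IsSuperscheme hcolim).obj X) :=
    have := hcolim X.obj X.property
    isGeomSuperscheme_colimit hK X.property
  have hpoints (Y : GeomSuperscheme K) : IsSuperscheme ((functorOfPoints K).obj Y.obj) :=
    isSuperscheme_functorOfPoints hK Y.property
  let F : Superscheme K ⥤ GeomSuperscheme K := ObjectProperty.lift IsGeomSuperscheme
    (geometricRealization IsSuperscheme hcolim) hreal
  let G : GeomSuperscheme K ⥤ Superscheme K := ObjectProperty.lift IsSuperscheme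
    (ObjectProperty.ι IsGeomSuperscheme ⋙ functorOfPoints K) hpoints
  let η : 𝟭 (Superscheme K) ≅ F ⋙ G := NatIso.ofComponents
    (fun X =>
      have := hcolim X.obj X.property
      have h := isIso_realizationUnit hK X.property
      ObjectProperty.isoMk _ (@asIso _ _ _ _ (realizationUnit X.obj) h))
    (fun {X X'} f => by
      have := hcolim X.obj X.property
      have := hcolim X'.obj X'.property
      refine ObjectProperty.hom_ext _ ?_
      ext R x
      exact (realizationι_map f.hom R x).symm)
  let ε : G ⋙ F ≅ 𝟭 (GeomSuperscheme K) := NatIso.ofComponents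
    (fun Y =>
      have := hcolim _ (hpoints Y)
      have h := isIso_realizationCounit Y.property
      ObjectProperty.isoMk _ (@asIso _ _ _ _ (realizationCounit Y.obj) h))
    (fun {Y Y'} f => by
      have := hcolim _ (hpoints Y)
      have := hcolim _ (hpoints Y')
      exact ObjectProperty.hom_ext _ (realizationMap_counit f.hom))
  -- `Equivalence.mk` adjusts the unit to obtain the triangle identity but keeps `F` and `G`, so
  -- both equalities hold by definition.
  exact ⟨hcolim, hreal, hpoints, CategoryTheory.Equivalence.mk F G η ε, rfl, rfl⟩
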